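/- Let $k$ be a global function field of characteristic $p$, that is, a finite extension of $\mathbb{F}_q(t)$ for some power $q$ of the prime $p$, let $\mathbb{A}$ be its ring of adèles, in which $k$ is embedded diagonally, and let $\psi:\mathbb{A}\to\mathbb{C}^\times$ be a non-trivial continuous character of the additive group of $\mathbb{A}$ that is trivial on $k$. Let $I$ be a sub-$\mathbb{Z}[\mu_p]$-module of $\mathbb{C}$, where $\mu_p$ is the group of $p$th roots of unity in $\mathbb{C}$. Let $n\geq 2$, let $P_n$ be the mirabolic subgroup of $\mathrm{GL}_n$, made of all matrices whose last row is $(0\ \dots\ 0\ 1)$, let $N$ be the group of upper triangular unipotent $n\times n$ matrices and, for $m\in\{1,\dots,n-1\}$, let $N_{m,n-m}$ be the group of block matrices $\begin{pmatrix}1_m&*\\0&1_{n-m}\end{pmatrix}$. Set $\psi(u)=\psi(u_{1,2}+\dots+u_{n-1,n})$ for $u\in N(\mathbb{A})$, and equip $N(k)\backslash N(\mathbb{A})$ and each $N_{m,n-m}(k)\backslash N_{m,n-m}(\mathbb{A})$ with its Haar measure of total mass $1$, that is, the right-invariant Borel probability measure. Let $\phi:P_n(\mathbb{A})\to\mathbb{C}$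 be a smooth (that is, locally constant) function such that: 1. $\phi(\gamma g)=\phi(g)$ for all $\gamma\in P_n(k)$ and all $g\in P_n(\mathbb{A})$; 2. $\phi$ is cuspidal, in the sense that $$\int_{N_{m,n-m}(k)\backslash N_{m,n-m}(\mathbb{A})}\phi(ug)\,\mathrm{d}u=0$$ for all $g\in P_n(\mathbb{A})$ and all $m\in\{1,\dots,n-1\}$; 3. for all $g\in P_n(\mathbb{A})$, $$\int_{N(k)\backslash N(\mathbb{A})}\psi(u)^{-1}\phi(ug)\,\mathrm{d}u\in I.$$ Then $\phi(g)\in I$ for all $g\in P_n(\mathbb{A})$. -/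

import Mathlib

open scoped RestrictedProduct MatrixGroups

namespace GlobalFunctionField

section Places

open Polynomial IsDedekindDomain

/-- `k` is (isomorphic to) the field of rational functions of a smooth irreducible projective curve
over a finite field, that is, a finite extension of `F(t)` for some finite field `F`. -/
class IsGlobalFunctionField (k : Type*) [Field k] : Prop where
  exists_finite_extension : ∃ (F : Type) (_ : Field F) (_ : Finite F) (_ : Algebra (RatFunc F) k),
    FunctionField F k

theorem finite_valuationSubring_dedekind {B L : Type*} [CommRing B] [IsDedekindDomain B] [Field L]
    [Algebra B L] [IsFractionRing B L] {y : B} (hy : y ≠ 0) :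
    {V : ValuationSubring L | (∀ b : B, algebraMap B L b ∈ V) ∧
      V.valuation (algebraMap B L y) < 1}.Finite := by
  have hfin : {P : HeightOneSpectrum B | P.asIdeal ∣ Ideal.span {y}}.Finite :=
    Ideal.finite_factors (by simpa using hy)
  refine (hfin.image fun P => (P.valuation L).valuationSubring).subset ?_
  rintro V ⟨hB, hyV⟩
  let f : B →+* V := (algebraMap B L).codRestrict V.toSubring hB
  have hf : ∀ b, V.valuation (algebraMap B L b) < 1 ↔
      b ∈ (IsLocalRing.maximalIdeal V).comap f := fun b =>
    (V.valuation_lt_one_iff (f b)).symm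
  have hle : ∀ b, V.valuation (algebraMap B L b) ≤ 1 := fun b => V.valuation_le_one (f b)
  let P : HeightOneSpectrum B := ⟨(IsLocalRing.maximalIdeal V).comap f, inferInstance, by
    intro h
    have := (hf y).1 hyV
    rw [h] at this
    exact hy (by simpa using this)⟩
  have hP : ∀ b, b ∈ P.asIdeal ↔ V.valuation (algebraMap B L b) < 1 := fun b => (hf b).symm
  refine ⟨P, ?_, ?_⟩
  · exact Ideal.dvd_span_singleton.2 ((hP y).2 hyV)
  · have key : ∀ x : L, P.valuation L x ≤ 1 → ∃ a b : B, x * algebraMap B L b = algebraMap B L a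
        ∧ V.valuation (algebraMap B L b) = 1 ∧ P.valuation L (algebraMap B L b) = 1 := by
      intro x hx
      obtain ⟨a, b, h⟩ := P.exists_primeCompl_mul_eq_of_integer x hx
      have hb : (b : B) ∉ P.asIdeal := b.2
      refine ⟨a, b, h, ?_, ?_⟩
      · exact le_antisymm (hle _) (not_lt.1 fun h => hb ((hP _).2 h))
      · exact le_antisymm (P.valuation_le_one _)
          (not_lt.1 fun h => hb ((P.valuation_lt_one_iff_mem _).1 h))
    ext x
    rw [Valuation.mem_valuationSubring_iff]
    constructor
    · intro hx
      obtain ⟨a, b, h, hb, -⟩ := key x hx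
      have := congrArg V.valuation h
      rw [map_mul, hb, mul_one] at this
      exact V.mem_of_valuation_le_one x (this ▸ hle a)
    · intro hx
      by_contra hlt
      rw [not_le] at hlt
      have hx0 : x ≠ 0 := by rintro rfl; simp at hlt
      have hx' : P.valuation L x⁻¹ < 1 := by
        rw [map_inv₀]; exact inv_lt_one_of_one_lt₀ hlt
      obtain ⟨a, b, h, hb, hb'⟩ := key x⁻¹ hx'.le
      have h1 := congrArg V.valuation h
      have h2 := congrArg (P.valuation L) h
      rw [map_mul, hb, mul_one] at h1
      rw [map_mul, hb', mul_one] at h2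
      rw [h2, P.valuation_lt_one_iff_mem, hP, ← h1, map_inv₀] at hx'
      have := (V.valuation_le_one_iff x).2 hx
      have h0 : V.valuation x ≠ 0 := by simpa using hx0
      exact absurd (inv_lt_one₀ (zero_lt_iff.2 h0) |>.1 hx') (not_lt.2 this)

theorem algebraMap_mem_of_finite {F K : Type*} [Field F] [Finite F] [Field K] (i : F →+* K)
    (V : ValuationSubring K) (a : F) : i a ∈ V := by
  by_cases ha : a = 0
  · simp [ha]
  obtain ⟨m, hm, h1⟩ := isOfFinOrder_iff_pow_eq_one.1 (isOfFinOrder_of_finite (Units.mk0 a ha))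
  have h1' : a ^ m = 1 := by simpa using congrArg Units.val h1
  refine V.mem_of_valuation_le_one _ ?_
  have := congrArg (fun z => V.valuation (i z)) h1'
  simp only [map_pow, map_one] at this
  exact (pow_le_one_iff hm.ne').1 this.le

theorem mem_of_isIntegral {R K : Type*} [CommRing R] [Field K] [Algebra R K]
    (V : ValuationSubring K) (hV : ∀ r : R, algebraMap R K r ∈ V) {z : K} (hz : IsIntegral R z) :
    z ∈ V := by
  let g : R →+* V := (algebraMap R K).codRestrict V.toSubring hV
  have hz' : IsIntegral V z := by
    obtain ⟨q, hq, hq'⟩ := hz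
    refine ⟨q.map g, hq.map g, ?_⟩
    rw [eval₂_map]; exact hq'
  obtain ⟨w, hw⟩ := IsIntegrallyClosed.isIntegral_iff.1 hz'
  rw [← hw]; exact w.2

theorem finite_valuationSubring_zeros (F K : Type*) [Field F] [Finite F] [Field K] [Algebra F[X] K]
    [Algebra (FractionRing F[X]) K] [IsScalarTower F[X] (FractionRing F[X]) K]
    [FiniteDimensional (FractionRing F[X]) K] :
    {V : ValuationSubring K | V.valuation (algebraMap F[X] K X) < 1}.Finite := by
  let Q := FractionRing F[X]
  let L := separableClosure Q K
  let : Algebra F[X] L := ((algebraMap Q L).comp (algebraMap F[X] Q)).toAlgebra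
  have : IsScalarTower F[X] Q L := IsScalarTower.of_algebraMap_eq fun _ => rfl
  have : IsScalarTower F[X] L K := IsScalarTower.of_algebraMap_eq fun x => by
    rw [IsScalarTower.algebraMap_apply F[X] Q K, IsScalarTower.algebraMap_apply Q L K]; rfl
  let B := integralClosure F[X] L
  have : IsDedekindDomain B := IsIntegralClosure.isDedekindDomain F[X] Q L B
  have : IsFractionRing B L := IsIntegralClosure.isFractionRing_of_finite_extension F[X] Q L B
  have hinj : Function.Injective (algebraMap F[X] L) :=
    (algebraMap Q L).injective.comp (IsFractionRing.injective F[X] Q)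
  let y : B := algebraMap F[X] B X
  have hyL : algebraMap B L y = algebraMap F[X] L X :=
    (IsScalarTower.algebraMap_apply F[X] B L X).symm
  have hy : y ≠ 0 := by
    intro h
    rw [h, map_zero, eq_comm, map_eq_zero_iff _ hinj] at hyL
    exact X_ne_zero hyL
  refine Set.Finite.of_injOn (f := fun V : ValuationSubring K => V.comap (algebraMap L K)) ?_ ?_
    (finite_valuationSubring_dedekind (L := L) hy)
  · intro V hV
    have hXV : algebraMap F[X] K X ∈ V := V.mem_of_valuation_le_one _ (le_of_lt hV)
    have hpoly : ∀ f : F[X], algebraMap F[X] K f ∈ V := by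
      intro f
      induction f using Polynomial.induction_on' with
      | add p q hp hq => rw [map_add]; exact V.add_mem _ _ hp hq
      | monomial n a =>
        rw [← C_mul_X_pow_eq_monomial, map_mul, map_pow]
        refine V.mul_mem _ _ ?_ (pow_mem hXV n)
        exact algebraMap_mem_of_finite ((algebraMap F[X] K).comp C) V a
    refine ⟨fun b => ?_, ?_⟩
    · exact mem_of_isIntegral V hpoly (b.2.algebraMap : IsIntegral F[X] (algebraMap L K (b : L)))
    · rw [hyL]
      by_contra hlt
      rw [not_lt] at hlt
      have hne : algebraMap F[X] L X ≠ 0 := by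
        rw [Ne, map_eq_zero_iff _ hinj]; exact X_ne_zero
      have hmem : (algebraMap F[X] L X)⁻¹ ∈ V.comap (algebraMap L K) := by
        apply ValuationSubring.mem_of_valuation_le_one
        rw [map_inv₀]; exact inv_le_one_of_one_le₀ hlt
      rw [ValuationSubring.mem_comap, map_inv₀, ← IsScalarTower.algebraMap_apply,
        ← V.valuation_le_one_iff, map_inv₀] at hmem
      have h0 : V.valuation (algebraMap F[X] K X) ≠ 0 := by
        rw [IsScalarTower.algebraMap_apply F[X] L K]; simpa using hne
      exact absurd ((inv_le_one₀ (zero_lt_iff.2 h0)).1 hmem) (not_le.2 hV)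
  · intro V _ W _ h
    obtain ⟨q, _⟩ := ExpChar.exists L
    have : IsPurelyInseparable L K := separableClosure.isPurelyInseparable Q K
    have hq : 0 < q := expChar_pos L q
    ext x
    obtain ⟨n, z, hz⟩ := IsPurelyInseparable.pow_mem L q x
    have hpow : ∀ U : ValuationSubring K, x ∈ U ↔ z ∈ U.comap (algebraMap L K) := by
      intro U
      rw [ValuationSubring.mem_comap, hz, ← U.valuation_le_one_iff, ← U.valuation_le_one_iff,
        map_pow]
      exact (pow_le_one_iff (pow_pos hq n).ne').symm
    rw [hpow V, hpow W]
    exact iff_of_eq (congrArg (z ∈ ·) h)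

/-- An element of a global function field has finitely many poles. -/
theorem finite_valuationSubring_poles (k : Type*) [Field k] [IsGlobalFunctionField k] (x : k) :
    {V : ValuationSubring k | x ∉ V}.Finite := by
  obtain ⟨F, _, _, _, _⟩ := IsGlobalFunctionField.exists_finite_extension (k := k)
  let : Algebra F k := ((algebraMap (RatFunc F) k).comp (algebraMap F (RatFunc F))).toAlgebra
  have : IsScalarTower F (RatFunc F) k := IsScalarTower.of_algebraMap_eq fun _ => rfl
  by_cases hx0 : x = 0
  · subst hx0; simp
  by_cases hx : Transcendental F x⁻¹
  · let : Algebra F[X] k := (aeval x⁻¹ : F[X] →ₐ[F] k).toAlgebra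
    have hinj : Function.Injective (algebraMap F[X] k) := transcendental_iff_injective.1 hx
    have : FaithfulSMul F[X] k := (faithfulSMul_iff_algebraMap_injective _ _).2 hinj
    let : Algebra (FractionRing F[X]) k := FractionRing.liftAlgebra F[X] k
    have : IsScalarTower F[X] (FractionRing F[X]) k := FractionRing.isScalarTower_liftAlgebra ..
    have hfd := FunctionField.finiteDimensional_of_adjoin_transcendental hx
    have : FiniteDimensional (FractionRing F[X]) k := by
      have hsurj : ∀ c ∈ IntermediateField.adjoin F {x⁻¹},
          ∃ q : FractionRing F[X], algebraMap _ k q = c := by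
        intro c hc
        induction hc using IntermediateField.adjoin_induction with
        | mem z hz =>
          rw [Set.mem_singleton_iff] at hz
          refine ⟨algebraMap F[X] _ X, ?_⟩
          rw [← IsScalarTower.algebraMap_apply, hz]; exact aeval_X _
        | algebraMap a =>
          refine ⟨algebraMap F[X] _ (C a), ?_⟩
          rw [← IsScalarTower.algebraMap_apply]; exact aeval_C _ a
        | add a b _ _ ha hb =>
          obtain ⟨a, rfl⟩ := ha; obtain ⟨b, rfl⟩ := hb; exact ⟨a + b, map_add _ _ _⟩
        | inv a _ ha => obtain ⟨a, rfl⟩ := ha; exact ⟨a⁻¹, map_inv₀ _ _⟩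
        | mul a b _ _ ha hb =>
          obtain ⟨a, rfl⟩ := ha; obtain ⟨b, rfl⟩ := hb; exact ⟨a * b, map_mul _ _ _⟩
      obtain ⟨s, hs⟩ := Module.finite_def.1 hfd
      refine ⟨s, eq_top_iff.2 fun z _ => ?_⟩
      have hz : z ∈ Submodule.span (IntermediateField.adjoin F {x⁻¹}) (s : Set k) :=
        hs ▸ Submodule.mem_top
      induction hz using Submodule.span_induction with
      | mem z hz => exact Submodule.subset_span hz
      | zero => exact Submodule.zero_mem _
      | add a b _ _ ha hb => exact Submodule.add_mem _ (ha trivial) (hb trivial)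
      | smul c z _ hz =>
        obtain ⟨q, hq⟩ := hsurj c c.2
        have : c • z = q • z := by
          rw [Algebra.smul_def q, hq]; rfl
        rw [this]; exact Submodule.smul_mem _ _ (hz trivial)
    refine (finite_valuationSubring_zeros F k).subset fun V hV => ?_
    have h1 : algebraMap F[X] k X = x⁻¹ := aeval_X _
    change V.valuation _ < 1
    rw [h1, map_inv₀]
    exact inv_lt_one_of_one_lt₀ (not_le.1 fun h => hV ((V.valuation_le_one_iff x).1 h))
  · convert Set.finite_empty
    ext V
    simp only [Set.mem_ofPred_eq, Set.mem_empty_iff_false, iff_false, not_not]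
    have : IsAlgebraic F x := by
      rw [Transcendental, not_not] at hx; simpa using hx.inv
    exact mem_of_isIntegral V (algebraMap_mem_of_finite (algebraMap F k) V) this.isIntegral

end Places

noncomputable section Adeles

variable (k : Type*) [Field k]

/-- The places of `k`: its valuation rings other than `k` itself. For a global function field these
are the discrete valuation rings attached to the closed points of the curve. -/
abbrev Place : Type _ := {V : ValuationSubring k // V ≠ ⊤}

variable {k} in
/-- The completion of `k` at `v`. -/
abbrev Place.Completion (v : Place k) : Type _ := v.1.valuation.Completion

variable {k} in
/-- The ring of integers of the completion of `k` at `v`. -/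
abbrev Place.integers (v : Place k) : Subring (Place.Completion v) :=
  Valued.integer (Place.Completion v)

/-- The ring of adeles of `k`, with its restricted product topology. -/
abbrev AdeleRing : Type _ := Πʳ v : Place k, [Place.Completion v, Place.integers v]

/-- The diagonal embedding of `k` in its ring of adeles. -/
def diagonal [IsGlobalFunctionField k] : k →+* AdeleRing k where
  toFun x := ⟨fun v => (WithVal.toVal v.1.valuation x : Place.Completion v), by
    rw [Filter.eventually_cofinite]
    refine ((finite_valuationSubring_poles k x).preimage Subtype.val_injective.injOn).subset ?_
    intro v hv hx
    refine hv ?_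
    change Valued.v ((WithVal.toVal v.1.valuation x : WithVal v.1.valuation) : Place.Completion v) ≤ 1
    rw [Valued.valuedCompletion_apply]
    exact (v.1.valuation_le_one_iff x).2 hx⟩
  map_one' := Subtype.ext <| funext fun _ => UniformSpace.Completion.coe_one _
  map_mul' _ _ := Subtype.ext <| funext fun _ => UniformSpace.Completion.coe_mul _ _
  map_zero' := Subtype.ext <| funext fun _ => UniformSpace.Completion.coe_zero
  map_add' _ _ := Subtype.ext <| funext fun _ => UniformSpace.Completion.coe_add _ _

end Adeles

section Groups

variable (n : ℕ) (R : Type*) [CommRing R]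

/-- The mirabolic subgroup of `GL n R`: the last row is `(0, …, 0, 1)`. -/
def mirabolic : Subgroup (GL (Fin n) R) where
  carrier := {g | ∀ i j : Fin n, (i : ℕ) + 1 = n → g.1 i j = (1 : Matrix (Fin n) (Fin n) R) i j}
  one_mem' _ _ _ := rfl
  mul_mem' {a b} ha hb i j hi := by
    rw [Units.val_mul, Matrix.mul_apply]
    simp only [ha i _ hi]
    rw [← Matrix.mul_apply, one_mul]
    exact hb i j hi
  inv_mem' {a} ha i j hi := by
    have h : ((a.1 * a⁻¹.1 : Matrix (Fin n) (Fin n) R)) i j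
        = (1 : Matrix (Fin n) (Fin n) R) i j := by
      rw [← Units.val_mul, mul_inv_cancel, Units.val_one]
    rw [Matrix.mul_apply] at h
    simp only [ha i _ hi] at h
    rwa [← Matrix.mul_apply, one_mul] at h

variable {n R}

/-- The `(i, j)` entry of an element of the mirabolic subgroup. -/
abbrev mirabolic.entry (g : mirabolic n R) (i j : Fin n) : R := g.1.1 i j

variable (n R)

/-- The group `N` of upper triangular unipotent matrices, inside the mirabolic subgroup. -/
def upperUnipotent : Subgroup (mirabolic n R) where
  carrier := {g | (∀ i, mirabolic.entry g i i = 1) ∧ ∀ i j, j < i → mirabolic.entry g i j = 0}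
  one_mem' := ⟨fun i => Matrix.one_apply_eq i, fun i j h => Matrix.one_apply_ne h.ne'⟩
  mul_mem' {a b} ha hb := by
    have hU : ∀ c : mirabolic n R, (∀ i j, j < i → mirabolic.entry c i j = 0) →
      Matrix.BlockTriangular c.1.1 id := fun c hc i j h => hc i j h
    refine ⟨fun i => ?_, fun i j h => ((hU a ha.2).mul (hU b hb.2)) h⟩
    change (a.1.1 * b.1.1) i i = 1
    rw [Matrix.mul_apply, Finset.sum_eq_single i]
    · rw [show a.1.1 i i = 1 from ha.1 i, show b.1.1 i i = 1 from hb.1 i, one_mul]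
    · intro j _ hj
      rcases lt_or_gt_of_ne hj with h | h
      · rw [show a.1.1 i j = 0 from ha.2 i j h, zero_mul]
      · rw [show b.1.1 j i = 0 from hb.2 j i h, mul_zero]
    · simp
  inv_mem' {a} ha := by
    have hU : Matrix.BlockTriangular a.1.1 id := fun i j h => ha.2 i j h
    have hinv : a⁻¹.1.1 = a.1.1⁻¹ := Matrix.coe_units_inv _
    let _ : Invertible a.1.1 := a.1.invertible
    have hU' : Matrix.BlockTriangular a⁻¹.1.1 id := by
      rw [hinv]; exact Matrix.blockTriangular_inv_of_blockTriangular hU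
    refine ⟨fun i => ?_, fun i j h => hU' h⟩
    have h : (a.1.1 * a⁻¹.1.1) i i = 1 := by
      change (a.1 * a.1⁻¹).1 i i = 1
      rw [mul_inv_cancel]; exact Matrix.one_apply_eq i
    rw [Matrix.mul_apply, Finset.sum_eq_single i] at h
    · rwa [show a.1.1 i i = 1 from ha.1 i, one_mul] at h
    · intro j _ hj
      rcases lt_or_gt_of_ne hj with h | h
      · rw [show a.1.1 i j = 0 from ha.2 i j h, zero_mul]
      · rw [hU' h, mul_zero]
    · simp

/-- The unipotent radical `N_{m,n-m}` of the standard parabolic subgroup with Levi subgroup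
`GL_m × GL_{n-m}`: block matrices `(1 *; 0 1)` with diagonal blocks of sizes `m` and `n - m`.
For `m < n` they all lie in the mirabolic subgroup. -/
def unipotentRadical (m : ℕ) : Subgroup (mirabolic n R) where
  carrier := {g | ∀ i j : Fin n, ¬((i : ℕ) < m ∧ m ≤ (j : ℕ)) →
    mirabolic.entry g i j = (1 : Matrix (Fin n) (Fin n) R) i j}
  one_mem' _ _ _ := rfl
  mul_mem' {a b} ha hb i j hij := by
    change (a.1.1 * b.1.1) i j = _
    rw [Matrix.mul_apply]
    by_cases hi : (i : ℕ) < m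
    · have hj : ¬ m ≤ (j : ℕ) := fun h => hij ⟨hi, h⟩
      have : ∀ l, b.1.1 l j = (1 : Matrix (Fin n) (Fin n) R) l j := fun l => hb l j fun h => hj h.2
      simp only [this]
      rw [← Matrix.mul_apply, mul_one]
      exact ha i j hij
    · have : ∀ l, a.1.1 i l = (1 : Matrix (Fin n) (Fin n) R) i l := fun l => ha i l fun h => hi h.1
      simp only [this]
      rw [← Matrix.mul_apply, one_mul]
      exact hb i j hij
  inv_mem' {a} ha i j hij := by
    change a⁻¹.1.1 i j = _
    by_cases hi : (i : ℕ) < m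
    · have hj : ¬ m ≤ (j : ℕ) := fun h => hij ⟨hi, h⟩
      have h : (a⁻¹.1.1 * a.1.1) i j = (1 : Matrix (Fin n) (Fin n) R) i j := by
        change (a.1⁻¹ * a.1).1 i j = _
        rw [inv_mul_cancel]; rfl
      have : ∀ l, a.1.1 l j = (1 : Matrix (Fin n) (Fin n) R) l j := fun l => ha l j fun h => hj h.2
      rw [Matrix.mul_apply] at h
      simp only [this] at h
      rwa [← Matrix.mul_apply, mul_one] at h
    · have h : (a.1.1 * a⁻¹.1.1) i j = (1 : Matrix (Fin n) (Fin n) R) i j := by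
        change (a.1 * a.1⁻¹).1 i j = _
        rw [mul_inv_cancel]; rfl
      have : ∀ l, a.1.1 i l = (1 : Matrix (Fin n) (Fin n) R) i l := fun l => ha i l fun h => hi h.1
      rw [Matrix.mul_apply] at h
      simp only [this] at h
      rwa [← Matrix.mul_apply, one_mul] at h

variable {R} {S : Type*} [CommRing S]

/-- The map induced by a ring homomorphism on mirabolic subgroups. -/
def mirabolicMap (f : R →+* S) : mirabolic n R →* mirabolic n S :=
  ((Matrix.GeneralLinearGroup.map f).comp (mirabolic n R).subtype).codRestrict (mirabolic n S)
    fun g i j hi => by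
      change f (g.1.1 i j) = _
      rw [g.2 i j hi, Matrix.one_apply, Matrix.one_apply]
      split_ifs <;> simp

variable {n} in
/-- The sum `g₁₂ + g₂₃ + … + g_{n-1,n}`. -/
def superdiagonalSum (g : mirabolic n R) : R :=
  ∑ i : Fin n, ∑ j : Fin n, if (i : ℕ) + 1 = (j : ℕ) then mirabolic.entry g i j else 0

end Groups

noncomputable section Quotients

open MeasureTheory

variable {G : Type*} [Group G]

/-- The space `Γ\G` of cosets `Γ g`. -/
def LeftQuotient (Γ : Subgroup G) : Type _ := Quotient (QuotientGroup.rightRel Γ)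

variable (Γ : Subgroup G)

instance [TopologicalSpace G] : TopologicalSpace (LeftQuotient Γ) :=
  inferInstanceAs (TopologicalSpace (Quotient (QuotientGroup.rightRel Γ)))

instance [TopologicalSpace G] : MeasurableSpace (LeftQuotient Γ) := borel _

/-- The action of `h` by right translation on `Γ\G`. -/
def LeftQuotient.rightMul (h : G) : LeftQuotient Γ → LeftQuotient Γ :=
  Quotient.map (· * h) fun a b hab => by
    change QuotientGroup.rightRel Γ _ _
    change QuotientGroup.rightRel Γ a b at hab
    rw [QuotientGroup.rightRel_apply] at hab ⊢
    simpa [mul_assoc] using hab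

/-- A left `Γ`-invariant function on `G`, seen as a function on `Γ\G` by evaluation at an arbitrary
representative. -/
def LeftQuotient.descend (F : G → ℂ) (x : LeftQuotient Γ) : ℂ := F (Quotient.out x)

theorem LeftQuotient.descend_mk (F : G → ℂ) (hF : ∀ γ ∈ Γ, ∀ g, F (γ * g) = F g) (g : G) :
    LeftQuotient.descend Γ F (Quotient.mk (QuotientGroup.rightRel Γ) g) = F g := by
  have h : QuotientGroup.rightRel Γ (Quotient.out (Quotient.mk (QuotientGroup.rightRel Γ) g)) g :=
    Quotient.mk_out g
  rw [QuotientGroup.rightRel_apply] at h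
  have := hF _ h (Quotient.out (Quotient.mk (QuotientGroup.rightRel Γ) g))
  rw [inv_mul_cancel_right] at this
  exact this.symm

/-- `μ` is the Haar measure of total mass `1` on `Γ\G`: the Borel probability measure that is
invariant under right translation by `G`. -/
structure IsHaarProbability [TopologicalSpace G] (μ : Measure (LeftQuotient Γ)) : Prop where
  measure_univ : μ Set.univ = 1
  map_rightMul (h : G) : μ.map (LeftQuotient.rightMul Γ h) = μ

end Quotients

noncomputable section Functions

open MeasureTheory

variable (k : Type*) [Field k] [IsGlobalFunctionField k] (n : ℕ)

/-- The subgroup `N(k)` of `N(𝔸)`. -/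
def rationalUpperUnipotent : Subgroup (upperUnipotent n (AdeleRing k)) :=
  ((upperUnipotent n k).map (mirabolicMap n (diagonal k))).subgroupOf _

/-- The subgroup `N_{m,n-m}(k)` of `N_{m,n-m}(𝔸)`. -/
def rationalUnipotentRadical (m : ℕ) : Subgroup (unipotentRadical n (AdeleRing k) m) :=
  ((unipotentRadical n k m).map (mirabolicMap n (diagonal k))).subgroupOf _

variable {k n}

/-- `φ` is left invariant under the rational points of the mirabolic subgroup. -/
def IsLeftInvariant (φ : mirabolic n (AdeleRing k) → ℂ) : Prop :=
  ∀ (γ : mirabolic n k) (g : mirabolic n (AdeleRing k)),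
    φ (mirabolicMap n (diagonal k) γ * g) = φ g

/-- For `m ∈ {1, …, n-1}`, the integral of `u ↦ φ (u g)` over `N_{m,n-m}(k)\N_{m,n-m}(𝔸)`
vanishes for all `g`. -/
def IsCuspidal (φ : mirabolic n (AdeleRing k) → ℂ) : Prop :=
  ∀ m : ℕ, 1 ≤ m → m < n →
    ∀ μ : Measure (LeftQuotient (rationalUnipotentRadical k n m)), IsHaarProbability _ μ →
      ∀ g : mirabolic n (AdeleRing k),
        ∫ x, LeftQuotient.descend (rationalUnipotentRadical k n m) (fun u => φ (u * g)) x ∂μ = 0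

/-- The Whittaker coefficient `W_φ(g)`: the integral of `ψ(u)⁻¹ φ(u g)` over `N(k)\N(𝔸)`, where
`ψ(u) = ψ(u₁₂ + … + u_{n-1,n})`. -/
def whittaker (ψ : AddChar (AdeleRing k) ℂ)
    (μ : Measure (LeftQuotient (rationalUpperUnipotent k n)))
    (φ : mirabolic n (AdeleRing k) → ℂ) (g : mirabolic n (AdeleRing k)) : ℂ :=
  ∫ x, LeftQuotient.descend (rationalUpperUnipotent k n)
    (fun u => (ψ (superdiagonalSum (u : mirabolic n (AdeleRing k))))⁻¹ * φ (u * g)) x ∂μ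

end Functions

end GlobalFunctionField

namespace GlobalFunctionField

section LocalFiniteness

open Polynomial

theorem polynomial_eq_zero_of_sum_aeval_mul_eq_zero {F K ι : Type*} [Field F] [Field K]
    [Algebra F K] (V : ValuationSubring K) (hF : ∀ a : F, algebraMap F K a ∈ V) {y : K}
    (hy0 : y ≠ 0) (hyV : y ∈ V) (x : ι → K) (hx : ∀ i, x i ∈ V)
    (hind : ∀ (s : Finset ι) (a : ι → F), (∃ w ∈ V, ∑ i ∈ s, algebraMap F K (a i) * x i = y * w) →
      ∀ i ∈ s, a i = 0) (s : Finset ι) (g : ι → F[X])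
    (hg : ∑ i ∈ s, aeval y (g i) * x i = 0) : ∀ i ∈ s, g i = 0 := by
  have haeval : ∀ h : F[X], aeval y h ∈ V := by
    intro h
    induction h using Polynomial.induction_on' with
    | add p q hp hq => rw [map_add]; exact V.add_mem _ _ hp hq
    | monomial n a =>
      rw [aeval_monomial]
      exact V.mul_mem _ _ (hF a) (pow_mem hyV n)
  have key : ∀ h : ι → F[X], ∑ i ∈ s, aeval y (h i) * x i = 0 → ∀ i ∈ s, (h i).coeff 0 = 0 := by
    intro h hh
    refine hind s _ ⟨-∑ i ∈ s, aeval y (h i).divX * x i, ?_, ?_⟩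
    · exact V.neg_mem _ (sum_mem fun i _ => V.mul_mem _ _ (haeval _) (hx i))
    · have h1 : ∀ i, aeval y (h i) = y * aeval y (h i).divX + algebraMap F K ((h i).coeff 0) := by
        intro i
        conv_lhs => rw [← X_mul_divX_add (h i), map_add, map_mul, aeval_X, aeval_C]
      rw [← sub_eq_zero, ← hh, mul_neg, sub_neg_eq_add, Finset.mul_sum, ← Finset.sum_add_distrib]
      refine Finset.sum_congr rfl fun i _ => ?_
      rw [h1 i]; ring
  have hdiv : ∀ N : ℕ, ∀ i ∈ s, X ^ N ∣ g i := by
    intro N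
    induction N with
    | zero => intro i _; simp
    | succ N ih =>
      choose! h hh using ih
      have h2 : ∑ i ∈ s, aeval y (h i) * x i = 0 := by
        have : y ^ N * ∑ i ∈ s, aeval y (h i) * x i = 0 := by
          rw [← hg, Finset.mul_sum]
          refine Finset.sum_congr rfl fun i hi => ?_
          rw [hh i hi, map_mul, map_pow, aeval_X, mul_assoc]
        exact (mul_eq_zero.1 this).resolve_left (pow_ne_zero _ hy0)
      intro i hi
      have h3 := X_dvd_iff.2 (key h h2 i hi)
      rw [hh i hi, pow_succ]
      exact mul_dvd_mul_left _ h3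
  intro i hi
  by_contra h0
  have := natDegree_le_of_dvd (hdiv ((g i).natDegree + 1) i hi) h0
  simp at this

variable {k : Type*} [Field k]

theorem Place.exists_ne_zero_lt_one (v : Place k) : ∃ s : k, s ≠ 0 ∧ v.1.valuation s < 1 := by
  obtain ⟨x, hx⟩ : ∃ x, x ∉ v.1 := by
    by_contra! h
    exact v.2 (eq_top_iff.2 fun x _ => h x)
  have hx' : 1 < v.1.valuation x := not_le.1 fun h => hx ((v.1.valuation_le_one_iff x).1 h)
  refine ⟨x⁻¹, inv_ne_zero ?_, ?_⟩
  · rintro rfl; simp at hx'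
  · rw [map_inv₀]; exact inv_lt_one_of_one_lt₀ hx'

theorem isAlgebraic_of_forall_mem (F : Type*) [Field F] [Algebra F k] {x : k}
    (h : ∀ v : Place k, x ∈ v.1) : IsAlgebraic F x := by
  by_cases hx0 : x = 0
  · rw [hx0]; exact isAlgebraic_zero
  have hmem : ∀ V : ValuationSubring k, x ∈ V := fun V => by
    by_cases hV : V = ⊤
    · rw [hV]; trivial
    · exact h ⟨V, hV⟩
  have hint : IsIntegral (Subring.closure {x⁻¹}) x := by
    have : x ∈ (⨅ V : {V : ValuationSubring k // {x⁻¹} ⊆ (V.toSubring : Set k)},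
        V.1.toSubring) := Subring.mem_iInf.2 fun V => hmem V.1
    rw [iInf_valuationSubring_superset] at this
    exact this
  obtain ⟨q, hq, hq'⟩ := hint
  have hG : ∀ c : Subring.closure {x⁻¹}, ∃ G : F[X], aeval x⁻¹ G = (c : k) := fun c => by
    have hle : Subring.closure {x⁻¹} ≤ (aeval (R := F) x⁻¹).range.toSubring :=
      Subring.closure_le.2 (Set.singleton_subset_iff.2 ⟨X, aeval_X _⟩)
    exact hle c.2
  choose G hG using hG
  set n := q.natDegree with hn
  let H : F[X] := 1 + ∑ i ∈ Finset.range n, G (q.coeff i) * X ^ (n - i)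
  have hH0 : H ≠ 0 := by
    intro h0
    have := congrArg (fun f => coeff f 0) h0
    have h1 : ∑ i ∈ Finset.range n, (G (q.coeff i) * X ^ (n - i)).coeff 0 = 0 :=
      Finset.sum_eq_zero fun i hi => by
        rw [mul_coeff_zero, coeff_X_pow, if_neg (by have := Finset.mem_range.1 hi; omega),
          mul_zero]
    simp only [H, coeff_add, finsetSum_coeff, h1, coeff_one_zero, add_zero, coeff_zero] at this
    exact one_ne_zero this
  have hH : aeval x⁻¹ H = 0 := by
    have h2 : ∑ i ∈ Finset.range (n + 1), ((q.coeff i : Subring.closure {x⁻¹}) : k) * x ^ i = 0 := by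
      rw [← hq', eval₂_eq_sum_range]
      rfl
    rw [Finset.sum_range_succ, hn, hq.coeff_natDegree, ← hn] at h2
    have h3 : aeval x⁻¹ H = x⁻¹ ^ n * 0 := by
      rw [← h2, mul_add, Finset.mul_sum, map_add, map_sum, map_one, OneMemClass.coe_one, one_mul,
        ← mul_pow, inv_mul_cancel₀ hx0, one_pow, add_comm]
      congr 1
      refine Finset.sum_congr rfl fun i hi => ?_
      have hi' : i < n := Finset.mem_range.1 hi
      rw [map_mul, hG, map_pow, aeval_X, ← Nat.sub_add_cancel hi'.le, pow_add x⁻¹ (n - i) i,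
        Nat.sub_add_cancel hi'.le, mul_mul_mul_comm, mul_comm (x⁻¹ ^ (n - i)), mul_assoc,
        ← mul_pow, inv_mul_cancel₀ hx0]
      ring
    rw [h3, mul_zero]
  have : IsAlgebraic F x⁻¹ := ⟨H, hH0, hH⟩
  simpa using this.inv

variable [IsGlobalFunctionField k]

open scoped IntermediateField.algebraAdjoinAdjoin in
theorem finite_quotient_span (V : ValuationSubring k) {y : V} (hy : y ≠ 0) :
    Finite (V ⧸ Ideal.span {y}) := by
  by_cases hu : IsUnit y
  · rw [Ideal.span_singleton_eq_top.2 hu]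
    have : Subsingleton (V ⧸ (⊤ : Ideal V)) := Ideal.Quotient.subsingleton_iff.2 rfl
    infer_instance
  obtain ⟨F, _, _, _, _⟩ := IsGlobalFunctionField.exists_finite_extension (k := k)
  let : Algebra F k := ((algebraMap (RatFunc F) k).comp (algebraMap F (RatFunc F))).toAlgebra
  have : IsScalarTower F (RatFunc F) k := IsScalarTower.of_algebraMap_eq fun _ => rfl
  have hF : ∀ a : F, algebraMap F k a ∈ V := algebraMap_mem_of_finite (algebraMap F k) V
  let i : F →+* V := (algebraMap F k).codRestrict V.toSubring hF
  let : Algebra F V := i.toAlgebra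
  have hy0 : (y : k) ≠ 0 := by simpa using hy
  have htr : Transcendental F (y : k) := by
    intro halg
    refine hu ?_
    have hinv : (y : k)⁻¹ ∈ V := mem_of_isIntegral V hF halg.inv.isIntegral
    exact IsUnit.of_mul_eq_one ⟨_, hinv⟩ (Subtype.ext (mul_inv_cancel₀ hy0))
  have hfd := FunctionField.finiteDimensional_of_adjoin_transcendental htr
  let b := Module.Basis.ofVectorSpace F (V ⧸ Ideal.span {y})
  choose x hx using fun j => Ideal.Quotient.mk_surjective (I := Ideal.span {y}) (b j)
  have hsmul : ∀ (a : F) (z : V), Ideal.Quotient.mk (Ideal.span {y}) (i a * z)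
      = a • Ideal.Quotient.mk (Ideal.span {y}) z := by
    intro a z
    rw [map_mul, Algebra.smul_def]; rfl
  have hlin : LinearIndependent (Algebra.adjoin F {(y : k)}) (fun j => (x j : k)) := by
    rw [linearIndependent_iff']
    intro s c hc
    have hc' : ∀ j, ∃ g : F[X], aeval (y : k) g = c j := fun j => by
      have h : ((c j : Algebra.adjoin F {(y : k)}) : k) ∈ (aeval (R := F) (y : k)).range :=
        Algebra.adjoin_singleton_eq_range_aeval F (y : k) ▸ (c j).2
      exact h
    choose g hg using hc'
    have := polynomial_eq_zero_of_sum_aeval_mul_eq_zero V hF hy0 y.2 (fun j => (x j : k))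
      (fun j => (x j).2) ?_ s g ?_
    · intro j hj
      have h1 := hg j
      rw [this j hj, map_zero] at h1
      exact Subtype.ext h1.symm
    · rintro t a ⟨w, hw, hsum⟩
      have h1 : ∑ j ∈ t, i (a j) * x j = y * ⟨w, hw⟩ := by
        apply Subtype.ext
        refine Eq.trans ?_ hsum
        push_cast
        rfl
      have h2 := congrArg (Ideal.Quotient.mk (Ideal.span {y})) h1
      rw [map_sum, Ideal.Quotient.eq_zero_iff_mem.2 (Ideal.mul_mem_right _ _
        (Ideal.mem_span_singleton_self y))] at h2
      simp only [hsmul, hx] at h2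
      exact linearIndependent_iff'.1 b.linearIndependent t a h2
    · rw [← hc]
      refine Finset.sum_congr rfl fun j _ => ?_
      rw [hg j]; rfl
  have hlin' := (LinearIndependent.iff_fractionRing (Algebra.adjoin F {(y : k)})
    (IntermediateField.adjoin F {(y : k)})).1 hlin
  have hfin := hlin'.finite
  have : Module.Finite F (V ⧸ Ideal.span {y}) := Module.Finite.of_basis b
  exact Module.finite_of_finite F

theorem exists_pow_sub_pow_eq_mul (V : ValuationSubring k) {x y : k} (hx : x ∈ V) (hy : y ∈ V)
    (hy0 : y ≠ 0) : ∃ i j : ℕ, 0 < j ∧ ∃ w ∈ V, x ^ i - x ^ (i + j) = y * w := by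
  have hy' : (⟨y, hy⟩ : V) ≠ 0 := fun h => hy0 (congrArg Subtype.val h)
  have := finite_quotient_span V hy'
  obtain ⟨i, j, hij, h⟩ := Finite.exists_ne_map_eq_of_infinite
    (fun n : ℕ => Ideal.Quotient.mk (Ideal.span {(⟨y, hy⟩ : V)}) (⟨x, hx⟩ ^ n))
  wlog hlt : i < j generalizing i j
  · exact this j i hij.symm h.symm (by omega)
  obtain ⟨w, hw⟩ := Ideal.mem_span_singleton.1 (Ideal.Quotient.eq.1 h)
  refine ⟨i, j - i, by omega, w, w.2, ?_⟩
  rw [show i + (j - i) = j by omega]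
  simpa using congrArg Subtype.val hw

theorem exists_valuation_pow_le (V : ValuationSubring k) {x y : k} (hx : V.valuation x < 1)
    (hy0 : y ≠ 0) : ∃ N : ℕ, ∀ n, N ≤ n → V.valuation (x ^ n) ≤ V.valuation y := by
  have hxV : x ∈ V := (V.valuation_le_one_iff x).1 hx.le
  suffices h : ∃ N : ℕ, V.valuation (x ^ N) ≤ V.valuation y by
    obtain ⟨N, hN⟩ := h
    refine ⟨N, fun n hn => ?_⟩
    rw [← Nat.sub_add_cancel hn, pow_add, map_mul]
    exact (mul_le_mul_left (V.valuation_le_one_iff _ |>.2 (pow_mem hxV _)) _).trans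
      (by rwa [one_mul])
  rcases le_or_gt 1 (V.valuation y) with h1 | h1
  · exact ⟨0, by simpa using h1⟩
  obtain ⟨i, j, hj, w, hw, h⟩ := exists_pow_sub_pow_eq_mul V hxV
    ((V.valuation_le_one_iff y).1 h1.le) hy0
  refine ⟨i, ?_⟩
  have h2 : V.valuation (1 - x ^ j) = 1 := by
    apply Valuation.map_one_sub_of_lt
    rw [map_pow]
    exact pow_lt_one' hx hj.ne'
  have h3 := congrArg V.valuation h
  rw [pow_add, ← mul_one_sub, map_mul, h2, mul_one, map_mul] at h3
  rw [h3]
  exact mul_le_of_le_one_right' ((V.valuation_le_one_iff w).2 hw)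

theorem exists_pow_sub_one_lt (v : Place k) {u : k} (hu : v.1.valuation u = 1) :
    ∃ M : ℕ, 0 < M ∧ ∀ n, v.1.valuation (u ^ (M * n) - 1) < 1 := by
  obtain ⟨s, hs0, hs⟩ := v.exists_ne_zero_lt_one
  obtain ⟨i, j, hj, w, hw, h⟩ := exists_pow_sub_pow_eq_mul v.1
    ((v.1.valuation_le_one_iff u).1 hu.le) ((v.1.valuation_le_one_iff s).1 hs.le) hs0
  have h1 : v.1.valuation (u ^ j - 1) < 1 := by
    have h3 := congrArg v.1.valuation h
    rw [pow_add, ← mul_one_sub, map_mul, map_pow, hu, one_pow, one_mul, map_mul] at h3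
    rw [Valuation.map_sub_swap, h3]
    exact mul_lt_one_of_lt_of_le hs ((v.1.valuation_le_one_iff w).2 hw)
  refine ⟨j, hj, fun n => ?_⟩
  obtain ⟨c, hc⟩ : ∃ c ∈ v.1, (u ^ j) ^ n - 1 = (u ^ j - 1) * c :=
    ⟨∑ i ∈ Finset.range n, (u ^ j) ^ i, sum_mem fun i _ => pow_mem (pow_mem
      ((v.1.valuation_le_one_iff u).1 hu.le) _) _, (mul_geom_sum _ _).symm⟩
  rw [pow_mul, hc.2, map_mul]
  exact mul_lt_one_of_lt_of_le h1 ((v.1.valuation_le_one_iff c).2 hc.1)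

theorem Place.not_le_of_ne {v w : Place k} (h : v ≠ w) : ¬ v.1 ≤ w.1 := by
  intro hle
  obtain ⟨x, hxw, hxv⟩ : ∃ x ∈ w.1, x ∉ v.1 := by
    by_contra! h'
    exact h (Subtype.ext (le_antisymm hle h'))
  obtain ⟨z, hz⟩ : ∃ z, z ∉ w.1 := by
    by_contra! h'
    exact w.2 (eq_top_iff.2 fun x _ => h' x)
  have hx1 : 1 < v.1.valuation x := not_le.1 fun h => hxv ((v.1.valuation_le_one_iff x).1 h)
  have hx0 : x ≠ 0 := by rintro rfl; simp at hx1
  have hz0 : z ≠ 0 := by rintro rfl; simp at hz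
  obtain ⟨N, hN⟩ := exists_valuation_pow_le v.1 (x := x⁻¹) (y := z⁻¹)
    (by rw [map_inv₀]; exact inv_lt_one_of_one_lt₀ hx1) (inv_ne_zero hz0)
  have h1 : z * x⁻¹ ^ N ∈ v.1 := by
    rw [← v.1.valuation_le_one_iff, map_mul]
    refine (mul_le_mul_right (hN N le_rfl) _).trans ?_
    rw [← map_mul, mul_inv_cancel₀ hz0, map_one]
  refine hz ?_
  have h2 := w.1.mul_mem _ _ (hle h1) (pow_mem hxw N)
  rwa [mul_assoc, ← mul_pow, inv_mul_cancel₀ hx0, one_pow, mul_one] at h2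

/-- A nonzero element of `k` that is integral at all places is a unit at all places. -/
theorem eq_zero_of_forall_mem_of_lt_one {x : k} (h : ∀ v : Place k, x ∈ v.1) (v₀ : Place k)
    (h₀ : v₀.1.valuation x < 1) : x = 0 := by
  by_contra hx0
  obtain ⟨F, _, _, _, _⟩ := IsGlobalFunctionField.exists_finite_extension (k := k)
  let : Algebra F k := ((algebraMap (RatFunc F) k).comp (algebraMap F (RatFunc F))).toAlgebra
  have hF : ∀ (V : ValuationSubring k) (a : F), algebraMap F k a ∈ V :=
    algebraMap_mem_of_finite (algebraMap F k)
  have halg : IsAlgebraic F x := isAlgebraic_of_forall_mem F h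
  have hinv : x⁻¹ ∈ v₀.1 := mem_of_isIntegral v₀.1 (hF v₀.1) halg.inv.isIntegral
  have h1 := (v₀.1.valuation_le_one_iff _).2 hinv
  rw [map_inv₀] at h1
  have h0 : v₀.1.valuation x ≠ 0 := by simpa using hx0
  exact absurd ((inv_le_one₀ (zero_lt_iff.2 h0)).1 h1) (not_le.2 h₀)

instance countable_globalFunctionField : Countable k := by
  obtain ⟨F, _, _, _, hfd⟩ := IsGlobalFunctionField.exists_finite_extension (k := k)
  have h1 : Countable F[X] :=
    Cardinal.mk_le_aleph0_iff.1 (cardinalMk_le_max.trans (max_le Cardinal.mk_le_aleph0 le_rfl))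
  have h2 : Countable (RatFunc F) :=
    (IsLocalization.mk'_surjective (nonZeroDivisors F[X]) (S := RatFunc F)).countable
  have : FiniteDimensional (RatFunc F) k := hfd
  let b := Module.finBasis (RatFunc F) k
  exact b.equivFun.injective.countable

instance countable_place : Countable (Place k) := by
  have : (Set.univ : Set (Place k)) ⊆ ⋃ x : k, {v : Place k | x ∉ v.1} := fun v _ => by
    obtain ⟨x, hx⟩ : ∃ x, x ∉ v.1 := by
      by_contra! h
      exact v.2 (eq_top_iff.2 fun x _ => h x)
    exact Set.mem_iUnion.2 ⟨x, hx⟩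
  refine Set.countable_univ_iff.1 (Set.Countable.mono this (Set.countable_iUnion fun x => ?_))
  exact ((finite_valuationSubring_poles k x).preimage Subtype.val_injective.injOn).countable

end LocalFiniteness

section WeakApproximation

variable {k : Type*} [Field k] [IsGlobalFunctionField k]

theorem exists_forall_mem_valuation_pow_le (T : Finset (Place k)) (x : k) (y : Place k → k)
    (hx : ∀ v ∈ T, v.1.valuation x < 1) (hy : ∀ v ∈ T, y v ≠ 0) :
    ∃ N : ℕ, ∀ n, N ≤ n → ∀ v ∈ T, v.1.valuation (x ^ n) ≤ v.1.valuation (y v) := by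
  choose! N hN using fun v (hv : v ∈ T) => exists_valuation_pow_le v.1 (hx v hv) (hy v hv)
  exact ⟨T.sup N, fun n hn v hv => hN v hv n ((Finset.le_sup hv).trans hn)⟩

theorem exists_forall_mem_pow_sub_one_lt (T : Finset (Place k)) (u : k) :
    ∃ M : ℕ, 0 < M ∧ ∀ n, ∀ v ∈ T, v.1.valuation u = 1 → v.1.valuation (u ^ (M * n) - 1) < 1 := by
  have h : ∀ v : Place k, ∃ M : ℕ, 0 < M ∧
      (v.1.valuation u = 1 → ∀ n, v.1.valuation (u ^ (M * n) - 1) < 1) := fun v => by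
    by_cases hv : v.1.valuation u = 1
    · obtain ⟨M, hM, h⟩ := exists_pow_sub_one_lt v hv
      exact ⟨M, hM, fun _ => h⟩
    · exact ⟨1, one_pos, fun h => absurd h hv⟩
  choose M hM h using h
  refine ⟨∏ v ∈ T, M v, Finset.prod_pos fun v _ => hM v, fun n v hv hu => ?_⟩
  obtain ⟨c, hc⟩ := Finset.dvd_prod_of_mem M hv
  rw [hc, mul_assoc]
  exact h v hu _

theorem exists_approx_one_zero_integral {v w : Place k} (hvw : v ≠ w) (T : Finset (Place k)) :
    ∃ e : k, v.1.valuation (e - 1) < 1 ∧ w.1.valuation e < 1 ∧ ∀ u ∈ T, u.1.valuation e ≤ 1 := by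
  obtain ⟨x, hxv, hxw⟩ := Set.not_subset.1 (Place.not_le_of_ne hvw)
  obtain ⟨y, hyw, hyv⟩ := Set.not_subset.1 (Place.not_le_of_ne hvw.symm)
  have hxv' : v.1.valuation x ≤ 1 := (v.1.valuation_le_one_iff x).2 hxv
  have hyw' : w.1.valuation y ≤ 1 := (w.1.valuation_le_one_iff y).2 hyw
  have hxw' : 1 < w.1.valuation x := not_le.1 fun h => hxw ((w.1.valuation_le_one_iff x).1 h)
  have hyv' : 1 < v.1.valuation y := not_le.1 fun h => hyv ((v.1.valuation_le_one_iff y).1 h)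
  have hx0 : x ≠ 0 := by rintro rfl; simp at hxw'
  have hy0 : y ≠ 0 := by rintro rfl; simp at hyv'
  obtain ⟨M, hM, hMu⟩ := exists_forall_mem_pow_sub_one_lt T (y / x)
  set z := (y / x) ^ M with hz
  have hz0 : z ≠ 0 := pow_ne_zero _ (div_ne_zero hy0 hx0)
  have hzv : v.1.valuation z⁻¹ < 1 := by
    rw [hz, ← inv_pow, map_pow, inv_div, map_div₀]
    refine pow_lt_one' ((div_lt_one₀ (zero_lt_one.trans hyv')).2 (hxv'.trans_lt hyv')) hM.ne'
  have hzw : w.1.valuation z < 1 := by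
    rw [hz, map_pow, map_div₀]
    refine pow_lt_one' ((div_lt_one₀ (zero_lt_one.trans hxw')).2 (hyw'.trans_lt hxw')) hM.ne'
  have hsmall : ∀ u : Place k, u.1.valuation z < 1 →
      u.1.valuation (z ^ 2 / (1 - z + z ^ 2)) < 1 := fun u hu => by
    have h1 : u.1.valuation (1 - z * (1 - z)) = 1 := by
      apply Valuation.map_one_sub_of_lt
      rw [map_mul, Valuation.map_one_sub_of_lt _ hu, mul_one]; exact hu
    rw [show 1 - z + z ^ 2 = 1 - z * (1 - z) by ring, map_div₀, h1, div_one, map_pow]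
    exact pow_lt_one' hu two_ne_zero
  have hlarge : ∀ u : Place k, u.1.valuation z⁻¹ < 1 →
      u.1.valuation (z ^ 2 / (1 - z + z ^ 2) - 1) < 1 := fun u hu => by
    have h2 := Valuation.map_one_sub_of_lt u.1.valuation hu
    have h1 : u.1.valuation (1 - z⁻¹ * (1 - z⁻¹)) = 1 := by
      apply Valuation.map_one_sub_of_lt
      rw [map_mul, h2, mul_one]; exact hu
    have h0 : 1 - z⁻¹ * (1 - z⁻¹) ≠ 0 := fun h => by simp [h] at h1
    have h3 : 1 - z + z ^ 2 = z ^ 2 * (1 - z⁻¹ * (1 - z⁻¹)) := by field_simp; ring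
    have h4 : z ^ 2 / (1 - z + z ^ 2) - 1 = z⁻¹ * (1 - z⁻¹) / (1 - z⁻¹ * (1 - z⁻¹)) := by
      rw [h3, ← div_div, div_self (pow_ne_zero 2 hz0), div_sub_one h0]
      congr 1; ring
    rw [h4, map_div₀, h1, div_one, map_mul, h2, mul_one]
    exact hu
  refine ⟨z ^ 2 / (1 - z + z ^ 2), hlarge v hzv, hsmall w hzw, fun u hu => ?_⟩
  rcases lt_trichotomy (u.1.valuation z) 1 with h | h | h
  · exact (hsmall u h).le
  · have h' : u.1.valuation (y / x) = 1 := by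
      rw [hz, map_pow] at h
      exact (pow_eq_one_iff.1 h).resolve_right hM.ne'
    have h1 : u.1.valuation (z - 1) < 1 := by simpa using hMu 1 u hu h'
    have h2 : u.1.valuation (1 + z * (z - 1)) = 1 := by
      apply Valuation.map_one_add_of_lt
      rw [map_mul, h, one_mul]; exact h1
    rw [show 1 - z + z ^ 2 = 1 + z * (z - 1) by ring, map_div₀, h2, div_one, map_pow, h, one_pow]
  · have := hlarge u (by rw [map_inv₀]; exact inv_lt_one_of_one_lt₀ h)
    rw [← sub_add_cancel (z ^ 2 / (1 - z + z ^ 2)) 1]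
    exact (Valuation.map_add _ _ _).trans (max_le this.le (by simp))

theorem exists_approx_one_zero (v : Place k) (T : Finset (Place k)) (hT : v ∉ T) :
    ∃ e : k, v.1.valuation (e - 1) < 1 ∧ ∀ w ∈ T, w.1.valuation e < 1 := by
  choose! e he1 he2 he3 using fun w (hw : w ∈ T) =>
    exists_approx_one_zero_integral (v := v) (w := w) (fun h => hT (h ▸ hw)) T
  refine ⟨∏ w ∈ T, e w, ?_, fun w hw => ?_⟩
  · refine Finset.prod_induction e (fun a => v.1.valuation (a - 1) < 1) (fun a b ha hb => ?_)
      (by simp) he1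
    have hb' : v.1.valuation b ≤ 1 := by
      rw [← sub_add_cancel b 1]
      exact (Valuation.map_add _ _ _).trans (max_le hb.le (by simp))
    rw [show a * b - 1 = (a - 1) * b + (b - 1) by ring]
    refine (Valuation.map_add _ _ _).trans_lt (max_lt ?_ hb)
    rw [map_mul]
    exact mul_lt_one_of_lt_of_le ha hb'
  · classical
    rw [← Finset.mul_prod_erase T e hw, map_mul, map_prod]
    refine mul_lt_one_of_lt_of_le (he2 w hw) (Finset.prod_le_one' fun u hu => ?_)
    exact he3 u (Finset.mem_of_mem_erase hu) w hw

theorem exists_close_one_close_zero (v : Place k) (T : Finset (Place k)) (hT : v ∉ T) (c : k)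
    (hc : c ≠ 0) : ∃ f : k, v.1.valuation (f - 1) ≤ v.1.valuation c ∧
      ∀ w ∈ T, w.1.valuation f ≤ w.1.valuation c := by
  obtain ⟨e, he1, he2⟩ := exists_approx_one_zero v T hT
  obtain ⟨N₁, h₁⟩ := exists_forall_mem_valuation_pow_le T e (fun _ => c) he2 fun _ _ => hc
  have hev : e ∈ v.1 := by
    rw [← sub_add_cancel e 1]
    exact v.1.add_mem _ _ ((v.1.valuation_le_one_iff _).1 he1.le) v.1.one_mem
  have he3 : v.1.valuation (1 - e ^ N₁) < 1 := by
    rw [Valuation.map_sub_swap, ← mul_geom_sum, map_mul]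
    exact mul_lt_one_of_lt_of_le he1 ((v.1.valuation_le_one_iff _).2
      (sum_mem fun i _ => pow_mem hev i))
  obtain ⟨N₂, h₂⟩ := exists_valuation_pow_le v.1 he3 hc
  refine ⟨1 - (1 - e ^ N₁) ^ N₂, ?_, fun w hw => ?_⟩
  · rw [Valuation.map_sub_swap, sub_sub_cancel]
    exact h₂ N₂ le_rfl
  · have hew : e ∈ w.1 := (w.1.valuation_le_one_iff _).1 (he2 w hw).le
    rw [Valuation.map_sub_swap, ← mul_geom_sum, map_mul, sub_sub_cancel_left, Valuation.map_neg]
    refine (mul_le_of_le_one_right' ((w.1.valuation_le_one_iff _).2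
      (sum_mem fun i _ => pow_mem (w.1.sub_mem w.1.one_mem (pow_mem hew _)) i))).trans
      (h₁ N₁ le_rfl w hw)

/-- The weak approximation theorem. -/
theorem weak_approximation (T : Finset (Place k)) (y : Place k → k) :
    ∃ x : k, ∀ v ∈ T, v.1.valuation (x - y v) ≤ 1 := by
  classical
  have h : ∀ v ∈ T, ∃ f : k, v.1.valuation (y v * f - y v) ≤ 1 ∧
      ∀ w ∈ T.erase v, w.1.valuation (y v * f) ≤ 1 := fun v hv => by
    by_cases h0 : y v = 0
    · exact ⟨0, by simp [h0]⟩
    obtain ⟨f, h1, h2⟩ := exists_close_one_close_zero v (T.erase v) (Finset.notMem_erase v T)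
      (y v)⁻¹ (inv_ne_zero h0)
    have h3 : ∀ w : Place k, w.1.valuation (y v) * w.1.valuation (y v)⁻¹ = 1 := fun w => by
      rw [← map_mul, mul_inv_cancel₀ h0, map_one]
    refine ⟨f, ?_, fun w hw => ?_⟩
    · rw [← mul_sub_one, map_mul, ← h3 v]
      exact mul_le_mul_right h1 _
    · rw [map_mul, ← h3 w]
      exact mul_le_mul_right (h2 w hw) _
  choose! f hf1 hf2 using h
  refine ⟨∑ w ∈ T, y w * f w, fun v hv => ?_⟩
  rw [← Finset.add_sum_erase T _ hv, add_sub_right_comm]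
  refine (Valuation.map_add _ _ _).trans (max_le (hf1 v hv) ?_)
  refine Valuation.map_sum_le _ fun w hw => ?_
  exact hf2 w (Finset.mem_of_mem_erase hw) v (Finset.mem_erase.2
    ⟨(Finset.ne_of_mem_erase hw).symm, hv⟩)

theorem exists_integral_lt_one {t : k} (ht : ∃ v : Place k, t ∉ v.1) (T : Finset (Place k))
    (hT : ∀ v ∈ T, t ∈ v.1) :
    ∃ P : k, P ≠ 0 ∧ (∀ v : Place k, t ∈ v.1 → P ∈ v.1) ∧ ∀ v ∈ T, v.1.valuation P < 1 := by
  obtain ⟨v₀, hv₀⟩ := ht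
  have h : ∀ v ∈ T, ∃ P : k, P ≠ 0 ∧ (∀ w : Place k, t ∈ w.1 → P ∈ w.1) ∧
      v.1.valuation P < 1 := fun v hv => by
    obtain ⟨s, hs0, hs⟩ := v.exists_ne_zero_lt_one
    obtain ⟨i, j, hj, w, hw, h⟩ := exists_pow_sub_pow_eq_mul v.1 (hT v hv)
      ((v.1.valuation_le_one_iff s).1 hs.le) hs0
    refine ⟨t ^ i - t ^ (i + j), fun h0 => hv₀ ?_, fun u hu => u.1.sub_mem (pow_mem hu _)
      (pow_mem hu _), ?_⟩
    · rw [pow_add, ← mul_one_sub, mul_eq_zero, pow_eq_zero_iff', sub_eq_zero] at h0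
      rcases h0 with h0 | h0
      · rw [h0.1]; exact v₀.1.zero_mem
      · have := congrArg v₀.1.valuation h0
        rw [map_one, map_pow, eq_comm] at this
        exact (v₀.1.valuation_le_one_iff t).1 ((pow_eq_one_iff.1 this).resolve_right hj.ne').le
    · rw [h, map_mul]
      exact mul_lt_one_of_lt_of_le hs ((v.1.valuation_le_one_iff w).2 hw)
  choose! P hP0 hP1 hP2 using h
  refine ⟨∏ v ∈ T, P v, Finset.prod_ne_zero_iff.2 hP0, fun w hw => prod_mem fun v hv =>
    hP1 v hv w hw, fun v hv => ?_⟩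
  classical
  rw [← Finset.mul_prod_erase T P hv, map_mul]
  refine mul_lt_one_of_lt_of_le (hP2 v hv) ((v.1.valuation_le_one_iff _).2 (prod_mem fun u hu =>
    hP1 u (Finset.mem_of_mem_erase hu) v (hT v hv)))

/-- Strong approximation away from the poles of `t`. -/
theorem strong_approximation {t : k} (ht : ∃ v : Place k, t ∉ v.1) (T : Finset (Place k))
    (hT : ∀ v ∈ T, t ∈ v.1) (y : Place k → k) :
    ∃ x : k, (∀ v ∈ T, v.1.valuation (x - y v) ≤ 1) ∧ ∀ v ∉ T, t ∈ v.1 → x ∈ v.1 := by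
  classical
  have hfin : ∀ x : k, {v : Place k | x ∉ v.1}.Finite := fun x =>
    (finite_valuationSubring_poles k x).preimage Subtype.val_injective.injOn
  obtain ⟨P, hP0, hPint, hPT⟩ := exists_integral_lt_one ht T hT
  let Z : Finset (Place k) := (hfin P⁻¹).toFinset.filter fun v => t ∈ v.1
  have hZ : ∀ v : Place k, t ∈ v.1 → v ∉ T ∪ Z → v.1.valuation P = 1 := fun v hv hvT => by
    refine le_antisymm ((v.1.valuation_le_one_iff _).2 (hPint v hv)) ?_
    have h1 : P⁻¹ ∈ v.1 := by
      by_contra h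
      exact hvT (Finset.mem_union_right _ (Finset.mem_filter.2 ⟨(hfin _).mem_toFinset.2 h, hv⟩))
    have h2 := (v.1.valuation_le_one_iff _).2 h1
    rw [map_inv₀] at h2
    exact (inv_le_one₀ (zero_lt_iff.2 (by simpa using hP0))).1 h2
  have hZlt : ∀ v ∈ T ∪ Z, v.1.valuation P < 1 := fun v hv => by
    rcases Finset.mem_union.1 hv with hv | hv
    · exact hPT v hv
    · have h1 := (hfin _).mem_toFinset.1 (Finset.mem_filter.1 hv).1
      have h2 : 1 < v.1.valuation P⁻¹ := not_le.1 fun h => h1 ((v.1.valuation_le_one_iff _).1 h)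
      rw [map_inv₀] at h2
      exact (one_lt_inv₀ (zero_lt_iff.2 (by simpa using hP0))).1 h2
  have hTZ : ∀ v ∈ T ∪ Z, t ∈ v.1 := fun v hv => by
    rcases Finset.mem_union.1 hv with hv | hv
    · exact hT v hv
    · exact (Finset.mem_filter.1 hv).2
  let y' : Place k → k := fun v => if v ∈ T then y v else 0
  obtain ⟨x₀, hx₀⟩ := weak_approximation (T ∪ Z) y'
  by_cases hx00 : x₀ = 0
  · subst hx00
    refine ⟨0, fun v hv => ?_, fun v _ _ => v.1.zero_mem⟩
    simpa [y', hv] using hx₀ v (Finset.mem_union_left _ hv)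
  obtain ⟨M, hM⟩ := exists_forall_mem_valuation_pow_le (T ∪ Z) P (fun _ => x₀⁻¹) hZlt
    fun _ _ => inv_ne_zero hx00
  let W : Finset (Place k) := (hfin x₀).toFinset.filter fun v => t ∈ v.1 ∧ v ∉ T ∪ Z
  have hW : ∀ w ∈ W, t ∈ w.1 ∧ w ∉ T ∪ Z := fun w hw => (Finset.mem_filter.1 hw).2
  obtain ⟨j, hj, hjW⟩ := exists_forall_mem_pow_sub_one_lt W P
  set E := P ^ (j * (M + 1)) with hE
  have hEint : ∀ v : Place k, t ∈ v.1 → E ∈ v.1 := fun v hv => pow_mem (hPint v hv) _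
  have hEW : ∀ w ∈ W, w.1.valuation (1 - E) < 1 := fun w hw => by
    rw [Valuation.map_sub_swap]
    exact hjW _ w hw (hZ w (hW w hw).1 (hW w hw).2)
  obtain ⟨N, hN⟩ := exists_forall_mem_valuation_pow_le W (1 - E) (fun _ => x₀⁻¹) hEW
    fun _ _ => inv_ne_zero hx00
  have hmul : ∀ (v : Place k) (a : k), v.1.valuation a ≤ v.1.valuation x₀⁻¹ →
      a * x₀ ∈ v.1 := fun v a ha => by
    rw [← v.1.valuation_le_one_iff, map_mul]
    refine (mul_le_mul_left ha _).trans ?_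
    rw [← map_mul, inv_mul_cancel₀ hx00, map_one]
  have hgeom : ∀ v : Place k, t ∈ v.1 → ∃ c ∈ v.1, 1 - (1 - E) ^ N = E * c := fun v hv => by
    refine ⟨∑ i ∈ Finset.range N, (1 - E) ^ i, sum_mem fun i _ => pow_mem
      (v.1.sub_mem v.1.one_mem (hEint v hv)) i, ?_⟩
    rw [← neg_inj, neg_sub, ← mul_geom_sum]; ring
  have hmain : ∀ v ∈ T ∪ Z, v.1.valuation ((1 - E) ^ N * x₀ - y' v) ≤ 1 := fun v hv => by
    obtain ⟨c, hc, hc'⟩ := hgeom v (hTZ v hv)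
    rw [show (1 - E) ^ N * x₀ - y' v = (x₀ - y' v) - c * (E * x₀) by
      linear_combination (-x₀) * hc']
    refine (Valuation.map_sub _ _ _).trans (max_le (hx₀ v hv) ?_)
    rw [v.1.valuation_le_one_iff]
    refine v.1.mul_mem _ _ hc (hmul v _ (hM _ ?_ v hv))
    nlinarith
  refine ⟨(1 - E) ^ N * x₀, fun v hv => ?_, fun v hvT hv => ?_⟩
  · simpa [y', hv] using hmain v (Finset.mem_union_left _ hv)
  · by_cases hvZ : v ∈ T ∪ Z
    · have := hmain v hvZ
      simp only [y', hvT, if_false, sub_zero] at this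
      exact (v.1.valuation_le_one_iff _).1 this
    by_cases hx : x₀ ∈ v.1
    · exact v.1.mul_mem _ _ (pow_mem (v.1.sub_mem v.1.one_mem (hEint v hv)) _) hx
    · exact hmul v _ (hN N le_rfl v (Finset.mem_filter.2 ⟨(hfin _).mem_toFinset.2 hx, hv, hvZ⟩))

end WeakApproximation

section Infinity

open Polynomial

variable {k : Type*} [Field k] [IsGlobalFunctionField k]

theorem valuation_aeval_eq_pow_natDegree {F K : Type*} [Field F] [Finite F] [Field K] [Algebra F K]
    (V : ValuationSubring K) {t : K} (ht : 1 < V.valuation t) {g : F[X]} (hg : g ≠ 0) :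
    V.valuation (aeval t g) = V.valuation t ^ g.natDegree := by
  have hc : ∀ a : F, a ≠ 0 → V.valuation (algebraMap F K a) = 1 := fun a ha => by
    refine le_antisymm ((V.valuation_le_one_iff _).2 (algebraMap_mem_of_finite _ V a)) ?_
    have h := (V.valuation_le_one_iff _).2 (algebraMap_mem_of_finite (algebraMap F K) V a⁻¹)
    rw [map_inv₀, map_inv₀] at h
    exact (inv_le_one₀ (zero_lt_iff.2 (by simpa using ha))).1 h
  rw [aeval_eq_sum_range, Finset.sum_range_succ]
  have hlead : V.valuation (g.coeff g.natDegree • t ^ g.natDegree) = V.valuation t ^ g.natDegree := by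
    rw [Algebra.smul_def, map_mul, map_pow, hc _ (by simpa using hg), one_mul]
  rw [Valuation.map_add_eq_of_lt_right, hlead]
  rw [hlead]
  refine Valuation.map_sum_lt _ (pow_ne_zero _ (zero_lt_one.trans ht).ne') fun i hi => ?_
  rw [Algebra.smul_def, map_mul, map_pow]
  refine (mul_le_of_le_one_left' ((V.valuation_le_one_iff _).2
    (algebraMap_mem_of_finite (algebraMap F K) V _))).trans_lt ?_
  exact pow_lt_pow_right₀ ht (Finset.mem_range.1 hi)

theorem exists_forall_exists_integral_bounded : ∃ t : k, (∃ v : Place k, t ∉ v.1) ∧ ∃ M : ℕ,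
    ∀ x : k, ∃ b : k, (∀ v : Place k, t ∈ v.1 → b ∈ v.1) ∧
      ∀ v : Place k, t ∉ v.1 → v.1.valuation (x - b) ≤ v.1.valuation (t ^ M) := by
  obtain ⟨F, _, _, _, hfd⟩ := IsGlobalFunctionField.exists_finite_extension (k := k)
  have : FiniteDimensional (RatFunc F) k := hfd
  let : Algebra F k := ((algebraMap (RatFunc F) k).comp (algebraMap F (RatFunc F))).toAlgebra
  have : IsScalarTower F (RatFunc F) k := IsScalarTower.of_algebraMap_eq fun _ => rfl
  let : Algebra F[X] k := ((algebraMap (RatFunc F) k).comp (algebraMap F[X] (RatFunc F))).toAlgebra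
  have : IsScalarTower F[X] (RatFunc F) k := IsScalarTower.of_algebraMap_eq fun _ => rfl
  have hF : ∀ (V : ValuationSubring k) (a : F), algebraMap F k a ∈ V :=
    algebraMap_mem_of_finite (algebraMap F k)
  set t : k := algebraMap F[X] k X with ht
  have : IsScalarTower F F[X] k := IsScalarTower.of_algebraMap_eq fun a => by
    change algebraMap (RatFunc F) k (algebraMap F (RatFunc F) a) =
      algebraMap (RatFunc F) k (algebraMap F[X] (RatFunc F) (algebraMap F F[X] a))
    rw [← IsScalarTower.algebraMap_apply F F[X] (RatFunc F)]
  have haeval : ∀ g : F[X], algebraMap F[X] k g = aeval t g := fun g => by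
    rw [ht, aeval_algebraMap_apply, aeval_X_left_apply]
  have hinj : Function.Injective (algebraMap F[X] k) :=
    (algebraMap (RatFunc F) k).injective.comp (IsFractionRing.injective F[X] (RatFunc F))
  have htr : Transcendental F t := by
    rw [transcendental_iff_injective]
    exact fun g h hgh => hinj (by rw [haeval, haeval, hgh])
  have hpole : ∃ v : Place k, t ∉ v.1 := by
    by_contra! h
    exact htr (isAlgebraic_of_forall_mem F h)
  have hint : ∀ (v : Place k), t ∈ v.1 → ∀ g : F[X], algebraMap F[X] k g ∈ v.1 := fun v hv g => by
    rw [haeval, aeval_eq_sum_range]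
    refine sum_mem fun i _ => ?_
    rw [Algebra.smul_def]
    exact v.1.mul_mem _ _ (hF v.1 _) (pow_mem hv i)
  obtain ⟨s, b, hb⟩ := FiniteDimensional.exists_is_basis_integral F[X] (RatFunc F) k
  have hfin : {v : Place k | t ∉ v.1}.Finite :=
    (finite_valuationSubring_poles k t).preimage Subtype.val_injective.injOn
  have hlt : ∀ v : Place k, t ∉ v.1 → 1 < v.1.valuation t := fun v hv =>
    not_le.1 fun h => hv ((v.1.valuation_le_one_iff t).1 h)
  have ht0 : t ≠ 0 := fun h => by
    obtain ⟨v, hv⟩ := hpole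
    exact hv (h ▸ v.1.zero_mem)
  have hM : ∀ j : s, ∃ M : ℕ, ∀ n, M ≤ n → ∀ v : Place k, t ∉ v.1 →
      v.1.valuation (b j) ≤ v.1.valuation (t ^ n) := fun j => by
    obtain ⟨M, hM⟩ := exists_forall_mem_valuation_pow_le hfin.toFinset t⁻¹ (fun _ => (b j)⁻¹)
      (fun v hv => by
        rw [map_inv₀]; exact inv_lt_one_of_one_lt₀ (hlt v (hfin.mem_toFinset.1 hv)))
      (fun _ _ => inv_ne_zero (b.ne_zero j))
    refine ⟨M, fun n hn v hv => ?_⟩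
    have := hM n hn v (hfin.mem_toFinset.2 hv)
    rw [inv_pow, map_inv₀, map_inv₀, inv_le_inv₀ (zero_lt_iff.2 (by simp [ht0]))
      (zero_lt_iff.2 (by simpa using b.ne_zero j))] at this
    exact this
  choose M hM using hM
  refine ⟨t, hpole, Finset.univ.sup M, fun x => ?_⟩
  let q : s → RatFunc F := fun j => b.repr x j
  refine ⟨∑ j, algebraMap F[X] k ((q j).num / (q j).denom) * b j, fun v hv => ?_, fun v hv => ?_⟩
  · exact sum_mem fun j _ => v.1.mul_mem _ _ (hint v hv _) (mem_of_isIntegral v.1 (hint v hv) (hb j))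
  · have hx : x = ∑ j, algebraMap (RatFunc F) k (q j) * b j := by
      conv_lhs => rw [← b.sum_repr x]
      exact Finset.sum_congr rfl fun j _ => Algebra.smul_def _ _
    conv_lhs => rw [hx]
    rw [← Finset.sum_sub_distrib]
    refine Valuation.map_sum_le _ fun j _ => ?_
    rw [← sub_mul, map_mul]
    refine (mul_le_of_le_one_left' ?_).trans (hM j _ (Finset.le_sup (Finset.mem_univ j)) v hv)
    have hd0 : (q j).denom ≠ 0 := RatFunc.denom_ne_zero _
    have hd0' : algebraMap F[X] k (q j).denom ≠ 0 := by
      rwa [Ne, map_eq_zero_iff _ hinj]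
    have hq : algebraMap (RatFunc F) k (q j) =
        algebraMap F[X] k (q j).num / algebraMap F[X] k (q j).denom := by
      conv_lhs => rw [← RatFunc.num_div_denom (q j)]
      rw [map_div₀]; rfl
    have hmod : algebraMap F[X] k (q j).num / algebraMap F[X] k (q j).denom -
        algebraMap F[X] k ((q j).num / (q j).denom) =
        algebraMap F[X] k ((q j).num % (q j).denom) / algebraMap F[X] k (q j).denom := by
      rw [div_sub' hd0', ← map_mul, ← map_sub]
      congr 2
      rw [sub_eq_iff_eq_add, add_comm, EuclideanDomain.div_add_mod]
    rw [hq, hmod, map_div₀]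
    by_cases hr : (q j).num % (q j).denom = 0
    · simp [hr]
    · rw [haeval, haeval, valuation_aeval_eq_pow_natDegree v.1 (hlt v hv) hr,
        valuation_aeval_eq_pow_natDegree v.1 (hlt v hv) hd0]
      refine div_le_one_of_le₀ (pow_le_pow_right₀ (hlt v hv).le ?_) zero_le
      exact natDegree_le_natDegree (EuclideanDomain.mod_lt _ hd0).le

end Infinity

section Completion

open Topology UniformSpace

variable {k : Type*} [Field k]

/-- The embedding of `k` in its completion at `v`. -/
noncomputable abbrev Place.coe (v : Place k) (x : k) : v.Completion :=
  ((WithVal.toVal v.1.valuation x : WithVal v.1.valuation) : v.Completion)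

theorem Place.valued_coe (v : Place k) (x : k) : Valued.v (v.coe x) = v.1.valuation x :=
  Valued.valuedCompletion_apply _

theorem Place.coe_sub (v : Place k) (x y : k) : v.coe (x - y) = v.coe x - v.coe y :=
  UniformSpace.Completion.coe_sub _ _

theorem Place.isClopen_closedBall (v : Place k) {c : k} (hc : c ≠ 0) :
    IsClopen {x : v.Completion | Valued.v x ≤ v.1.valuation c} := by
  have h := Valued.isClopen_closedBall v.Completion
    (r := (Valued.v : Valuation v.Completion _).restrict (v.coe c)) ?_
  · convert h using 3 with x
    rw [Valuation.restrict_le_iff, v.valued_coe]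
  · simp [hc]

theorem Place.exists_coe_sub_le (v : Place k) (a : v.Completion) {c : k} (hc : c ≠ 0) :
    ∃ y : k, Valued.v (a - v.coe y) ≤ v.1.valuation c := by
  have h1 : {b : v.Completion | Valued.v (a - b) ≤ v.1.valuation c} ∈ 𝓝 a := by
    refine IsOpen.mem_nhds ((v.isClopen_closedBall hc).isOpen.preimage
      (continuous_const.sub continuous_id)) ?_
    simp
  obtain ⟨z, hz⟩ := UniformSpace.Completion.denseRange_coe.mem_nhds h1
  exact ⟨z.ofVal, hz⟩

theorem Place.exists_closedBall_subset (v : Place k) {s : Set v.Completion} (hs : s ∈ 𝓝 0) :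
    ∃ c : k, c ≠ 0 ∧ {x : v.Completion | Valued.v x ≤ v.1.valuation c} ⊆ s := by
  obtain ⟨γ, hγ⟩ := Valued.mem_nhds_zero.1 hs
  obtain ⟨x, hx⟩ : ∃ x : v.Completion, (Valued.v : Valuation v.Completion _).restrict x = γ := by
    obtain ⟨r, s, -, -, h⟩ := Valuation.restrict_exists_div_eq Valued.v γ
    exact ⟨r / s, by rw [map_div₀, h]⟩
  have hx0 : x ≠ 0 := by
    rintro rfl
    rw [map_zero] at hx
    exact γ.ne_zero hx.symm
  obtain ⟨r, hr⟩ := Valued.exists_coe_eq_v x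
  obtain ⟨s, hs0, hs1⟩ := v.exists_ne_zero_lt_one
  have hr' : Valued.v x = v.1.valuation r.ofVal := hr
  have hr0 : r.ofVal ≠ 0 := by
    intro h
    rw [h, map_zero] at hr'
    simp [hx0] at hr'
  refine ⟨r.ofVal * s, mul_ne_zero hr0 hs0, fun y hy => hγ ?_⟩
  rw [Set.mem_ofPred_eq, ← hx, Valuation.restrict_lt_iff, hr']
  refine lt_of_le_of_lt hy ?_
  rw [map_mul]
  exact mul_lt_of_lt_one_right (zero_lt_iff.2 (by simpa using hr0)) hs1

variable [IsGlobalFunctionField k]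

theorem Place.totallyBounded_integers (v : Place k) :
    TotallyBounded (v.integers : Set v.Completion) := by
  intro d hd
  rw [uniformity_eq_comap_nhds_zero] at hd
  obtain ⟨U, hU, hUd⟩ := hd
  obtain ⟨c, hc0, hcV, hcU⟩ : ∃ c : k, c ≠ 0 ∧ c ∈ v.1 ∧
      {x : v.Completion | Valued.v x ≤ v.1.valuation c} ⊆ U := by
    obtain ⟨c, hc0, hcU⟩ := v.exists_closedBall_subset hU
    rcases le_total (v.1.valuation c) 1 with h | h
    · exact ⟨c, hc0, (v.1.valuation_le_one_iff c).1 h, hcU⟩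
    · exact ⟨1, one_ne_zero, v.1.one_mem, fun x hx => hcU (le_trans hx (by simpa using h))⟩
  have := finite_quotient_span v.1 (y := ⟨c, hcV⟩) fun h => hc0 (congrArg Subtype.val h)
  refine ⟨Set.range fun q : v.1 ⧸ Ideal.span {(⟨c, hcV⟩ : v.1)} => v.coe (Quotient.out q : v.1),
    Set.finite_range _, fun a ha => ?_⟩
  obtain ⟨y, hy⟩ := v.exists_coe_sub_le a hc0
  have hc1 : v.1.valuation c ≤ 1 := (v.1.valuation_le_one_iff c).2 hcV
  have hyV : y ∈ v.1 := by
    rw [← v.1.valuation_le_one_iff, ← v.valued_coe, ← sub_sub_cancel a (v.coe y)]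
    exact (Valuation.map_sub _ _ _).trans (max_le ha (hy.trans hc1))
  let q := Ideal.Quotient.mk (Ideal.span {(⟨c, hcV⟩ : v.1)}) ⟨y, hyV⟩
  refine Set.mem_biUnion ⟨q, rfl⟩ (hUd (hcU ?_))
  obtain ⟨w, hw⟩ := Ideal.mem_span_singleton.1 (Ideal.Quotient.eq.1 (Quotient.out_eq q))
  have hw' : ((Quotient.out q : v.1) : k) - y = c * w := congrArg Subtype.val hw
  have : v.coe (Quotient.out q : v.1) - a = v.coe (c * w) - (a - v.coe y) := by
    rw [← hw', v.coe_sub]; ring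
  rw [Set.mem_ofPred_eq]
  change Valued.v (v.coe (Quotient.out q : v.1) - a) ≤ _
  rw [this]
  refine (Valuation.map_sub _ _ _).trans (max_le ?_ hy)
  rw [v.valued_coe, map_mul]
  exact mul_le_of_le_one_right' (v.1.valuation_le_one w)

instance Place.compactSpace_integers (v : Place k) : CompactSpace v.integers := by
  have h : IsClosed (v.integers : Set v.Completion) := Valued.isClosed_integer _
  exact isCompact_iff_compactSpace.1 (TotallyBounded.isCompact_of_isClosed
    v.totallyBounded_integers h)

instance Place.secondCountableTopology_completion (v : Place k) :
    SecondCountableTopology v.Completion := by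
  have h1 : (𝓝 (0 : v.Completion)).IsCountablyGenerated := by
    obtain ⟨s, hs0, hs⟩ := v.exists_ne_zero_lt_one
    refine Filter.HasBasis.isCountablyGenerated (ι := ℕ) (p := fun _ => True)
      (s := fun n => {x : v.Completion | Valued.v x ≤ v.1.valuation (s ^ n)}) ⟨fun t => ?_⟩
    constructor
    · intro ht
      obtain ⟨c, hc, hct⟩ := v.exists_closedBall_subset ht
      obtain ⟨N, hN⟩ := exists_valuation_pow_le v.1 hs hc
      exact ⟨N, trivial, fun x hx => hct (le_trans hx (hN N le_rfl))⟩
    · rintro ⟨n, -, hn⟩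
      exact Filter.mem_of_superset ((v.isClopen_closedBall (pow_ne_zero n hs0)).isOpen.mem_nhds
        (by simp)) hn
  have h2 : (uniformity v.Completion).IsCountablyGenerated :=
    IsUniformAddGroup.uniformity_countably_generated
  have h3 : Countable (WithVal v.1.valuation) := (WithVal.ofVal_injective v.1.valuation).countable
  have : TopologicalSpace.SeparableSpace v.Completion := inferInstance
  exact UniformSpace.secondCountable_of_separable _

end Completion

section AdeleTopology

open Topology Filter

variable {k : Type*} [Field k]

instance fact_isOpen_integers : Fact (∀ v : Place k, IsOpen (v.integers : Set v.Completion)) :=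
  ⟨fun _ => Valued.isOpen_integer _⟩

/-- The adeles `a` with `|a_v| ≤ |c_v|` for all `v`. -/
def adelicBox (c : Place k → k) : AddSubgroup (AdeleRing k) where
  carrier := {a | ∀ v, Valued.v (a v) ≤ v.1.valuation (c v)}
  zero_mem' v := by
    change Valued.v (0 : v.Completion) ≤ _
    simp
  add_mem' {a b} ha hb v := (Valuation.map_add _ _ _).trans (max_le (ha v) (hb v))
  neg_mem' {a} ha v := by
    change Valued.v (-(a v)) ≤ _
    rw [Valuation.map_neg]; exact ha v

theorem mem_adelicBox {c : Place k → k} {a : AdeleRing k} :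
    a ∈ adelicBox c ↔ ∀ v, Valued.v (a v) ≤ v.1.valuation (c v) := Iff.rfl

theorem isOpen_adelicBox {c : Place k → k} (hc0 : ∀ v, c v ≠ 0)
    (hc : ∀ᶠ v in cofinite, c v = 1) : IsOpen (adelicBox c : Set (AdeleRing k)) := by
  have h1 : IsOpen {a : AdeleRing k | ∀ v : Place k, c v = 1 → a.1 v ∈ v.integers} :=
    RestrictedProduct.isOpen_forall_imp_mem fun v => Valued.isOpen_integer v.Completion
  have hfin : {v : Place k | ¬ c v = 1}.Finite := hc
  have h2 : IsOpen (⋂ v ∈ {v : Place k | ¬ c v = 1},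
      {a : AdeleRing k | Valued.v (a v) ≤ v.1.valuation (c v)}) :=
    hfin.isOpen_biInter fun v _ => (v.isClopen_closedBall (hc0 v)).isOpen.preimage
      (RestrictedProduct.continuous_eval v)
  convert h1.inter h2 using 1
  ext a
  simp only [SetLike.mem_coe, mem_adelicBox, Set.mem_inter_iff, Set.mem_ofPred_eq, Set.mem_iInter]
  constructor
  · refine fun h => ⟨fun v hv => ?_, fun v _ => h v⟩
    have := h v
    rw [hv, map_one] at this
    exact this
  · rintro ⟨h, h'⟩ v
    by_cases hv : c v = 1
    · rw [hv, map_one]; exact h v hv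
    · exact h' v hv

theorem exists_adelicBox_subset {s : Set (AdeleRing k)} (hs : s ∈ 𝓝 0) :
    ∃ c : Place k → k, (∀ v, c v ≠ 0) ∧ (∀ᶠ v in cofinite, c v = 1) ∧ (∀ v, c v ∈ v.1) ∧
      (adelicBox c : Set (AdeleRing k)) ⊆ s := by
  have h0 := RestrictedProduct.nhds_zero_eq_map_structureMap (R := fun v : Place k => v.Completion)
    (B := fun v => v.integers) fun v => Valued.isOpen_integer v.Completion
  have hs' : s ∈ map (RestrictedProduct.structureMap (fun v : Place k => v.Completion)
      (fun v => (v.integers : Set v.Completion)) cofinite) (𝓝 0) := by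
    rw [← h0]; exact hs
  rw [mem_map, nhds_pi, mem_pi'] at hs'
  obtain ⟨T, t, ht, hts⟩ := hs'
  have hball : ∀ v : Place k, ∃ c : k, c ≠ 0 ∧ c ∈ v.1 ∧
      ∀ x : v.integers, Valued.v (x : v.Completion) ≤ v.1.valuation c → x ∈ t v := fun v => by
    obtain ⟨u, hu, hut⟩ := mem_nhds_subtype _ _ _ |>.1 (ht v)
    obtain ⟨c, hc0, hcu⟩ := v.exists_closedBall_subset hu
    rcases le_total (v.1.valuation c) 1 with h | h
    · exact ⟨c, hc0, (v.1.valuation_le_one_iff c).1 h, fun x hx => hut (hcu hx)⟩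
    · exact ⟨1, one_ne_zero, v.1.one_mem, fun x hx => hut (hcu (le_trans hx (by simpa using h)))⟩
  choose c hc0 hcV hct using hball
  classical
  refine ⟨fun v => if v ∈ T then c v else 1, fun v => ?_, ?_, fun v => ?_, fun a ha => ?_⟩
  · dsimp only
    split_ifs
    · exact hc0 v
    · exact one_ne_zero
  · rw [eventually_cofinite]
    refine T.finite_toSet.subset fun v hv => ?_
    by_contra h
    exact hv (if_neg h)
  · dsimp only
    split_ifs
    · exact hcV v
    · exact v.1.one_mem
  · have hint : ∀ v, a v ∈ v.integers := fun v => by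
      have h := ha v
      refine le_trans h ((v.1.valuation_le_one_iff _).2 ?_)
      dsimp only
      split_ifs
      · exact hcV v
      · exact v.1.one_mem
    have : a = RestrictedProduct.structureMap (fun v : Place k => v.Completion)
      (fun v => (v.integers : Set v.Completion)) cofinite fun v => ⟨a v, hint v⟩ := rfl
    rw [this]
    refine hts fun v hv => hct v _ ?_
    have h := ha v
    dsimp only at h
    rw [if_pos (Finset.mem_coe.1 hv)] at h
    exact h

variable [IsGlobalFunctionField k]

theorem isCompact_adelicBox_one : IsCompact (adelicBox (fun _ => (1 : k)) : Set (AdeleRing k)) := by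
  have hc : ∀ v : Place k, CompactSpace (v.integers : Set v.Completion) := fun v =>
    v.compactSpace_integers
  have := isCompact_range (RestrictedProduct.isOpenEmbedding_structureMap
    (R := fun v : Place k => v.Completion) (A := fun v => (v.integers : Set v.Completion))
    fun v => Valued.isOpen_integer v.Completion).continuous
  convert this using 1
  rw [RestrictedProduct.range_structureMap]
  ext a
  simp only [SetLike.mem_coe, mem_adelicBox, map_one]
  rfl

/-- The adele with component `c v` at `v`. -/
noncomputable def adeleOfFinite (c : Place k → k) (hc : ∀ᶠ v in cofinite, c v = 1) : AdeleRing k :=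
  ⟨fun v => v.coe (c v), hc.mono fun v hv => by
    change Valued.v (v.coe (c v)) ≤ 1
    rw [v.valued_coe, hv, map_one]⟩

theorem isCompact_adelicBox {c : Place k → k} (hc0 : ∀ v, c v ≠ 0)
    (hc : ∀ᶠ v in cofinite, c v = 1) : IsCompact (adelicBox c : Set (AdeleRing k)) := by
  have hc' : ∀ᶠ v in cofinite, (c v)⁻¹ = 1 := hc.mono fun v hv => by rw [hv, inv_one]
  have h1 := isCompact_adelicBox_one (k := k) |>.image
    (continuous_const.mul continuous_id : Continuous fun a => adeleOfFinite c hc * a)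
  have h2 : adeleOfFinite c hc * adeleOfFinite (fun v => (c v)⁻¹) hc' = 1 := by
    ext v
    change v.coe (c v) * v.coe (c v)⁻¹ = 1
    rw [← UniformSpace.Completion.coe_mul]
    change v.coe (c v * (c v)⁻¹) = 1
    rw [mul_inv_cancel₀ (hc0 v)]; rfl
  convert h1 using 1
  ext a
  constructor
  · intro ha
    refine ⟨adeleOfFinite (fun v => (c v)⁻¹) hc' * a, fun v => ?_, ?_⟩
    · change Valued.v (v.coe (c v)⁻¹ * a v) ≤ _
      rw [map_mul, v.valued_coe, map_one]
      refine (mul_le_mul_right (ha v) _).trans ?_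
      rw [← map_mul, inv_mul_cancel₀ (hc0 v), map_one]
    · change adeleOfFinite c hc * (adeleOfFinite (fun v => (c v)⁻¹) hc' * a) = a
      rw [← mul_assoc, h2, one_mul]
  · rintro ⟨b, hb, rfl⟩ v
    change Valued.v (v.coe (c v) * b v) ≤ _
    rw [map_mul, v.valued_coe]
    have := hb v
    rw [map_one] at this
    exact mul_le_of_le_one_right' this

/-- The adeles are the sum of `k` and of a compact subgroup. -/
theorem exists_adelicBox_add_diagonal : ∃ c : Place k → k, (∀ v, c v ≠ 0) ∧
    (∀ᶠ v in cofinite, c v = 1) ∧ ∀ a : AdeleRing k, ∃ x : k, a - diagonal k x ∈ adelicBox c := by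
  classical
  obtain ⟨t, ht, M, hM⟩ := exists_forall_exists_integral_bounded (k := k)
  have hfin : ∀ x : k, {v : Place k | x ∉ v.1}.Finite := fun x =>
    (finite_valuationSubring_poles k x).preimage Subtype.val_injective.injOn
  have ht0 : t ≠ 0 := fun h => by
    obtain ⟨v, hv⟩ := ht
    exact hv (h ▸ v.1.zero_mem)
  refine ⟨fun v => if t ∈ v.1 then 1 else t ^ M, fun v => ?_, ?_, fun a => ?_⟩
  · dsimp only
    split_ifs
    · exact one_ne_zero
    · exact pow_ne_zero _ ht0
  · rw [eventually_cofinite]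
    refine (hfin t).subset fun v hv h => hv (if_pos h)
  have ha : {v : Place k | ¬ a v ∈ v.integers}.Finite := a.2
  choose y hy using fun v : Place k => v.exists_coe_sub_le (a v) one_ne_zero
  obtain ⟨x, hx1, hx2⟩ := strong_approximation ht (ha.toFinset.filter fun v => t ∈ v.1)
    (fun v hv => (Finset.mem_filter.1 hv).2) y
  have hx : ∀ v : Place k, t ∈ v.1 → Valued.v (a v - v.coe x) ≤ 1 := fun v hv => by
    by_cases hav : a v ∈ v.integers
    · refine (Valuation.map_sub _ _ _).trans (max_le hav ?_)
      rw [v.valued_coe, v.1.valuation_le_one_iff]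
      exact hx2 v (fun h => ha.mem_toFinset.1 (Finset.mem_filter.1 h).1 hav) hv
    · have h1 := hx1 v (Finset.mem_filter.2 ⟨ha.mem_toFinset.2 hav, hv⟩)
      rw [← v.valued_coe, v.coe_sub] at h1
      rw [show a v - v.coe x = (a v - v.coe (y v)) - (v.coe x - v.coe (y v)) by ring]
      refine (Valuation.map_sub _ _ _).trans (max_le ?_ h1)
      simpa using hy v
  obtain ⟨z, hz⟩ := weak_approximation (hfin t).toFinset fun v => y v - x
  obtain ⟨b, hb1, hb2⟩ := hM z
  refine ⟨x + b, fun v => ?_⟩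
  change Valued.v (a v - v.coe (x + b)) ≤ _
  have hadd : ∀ x y : k, v.coe (x + y) = v.coe x + v.coe y := fun x y =>
    UniformSpace.Completion.coe_add _ _
  rw [hadd]
  dsimp only
  by_cases hv : t ∈ v.1
  · rw [if_pos hv, map_one, ← sub_sub]
    refine (Valuation.map_sub _ _ _).trans (max_le (hx v hv) ?_)
    rw [v.valued_coe]
    exact (v.1.valuation_le_one_iff b).2 (hb1 v hv)
  · rw [if_neg hv]
    have h1 := hz v ((hfin t).mem_toFinset.2 hv)
    have h2 := hb2 v hv
    rw [← v.valued_coe, v.coe_sub] at h1 h2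
    rw [v.coe_sub] at h1
    rw [show a v - (v.coe x + v.coe b) = (a v - v.coe (y v)) - (v.coe z - (v.coe (y v) - v.coe x))
      + (v.coe z - v.coe b) by ring]
    have h3 : 1 ≤ v.1.valuation (t ^ M) := by
      rw [map_pow]
      exact one_le_pow₀ (not_le.1 fun h => hv ((v.1.valuation_le_one_iff t).1 h)).le
    refine (Valuation.map_add _ _ _).trans (max_le ?_ h2)
    refine (Valuation.map_sub _ _ _).trans (max_le ?_ (h1.trans h3))
    refine le_trans ?_ h3
    simpa using hy v

theorem finite_quotient_range_diagonal_sup (H : AddSubgroup (AdeleRing k))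
    (hH : IsOpen (H : Set (AdeleRing k))) :
    Finite (AdeleRing k ⧸ ((diagonal k).toAddMonoidHom.range ⊔ H)) := by
  obtain ⟨c, hc0, hc, hcov⟩ := exists_adelicBox_add_diagonal (k := k)
  have hopen : IsOpen (((diagonal k).toAddMonoidHom.range ⊔ H : AddSubgroup (AdeleRing k)) :
      Set (AdeleRing k)) := AddSubgroup.isOpen_mono le_sup_right hH
  have := QuotientAddGroup.discreteTopology hopen
  have hcomp := (isCompact_adelicBox hc0 hc).image
    (QuotientAddGroup.continuous_mk (N := (diagonal k).toAddMonoidHom.range ⊔ H))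
  have huniv : IsCompact (Set.univ : Set (AdeleRing k ⧸ ((diagonal k).toAddMonoidHom.range ⊔ H))) := by
    convert hcomp
    refine (Set.eq_univ_of_forall fun q => ?_).symm
    obtain ⟨a, rfl⟩ := QuotientAddGroup.mk_surjective q
    obtain ⟨x, hx⟩ := hcov a
    refine ⟨_, hx, QuotientAddGroup.eq.2 ?_⟩
    have : -(a - diagonal k x) + a = diagonal k x := by abel
    rw [this]
    exact AddSubgroup.mem_sup_left ⟨x, rfl⟩
  have := isCompact_univ_iff.1 huniv
  exact finite_of_compact_of_discrete

theorem exists_fundamental_domain : ∃ D : Set (AdeleRing k), IsOpen D ∧ IsCompact D ∧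
    ∀ a, ∃! x : k, diagonal k x + a ∈ D := by
  classical
  obtain ⟨t, ⟨v₀, hv₀⟩, -⟩ := exists_forall_exists_integral_bounded (k := k)
  obtain ⟨s, hs0, hs⟩ := v₀.exists_ne_zero_lt_one
  let c : Place k → k := Function.update (fun _ => 1) v₀ s
  have hc0 : ∀ v, c v ≠ 0 := fun v => by
    by_cases h : v = v₀
    · subst h; simpa [c] using hs0
    · simp [c, h]
  have hc : ∀ᶠ v in cofinite, c v = 1 := by
    rw [eventually_cofinite]
    refine (Set.finite_singleton v₀).subset fun v hv => ?_
    by_contra h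
    exact hv (Function.update_of_ne h _ _)
  have hdisc : ∀ x : k, diagonal k x ∈ adelicBox c → x = 0 := fun x hx => by
    have hx' : ∀ v : Place k, v.1.valuation x ≤ v.1.valuation (c v) := fun v => by
      rw [← v.valued_coe x]; exact hx v
    refine eq_zero_of_forall_mem_of_lt_one (fun v => ?_) v₀ ((hx' v₀).trans_lt (by simpa [c]))
    rw [← v.1.valuation_le_one_iff]
    refine (hx' v).trans ?_
    by_cases h : v = v₀
    · subst h; simpa [c] using hs.le
    · simp [c, h]
  have hfin := finite_quotient_range_diagonal_sup _ (isOpen_adelicBox hc0 hc)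
  let D : Set (AdeleRing k) :=
    ⋃ q : AdeleRing k ⧸ ((diagonal k).toAddMonoidHom.range ⊔ adelicBox c),
      (fun a => Quotient.out q + a) '' (adelicBox c : Set (AdeleRing k))
  refine ⟨D, isOpen_iUnion fun q => (Homeomorph.addLeft _).isOpenMap _ (isOpen_adelicBox hc0 hc),
    isCompact_iUnion fun q => (isCompact_adelicBox hc0 hc).image (continuous_const.add continuous_id),
    fun a => ?_⟩
  have hmemD : ∀ b, b ∈ D → b - Quotient.out (QuotientAddGroup.mk b :
      AdeleRing k ⧸ ((diagonal k).toAddMonoidHom.range ⊔ adelicBox c)) ∈ adelicBox c := by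
    intro b hb
    obtain ⟨q, u, hu, rfl⟩ := Set.mem_iUnion.1 hb
    have : (QuotientAddGroup.mk (Quotient.out q + u) :
        AdeleRing k ⧸ ((diagonal k).toAddMonoidHom.range ⊔ adelicBox c)) = q := by
      rw [QuotientAddGroup.mk_add_of_mem _ (AddSubgroup.mem_sup_right hu)]
      exact Quotient.out_eq q
    simp only [this, add_sub_cancel_left]
    exact hu
  obtain ⟨r, hr, u, hu, hru⟩ := AddSubgroup.mem_sup.1 (QuotientAddGroup.eq.1 (Quotient.out_eq
    (QuotientAddGroup.mk a : AdeleRing k ⧸ ((diagonal k).toAddMonoidHom.range ⊔ adelicBox c))))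
  obtain ⟨x, rfl⟩ := hr
  have hx : diagonal k (-x) + a ∈ D := by
    refine Set.mem_iUnion.2 ⟨QuotientAddGroup.mk a, u, hu, ?_⟩
    have hru' : diagonal k x + u = -Quotient.out (QuotientAddGroup.mk a :
      AdeleRing k ⧸ ((diagonal k).toAddMonoidHom.range ⊔ adelicBox c)) + a := hru
    simp only [map_neg]
    rw [← sub_eq_iff_eq_add'.2 hru'.symm]; abel
  refine ⟨-x, hx, fun y hy => ?_⟩
  have hclass : ∀ z : k, (QuotientAddGroup.mk (diagonal k z + a) :
      AdeleRing k ⧸ ((diagonal k).toAddMonoidHom.range ⊔ adelicBox c)) = QuotientAddGroup.mk a :=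
    fun z => by
      refine QuotientAddGroup.eq.2 ?_
      have : -(diagonal k z + a) + a = diagonal k (-z) := by rw [map_neg]; abel
      rw [this]
      exact AddSubgroup.mem_sup_left ⟨-z, rfl⟩
  have h1 := hmemD _ hy
  have h2 := hmemD _ hx
  rw [hclass] at h1 h2
  have h3 := (adelicBox c).sub_mem h1 h2
  rw [sub_sub_sub_cancel_right, add_sub_add_right_eq_sub, ← map_sub] at h3
  exact sub_eq_zero.1 (hdisc _ h3)

instance : SecondCountableTopology (AdeleRing k) := by
  have hemb := RestrictedProduct.isOpenEmbedding_structureMap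
    (R := fun v : Place k => v.Completion) (A := fun v => (v.integers : Set v.Completion))
    fun v => Valued.isOpen_integer v.Completion
  have hbox : Set.range (RestrictedProduct.structureMap (fun v : Place k => v.Completion)
      (fun v => (v.integers : Set v.Completion)) cofinite) =
      (adelicBox (fun _ => (1 : k)) : Set (AdeleRing k)) := by
    rw [RestrictedProduct.range_structureMap]
    ext a
    simp only [SetLike.mem_coe, mem_adelicBox, map_one]
    rfl
  set O : Set (AdeleRing k) := (adelicBox (fun _ => (1 : k)) : Set (AdeleRing k)) with hO
  have hopen : IsOpen O := hbox ▸ hemb.isOpen_range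
  have h1 : SecondCountableTopology O := by
    rw [← hbox]
    exact hemb.isEmbedding.toHomeomorph.symm.secondCountableTopology
  have := finite_quotient_range_diagonal_sup (adelicBox (fun _ => (1 : k))) hopen
  let U : (AdeleRing k ⧸ ((diagonal k).toAddMonoidHom.range ⊔ adelicBox fun _ => (1 : k))) × k →
      Set (AdeleRing k) := fun i => (Homeomorph.addLeft (Quotient.out i.1 + diagonal k i.2)) '' O
  have h2 : ∀ i, SecondCountableTopology (U i) := fun i =>
    ((Homeomorph.addLeft (Quotient.out i.1 + diagonal k i.2)).image O).symm.secondCountableTopology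
  refine TopologicalSpace.secondCountableTopology_of_countable_cover
    (fun i => (Homeomorph.addLeft _).isOpenMap _ hopen) (Set.eq_univ_of_forall (s := ⋃ i, U i)
      fun a => ?_)
  obtain ⟨r, hr, u, hu, hru⟩ := AddSubgroup.mem_sup.1 (QuotientAddGroup.eq.1 (Quotient.out_eq
    (QuotientAddGroup.mk a :
      AdeleRing k ⧸ ((diagonal k).toAddMonoidHom.range ⊔ adelicBox fun _ => (1 : k)))))
  obtain ⟨x, rfl⟩ := hr
  refine Set.mem_iUnion.2 ⟨(QuotientAddGroup.mk a, x), u, hu, ?_⟩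
  change Quotient.out _ + (diagonal k x) + u = a
  rw [add_assoc, ← eq_neg_add_iff_add_eq]
  exact hru

end AdeleTopology

section Counting

variable {A : Type*} [CommRing A]

theorem card_sq_le_index_of_injective {L : Type*} [AddCommGroup L] (Q : AddSubgroup A)
    (hQ : Q.index ≠ 0) (j : L × L → AddChar A ℂ) (hj : Function.Injective j)
    (hjQ : ∀ l, ∀ a ∈ Q, j l a = 1) : Finite L ∧ Nat.card L ^ 2 ≤ Q.index := by
  have hfin : Finite (A ⧸ Q) := by
    by_contra h
    rw [not_finite_iff_infinite] at h
    exact hQ Nat.card_eq_zero_of_infinite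
  have := Fintype.ofFinite (A ⧸ Q)
  let lift : L × L → AddChar (A ⧸ Q) ℂ := fun l =>
    AddChar.toAddMonoidHomEquiv.symm (QuotientAddGroup.lift Q (AddChar.toAddMonoidHomEquiv (j l))
      fun a ha => congrArg Additive.ofMul (hjQ l a ha))
  have hlift : ∀ l a, lift l (QuotientAddGroup.mk a) = j l a := fun _ _ => rfl
  have hinj : Function.Injective lift := fun l l' h => hj (by
    ext a
    rw [← hlift, ← hlift, h])
  have h1 := Nat.card_le_card_of_injective lift hinj
  rw [Nat.card_prod, Nat.card_eq_fintype_card (α := AddChar (A ⧸ Q) ℂ), AddChar.card_eq,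
    ← Nat.card_eq_fintype_card] at h1
  refine ⟨?_, by rwa [sq]⟩
  have := Finite.of_injective lift hinj
  exact Finite.of_injective (fun l : L => (l, (0 : L))) fun a b h => congrArg Prod.fst h

variable (K O H : AddSubgroup A) (β : Aˣ)

theorem relIndex_map_mulLeft_pow_eq (hHO : H ≤ O) (hβO : O.map (AddMonoidHom.mulLeft (β : A)) ≤ O)
    (hβH : H.map (AddMonoidHom.mulLeft (β : A)) ≤ H) (hfin : H.relIndex O ≠ 0) :
    (H.map (AddMonoidHom.mulLeft (β : A))).relIndex H =
      (O.map (AddMonoidHom.mulLeft (β : A))).relIndex O := by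
  have hinj : Function.Injective (AddMonoidHom.mulLeft (β : A)) := fun a b h =>
    (Units.mul_right_inj β).1 h
  have h1 := AddSubgroup.relIndex_mul_relIndex _ _ _ hβH hHO
  have h2 := AddSubgroup.relIndex_mul_relIndex _ _ _ (AddSubgroup.map_mono hHO) hβO
  rw [AddSubgroup.relIndex_map_map_of_injective _ _ hinj] at h2
  rw [mul_comm, ← h2] at h1
  exact Nat.eq_of_mul_eq_mul_left (Nat.pos_of_ne_zero hfin) h1

theorem two_pow_le_relIndex_map_mulLeft_pow
    (hβO : O.map (AddMonoidHom.mulLeft (β : A)) ≤ O) (hne : ¬ O ≤ O.map (AddMonoidHom.mulLeft (β : A)))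
    (hfin : (O.map (AddMonoidHom.mulLeft (β : A))).relIndex O ≠ 0) (m : ℕ) :
    2 ^ m ≤ (O.map (AddMonoidHom.mulLeft ((β ^ m : Aˣ) : A))).relIndex O ∧
      O.map (AddMonoidHom.mulLeft ((β ^ m : Aˣ) : A)) ≤ O := by
  induction m with
  | zero =>
    have : O.map (AddMonoidHom.mulLeft ((β ^ 0 : Aˣ) : A)) = O := by
      convert AddSubgroup.map_id O
      ext; simp
    rw [this]
    simp
  | succ m ih =>
    have hmap : O.map (AddMonoidHom.mulLeft ((β ^ (m + 1) : Aˣ) : A)) =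
        (O.map (AddMonoidHom.mulLeft (β : A))).map (AddMonoidHom.mulLeft ((β ^ m : Aˣ) : A)) := by
      rw [AddSubgroup.map_map]
      congr 1
      ext a
      simp [pow_succ, mul_assoc]
    have hinj : Function.Injective (AddMonoidHom.mulLeft ((β ^ m : Aˣ) : A)) := fun a b h =>
      (Units.mul_right_inj _).1 h
    have hle := AddSubgroup.map_mono (f := AddMonoidHom.mulLeft ((β ^ m : Aˣ) : A)) hβO
    rw [hmap]
    refine ⟨?_, hle.trans ih.2⟩
    rw [← AddSubgroup.relIndex_mul_relIndex _ _ _ hle ih.2,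
      AddSubgroup.relIndex_map_map_of_injective _ _ hinj, pow_succ, mul_comm]
    refine Nat.mul_le_mul ?_ ih.1
    have h1 : (O.map (AddMonoidHom.mulLeft (β : A))).relIndex O ≠ 1 := fun h =>
      hne (AddSubgroup.relIndex_eq_one.1 h)
    omega

theorem relIndex_comap_le (hO : O ≤ O.comap (AddMonoidHom.mulLeft (β : A)))
    (hK : (K ⊔ O).index ≠ 0) (hL : Finite (K ⊓ O.comap (AddMonoidHom.mulLeft (β : A)) : AddSubgroup A)) :
    (O.map (AddMonoidHom.mulLeft (β : A))).relIndex O ≤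
      (K ⊔ O).index * Nat.card (K ⊓ O.comap (AddMonoidHom.mulLeft (β : A)) : AddSubgroup A) := by
  have hinj : Function.Injective (AddMonoidHom.mulLeft (β : A)) := fun a b h =>
    (Units.mul_right_inj β).1 h
  have hsurj : Function.Surjective (AddMonoidHom.mulLeft (β : A)) := fun a =>
    ⟨(β⁻¹ : Aˣ) * a, by simp⟩
  set O' := O.comap (AddMonoidHom.mulLeft (β : A)) with hO'
  have h1 : (O.map (AddMonoidHom.mulLeft (β : A))).relIndex O = O.relIndex O' := by
    rw [← AddSubgroup.relIndex_map_map_of_injective O O' hinj, hO',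
      AddSubgroup.map_comap_eq_self_of_surjective hsurj]
  rw [h1]
  have h2 := AddSubgroup.relIndex_mul_relIndex O ((K ⊔ O) ⊓ O') O' (le_inf le_sup_right hO) inf_le_right
  rw [← h2, mul_comm]
  refine Nat.mul_le_mul ?_ ?_
  · rw [AddSubgroup.inf_relIndex_right]
    exact Nat.le_of_dvd (Nat.pos_of_ne_zero hK) (AddSubgroup.relIndex_dvd_index_of_normal _ _)
  · rw [sup_comm, sup_inf_assoc_of_le K hO, sup_comm, AddSubgroup.relIndex_sup_right]
    exact Nat.le_of_dvd Nat.card_pos (AddSubgroup.relIndex_dvd_card _ _)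

theorem exists_ne_zero_forall_mul_eq_one {k : Type*} [Field k] (d : k →+* A) [Nontrivial A]
    (hHO : H ≤ O) (hO1 : 1 ∈ O) (hOO : ∀ a ∈ O, ∀ b ∈ O, a * b ∈ O)
    (hOH : ∀ a ∈ O, ∀ b ∈ H, a * b ∈ H) (hβ : (β : A) ∈ O) (hβ' : ((β⁻¹ : Aˣ) : A) ∉ O)
    (hKO : (d.toAddMonoidHom.range ⊔ O).index ≠ 0) (hKH : (d.toAddMonoidHom.range ⊔ H).index ≠ 0)
    (hHO' : H.relIndex O ≠ 0) (hβO : (O.map (AddMonoidHom.mulLeft (β : A))).relIndex O ≠ 0)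
    (χ₁ χ₂ : AddChar A ℂ) (h₁ : ∀ x, χ₁ (d x) = 1) (h₂ : ∀ x, χ₂ (d x) = 1)
    (h₁' : ∀ a ∈ H, χ₁ a = 1) (h₂' : ∀ a ∈ H, χ₂ a = 1) :
    ∃ x₁ x₂ : k, (x₁ ≠ 0 ∨ x₂ ≠ 0) ∧ ∀ a, χ₁ (d x₁ * a) * χ₂ (d x₂ * a) = 1 := by
  by_contra! hcon
  set K := d.toAddMonoidHom.range with hK
  have hβpow : ∀ m : ℕ, ((β ^ m : Aˣ) : A) ∈ O := fun m => by
    induction m with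
    | zero => simpa using hO1
    | succ m ih => rw [pow_succ, Units.val_mul]; exact hOO _ ih _ hβ
  have hmapO : O.map (AddMonoidHom.mulLeft (β : A)) ≤ O := by
    rintro _ ⟨a, ha, rfl⟩
    exact hOO _ hβ _ ha
  have hmapH : ∀ m : ℕ, H.map (AddMonoidHom.mulLeft ((β ^ m : Aˣ) : A)) ≤ H := by
    rintro m _ ⟨a, ha, rfl⟩
    exact hOH _ (hβpow m) _ ha
  have hne : ¬ O ≤ O.map (AddMonoidHom.mulLeft (β : A)) := fun h => by
    obtain ⟨a, ha, hba⟩ := h hO1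
    refine hβ' ?_
    have : ((β⁻¹ : Aˣ) : A) = a := by
      rw [Units.inv_eq_of_mul_eq_one_right]
      exact hba
    rw [this]; exact ha
  have hRfin : ∀ m : ℕ, (O.map (AddMonoidHom.mulLeft ((β ^ m : Aˣ) : A))).relIndex O ≠ 0 := fun m =>
    (lt_of_lt_of_le (by positivity)
      (two_pow_le_relIndex_map_mulLeft_pow O β hmapO hne hβO m).1).ne'
  have key : ∀ m : ℕ, (O.map (AddMonoidHom.mulLeft ((β ^ m : Aˣ) : A))).relIndex O ≤
      (K ⊔ O).index ^ 2 * (K ⊔ H).index := fun m => by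
    set R := (O.map (AddMonoidHom.mulLeft ((β ^ m : Aˣ) : A))).relIndex O with hR
    set Hm := H.map (AddMonoidHom.mulLeft ((β ^ m : Aˣ) : A)) with hHm
    have hmO := (two_pow_le_relIndex_map_mulLeft_pow O β hmapO hne hβO m).2
    have hHR : Hm.relIndex H = R := relIndex_map_mulLeft_pow_eq O H (β ^ m) hHO hmO (hmapH m) hHO'
    have hind : (K ⊔ Hm).index ≤ R * (K ⊔ H).index ∧ (K ⊔ Hm).index ≠ 0 := by
      have hle : K ⊔ Hm ≤ K ⊔ H := sup_le_sup_left (hmapH m) K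
      have h3 : (K ⊔ Hm).relIndex (K ⊔ H) ∣ R := by
        have : K ⊔ H = (K ⊔ Hm) ⊔ H := by rw [sup_assoc, sup_eq_right.2 (hmapH m)]
        rw [this, AddSubgroup.relIndex_sup_left, ← hHR]
        exact AddSubgroup.relIndex_dvd_of_le_left _ le_sup_right
      rw [← AddSubgroup.relIndex_mul_index hle]
      refine ⟨Nat.mul_le_mul_right _ (Nat.le_of_dvd (Nat.pos_of_ne_zero (hRfin m)) h3), ?_⟩
      exact mul_ne_zero (ne_zero_of_dvd_ne_zero (hRfin m) h3) hKH
    let L : AddSubgroup k :=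
      (O.comap (AddMonoidHom.mulLeft ((β ^ m : Aˣ) : A))).comap d.toAddMonoidHom
    have hL : ∀ x ∈ L, ∀ a ∈ Hm, d x * a ∈ H := by
      rintro x hx _ ⟨a, ha, rfl⟩
      have hx' : ((β ^ m : Aˣ) : A) * d x ∈ O := hx
      change d x * (((β ^ m : Aˣ) : A) * a) ∈ H
      rw [← mul_assoc, mul_comm (d x)]
      exact hOH _ hx' _ ha
    let j : L × L → AddChar A ℂ := fun l => AddChar.toAddMonoidHomEquiv.symm
      ((AddChar.toAddMonoidHomEquiv χ₁).comp (AddMonoidHom.mulLeft (d l.1)) +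
        (AddChar.toAddMonoidHomEquiv χ₂).comp (AddMonoidHom.mulLeft (d l.2)))
    have hj : ∀ l a, j l a = χ₁ (d l.1 * a) * χ₂ (d l.2 * a) := fun _ _ => rfl
    have hcard := card_sq_le_index_of_injective (K ⊔ Hm) hind.2 j ?_ ?_
    · have hLmap : L.map d.toAddMonoidHom =
          K ⊓ O.comap (AddMonoidHom.mulLeft ((β ^ m : Aˣ) : A)) := by
        rw [AddSubgroup.map_comap_eq]
      have hLfin : Finite L := hcard.1
      have hcardL : Nat.card (L.map d.toAddMonoidHom) = Nat.card L :=
        Nat.card_congr (AddSubgroup.equivMapOfInjective L _ d.injective).symm.toEquiv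
      have hfin : Finite (L.map d.toAddMonoidHom) :=
        Finite.of_equiv _ (AddSubgroup.equivMapOfInjective L _ d.injective).toEquiv
      rw [hLmap] at hcardL hfin
      have h4 := relIndex_comap_le K O (β ^ m) (AddSubgroup.map_le_iff_le_comap.1 hmO) hKO hfin
      rw [hcardL, ← hR] at h4
      have h5 := hcard.2.trans hind.1
      have h6 : R * R ≤ R * ((K ⊔ O).index ^ 2 * (K ⊔ H).index) := by
        calc R * R ≤ ((K ⊔ O).index * Nat.card L) * ((K ⊔ O).index * Nat.card L) :=
              Nat.mul_le_mul h4 h4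
          _ = (K ⊔ O).index ^ 2 * Nat.card L ^ 2 := by ring
          _ ≤ (K ⊔ O).index ^ 2 * (R * (K ⊔ H).index) := Nat.mul_le_mul_left _ h5
          _ = R * ((K ⊔ O).index ^ 2 * (K ⊔ H).index) := by ring
      exact Nat.le_of_mul_le_mul_left h6 (Nat.pos_of_ne_zero (hRfin m))
    · intro l l' hll
      by_contra hne'
      obtain ⟨a, ha⟩ := hcon (l.1 - l'.1 : k) (l.2 - l'.2 : k) (by
        by_contra! h
        exact hne' (Prod.ext (Subtype.ext (sub_eq_zero.1 h.1)) (Subtype.ext (sub_eq_zero.1 h.2))))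
      refine ha ?_
      have := DFunLike.congr_fun hll a
      rw [hj, hj] at this
      rw [map_sub, map_sub, sub_mul, sub_mul, AddChar.map_sub_eq_div, AddChar.map_sub_eq_div,
        div_mul_div_comm, this, div_self]
      exact mul_ne_zero (AddChar.val_isUnit _ _).ne_zero (AddChar.val_isUnit _ _).ne_zero
    · intro l a ha
      obtain ⟨_, ⟨x, rfl⟩, b, hb, rfl⟩ := AddSubgroup.mem_sup.1 ha
      rw [hj]
      change χ₁ (d l.1 * (d x + b)) * χ₂ (d l.2 * (d x + b)) = 1
      rw [mul_add, mul_add, AddChar.map_add_eq_mul, AddChar.map_add_eq_mul, ← map_mul d, ← map_mul d,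
        h₁, h₂, h₁' _ (hL _ l.1.2 _ hb), h₂' _ (hL _ l.2.2 _ hb)]
      simp
  obtain ⟨m, hm⟩ := pow_unbounded_of_one_lt ((K ⊔ O).index ^ 2 * (K ⊔ H).index) one_lt_two
  exact absurd ((two_pow_le_relIndex_map_mulLeft_pow O β hmapO hne hβO m).1.trans (key m))
    (not_le.2 hm)

theorem exists_forall_eq_mul {k : Type*} [Field k] (d : k →+* A) [Nontrivial A]
    (hHO : H ≤ O) (hO1 : 1 ∈ O) (hOO : ∀ a ∈ O, ∀ b ∈ O, a * b ∈ O)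
    (hOH : ∀ a ∈ O, ∀ b ∈ H, a * b ∈ H) (hβ : (β : A) ∈ O) (hβ' : ((β⁻¹ : Aˣ) : A) ∉ O)
    (hKO : (d.toAddMonoidHom.range ⊔ O).index ≠ 0) (hKH : (d.toAddMonoidHom.range ⊔ H).index ≠ 0)
    (hHO' : H.relIndex O ≠ 0) (hβO : (O.map (AddMonoidHom.mulLeft (β : A))).relIndex O ≠ 0)
    (χ₁ χ₂ : AddChar A ℂ) (h₁ : ∀ x, χ₁ (d x) = 1) (h₂ : ∀ x, χ₂ (d x) = 1)
    (h₁' : ∀ a ∈ H, χ₁ a = 1) (h₂' : ∀ a ∈ H, χ₂ a = 1) (hne : ∃ a, χ₁ a ≠ 1) :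
    ∃ x : k, ∀ a, χ₂ a = χ₁ (d x * a) := by
  obtain ⟨x₁, x₂, hx, h⟩ := exists_ne_zero_forall_mul_eq_one O H β d hHO hO1 hOO hOH hβ hβ' hKO hKH
    hHO' hβO χ₁ χ₂ h₁ h₂ h₁' h₂'
  have hx₂ : x₂ ≠ 0 := by
    rintro rfl
    have hx₁ : x₁ ≠ 0 := hx.resolve_right (by simp)
    obtain ⟨a, ha⟩ := hne
    refine ha ?_
    have := h (d x₁⁻¹ * a)
    rwa [← mul_assoc, ← map_mul, mul_inv_cancel₀ hx₁, map_one, one_mul, map_zero, zero_mul,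
      AddChar.map_zero_eq_one, mul_one] at this
  refine ⟨-(x₁ * x₂⁻¹), fun a => ?_⟩
  have := h (d x₂⁻¹ * a)
  rw [← mul_assoc, ← mul_assoc, ← map_mul, ← map_mul, mul_inv_cancel₀ hx₂, map_one, one_mul] at this
  rw [map_neg, neg_mul, AddChar.map_neg_eq_inv]
  exact eq_inv_of_mul_eq_one_right this

end Counting

section Duality

open Filter Topology

variable {k : Type*} [Field k]

theorem mul_mem_adelicBox {c : Place k → k} {a b : AdeleRing k}
    (ha : a ∈ adelicBox fun _ => (1 : k)) (hb : b ∈ adelicBox c) : a * b ∈ adelicBox c := fun v => by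
  change Valued.v (a v * b v) ≤ _
  have := ha v
  rw [map_one] at this
  rw [map_mul]
  exact (mul_le_of_le_one_left' this).trans (hb v)

variable [IsGlobalFunctionField k]

theorem natCast_mul_adele_eq_zero (p : ℕ) [CharP k p] (a : AdeleRing k) : p • a = 0 := by
  rw [nsmul_eq_mul, ← map_natCast (diagonal k), CharP.cast_eq_zero, map_zero, zero_mul]

theorem eventually_addChar_eq_one {A : Type*} [AddCommGroup A] [TopologicalSpace A] {p : ℕ}
    (hp : p ≠ 0) (hA : ∀ a : A, p • a = 0) (χ : AddChar A ℂ) (hχ : Continuous χ) :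
    ∀ᶠ a in 𝓝 0, χ a = 1 := by
  have hfin : {z : ℂ | z ^ p = 1 ∧ z ≠ 1}.Finite := by
    refine (Polynomial.nthRootsFinset p (1 : ℂ)).finite_toSet.subset fun z hz => ?_
    exact (Polynomial.mem_nthRootsFinset (Nat.pos_of_ne_zero hp) 1).2 hz.1
  have h1 : {z : ℂ | z ^ p = 1 ∧ z ≠ 1}ᶜ ∈ 𝓝 (χ 0) := by
    refine hfin.isClosed.isOpen_compl.mem_nhds ?_
    simp
  filter_upwards [hχ.continuousAt h1] with a ha
  by_contra h
  refine ha ⟨?_, h⟩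
  rw [← AddChar.map_nsmul_eq_pow, hA, AddChar.map_zero_eq_one]

theorem index_range_diagonal_sup_ne_zero (H : AddSubgroup (AdeleRing k))
    (hH : IsOpen (H : Set (AdeleRing k))) : ((diagonal k).toAddMonoidHom.range ⊔ H).index ≠ 0 := by
  have := finite_quotient_range_diagonal_sup H hH
  exact AddSubgroup.index_ne_zero_of_finite

theorem relIndex_adelicBox_one_ne_zero (H : AddSubgroup (AdeleRing k))
    (hH : IsOpen (H : Set (AdeleRing k))) : H.relIndex (adelicBox fun _ => (1 : k)) ≠ 0 := by
  have : CompactSpace (adelicBox fun _ => (1 : k)) :=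
    isCompact_iff_compactSpace.1 isCompact_adelicBox_one
  have := AddSubgroup.quotient_finite_of_isOpen (H.addSubgroupOf (adelicBox fun _ => (1 : k)))
    (hH.preimage continuous_subtype_val)
  exact AddSubgroup.index_ne_zero_of_finite

variable (k) in
theorem exists_integral_unit_inv_not_integral : ∃ β : (AdeleRing k)ˣ,
    (β : AdeleRing k) ∈ adelicBox (fun _ => (1 : k)) ∧
      ((β⁻¹ : (AdeleRing k)ˣ) : AdeleRing k) ∉ adelicBox (fun _ => (1 : k)) := by
  classical
  obtain ⟨t, ⟨v₀, hv₀⟩, -⟩ := exists_forall_exists_integral_bounded (k := k)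
  obtain ⟨s, hs0, hs⟩ := v₀.exists_ne_zero_lt_one
  have hev : ∀ u : k, ∀ᶠ v in cofinite, Function.update (fun _ : Place k => (1 : k)) v₀ u v = 1 :=
    fun u => by
      rw [eventually_cofinite]
      refine (Set.finite_singleton v₀).subset fun v hv => ?_
      by_contra h
      exact hv (Function.update_of_ne h _ _)
  have hmul : ∀ u w : k, u * w = 1 → adeleOfFinite _ (hev u) * adeleOfFinite _ (hev w) = 1 := by
    intro u w huw
    ext v
    change v.coe _ * v.coe _ = 1
    rw [← UniformSpace.Completion.coe_mul]
    change v.coe (_ * _) = 1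
    have : Function.update (fun _ : Place k => (1 : k)) v₀ u v *
        Function.update (fun _ : Place k => (1 : k)) v₀ w v = 1 := by
      by_cases h : v = v₀
      · subst h; simpa using huw
      · simp [h]
    rw [this]; rfl
  have hval : ∀ (u : k) (v : Place k), Valued.v (adeleOfFinite _ (hev u) v) =
      v.1.valuation (Function.update (fun _ : Place k => (1 : k)) v₀ u v) := fun u v =>
    v.valued_coe _
  refine ⟨⟨adeleOfFinite _ (hev s), adeleOfFinite _ (hev s⁻¹), hmul _ _ (mul_inv_cancel₀ hs0),
    hmul _ _ (inv_mul_cancel₀ hs0)⟩, fun v => ?_, fun h => ?_⟩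
  · rw [hval, map_one]
    by_cases h : v = v₀
    · subst h; simpa using hs.le
    · simp [h]
  · have := h v₀
    rw [Units.inv_mk, hval, map_one, Function.update_self, map_inv₀] at this
    exact absurd ((inv_le_one₀ (zero_lt_iff.2 (by simpa using hs0))).1 this) (not_le.2 hs)

theorem isOpen_map_mulLeft_units {A : Type*} [CommRing A] [TopologicalSpace A] [ContinuousMul A]
    (β : Aˣ) {O : AddSubgroup A} (hO : IsOpen (O : Set A)) :
    IsOpen (O.map (AddMonoidHom.mulLeft (β : A)) : Set A) :=
  (Homeomorph.isOpenMap ⟨Units.mulLeft β, continuous_const.mul continuous_id,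
    continuous_const.mul continuous_id⟩) _ hO

noncomputable local instance : CommRing (AdeleRing k) := inferInstance
noncomputable local instance : AddCommGroup (AdeleRing k) := inferInstance
noncomputable local instance : AddMonoid (AdeleRing k) := inferInstance

/-- The adele class group `𝔸 / k` has dual group `k`: every character of `𝔸` trivial on `k` is
of the form `a ↦ ψ (x a)` with `x ∈ k`. -/
theorem exists_eq_mul_of_trivial_on_diagonal (p : ℕ) [Fact p.Prime] [CharP k p]
    (ψ χ : AddChar (AdeleRing k) ℂ) (hψ : Continuous ψ) (hχ : Continuous χ)
    (hψ_ne : ∃ a : AdeleRing k, ψ a ≠ 1) (hψ_k : ∀ x : k, ψ (diagonal k x) = 1)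
    (hχ_k : ∀ x : k, χ (diagonal k x) = 1) :
    ∃ x : k, ∀ a : AdeleRing k, χ a = ψ (diagonal k x * a) := by
  have hp : p ≠ 0 := (Fact.out : p.Prime).ne_zero
  have hev : {a : AdeleRing k | ψ a = 1 ∧ χ a = 1} ∈ 𝓝 0 :=
    (eventually_addChar_eq_one hp (natCast_mul_adele_eq_zero p) ψ hψ).and
      (eventually_addChar_eq_one hp (natCast_mul_adele_eq_zero p) χ hχ)
  obtain ⟨c, hc0, hc1, hcV, hc⟩ := exists_adelicBox_subset hev
  obtain ⟨β, hβ, hβ'⟩ := exists_integral_unit_inv_not_integral k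
  have hOopen : IsOpen (adelicBox (fun _ => (1 : k)) : Set (AdeleRing k)) :=
    isOpen_adelicBox (fun _ => one_ne_zero) (by simp)
  have hHopen := isOpen_adelicBox hc0 hc1
  have hle : adelicBox c ≤ adelicBox (fun _ => (1 : k)) := fun a ha v =>
    (ha v).trans (by simpa using (v.1.valuation_le_one_iff _).2 (hcV v))
  have hone : (1 : AdeleRing k) ∈ adelicBox (fun _ => (1 : k)) := fun v => by
    change Valued.v (1 : v.Completion) ≤ _
    simp
  have : Nontrivial (AdeleRing k) := by
    obtain ⟨a, ha⟩ := hψ_ne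
    refine ⟨a, 0, fun h => ha ?_⟩
    rw [h, AddChar.map_zero_eq_one]
  have hc' : ∀ a ∈ adelicBox c, ψ a = 1 ∧ χ a = 1 := fun a ha => hc ha
  exact exists_forall_eq_mul (adelicBox fun _ => (1 : k)) (adelicBox c) β (diagonal k) hle hone
    (fun a ha b hb => mul_mem_adelicBox ha hb) (fun a ha b hb => mul_mem_adelicBox ha hb) hβ hβ'
    (index_range_diagonal_sup_ne_zero _ hOopen) (index_range_diagonal_sup_ne_zero _ hHopen)
    (relIndex_adelicBox_one_ne_zero _ hHopen)
    (relIndex_adelicBox_one_ne_zero _ (isOpen_map_mulLeft_units β hOopen)) ψ χ hψ_k hχ_k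
    (fun a ha => (hc' a ha).1) (fun a ha => (hc' a ha).2) hψ_ne

end Duality

section CompactGroups

open MeasureTheory Filter Topology

variable {G : Type*} [AddCommGroup G] [TopologicalSpace G] [IsTopologicalAddGroup G]

/-- The group of periods of a function. -/
def periods {E : Type*} (f : G → E) : AddSubgroup G where
  carrier := {u | ∀ z, f (z + u) = f z}
  zero_mem' z := by rw [add_zero]
  add_mem' {a b} ha hb z := by rw [← add_assoc, hb, ha]
  neg_mem' {a} ha z := by rw [← ha (z + -a), neg_add_cancel_right]

theorem isOpen_periods [CompactSpace G] {E : Type*} {f : G → E} (hf : IsLocallyConstant f) :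
    IsOpen (periods f : Set G) := by
  refine AddSubgroup.isOpen_of_mem_nhds (g := 0) _ ?_
  have h : ∀ᶠ u in 𝓝 (0 : G), ∀ z ∈ (Set.univ : Set G), f (z + u) = f z := by
    refine isCompact_univ.eventually_forall_of_forall_eventually fun z _ => ?_
    have h1 : ∀ᶠ w in 𝓝 ((0, z) : G × G), f (w.2 + w.1) = f z := by
      have hc : Continuous fun w : G × G => w.2 + w.1 := by fun_prop
      have := hc.continuousAt.eventually
        ((IsLocallyConstant.iff_eventually_eq f).1 hf ((0, z) : G × G).2 |>.filter_mono
          (by simp : 𝓝 (((0, z) : G × G).2 + ((0, z) : G × G).1) ≤ _))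
      exact this
    have h2 : ∀ᶠ w in 𝓝 ((0, z) : G × G), f w.2 = f z :=
      (continuous_snd.continuousAt (x := ((0, z) : G × G))).eventually
        ((IsLocallyConstant.iff_eventually_eq f).1 hf z)
    filter_upwards [h1, h2] with w h1 h2
    rw [h1, h2]
  filter_upwards [h] with u hu z
  exact hu z trivial

variable [CompactSpace G] [MeasurableSpace G] [BorelSpace G]

/-- The finite Fourier expansion at `0` of a locally constant function on a compact abelian
group. -/
theorem mem_of_forall_integral_addChar_mem (μ : Measure G) [μ.IsAddHaarMeasure]
    [IsProbabilityMeasure μ] (I : AddSubgroup ℂ) {f : G → ℂ} (hf : IsLocallyConstant f)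
    (h : ∀ χ : AddChar G ℂ, Continuous χ → (∀ u ∈ periods f, χ u = 1) →
      ∫ z, f z * χ (-z) ∂μ ∈ I) : f 0 ∈ I := by
  classical
  have hU := isOpen_periods hf
  set U := periods f with hUdef
  have hfin : Finite (G ⧸ U) := AddSubgroup.quotient_finite_of_isOpen U hU
  have : U.FiniteIndex := AddSubgroup.finiteIndex_of_finite_quotient
  let _ : Fintype (G ⧸ U) := Fintype.ofFinite _
  let π : G →+ G ⧸ U := QuotientAddGroup.mk' U
  have hcont : ∀ χ : AddChar (G ⧸ U) ℂ, Continuous (χ.compAddMonoidHom π) := fun χ => by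
    refine IsLocallyConstant.continuous ((IsLocallyConstant.iff_eventually_eq _).2 fun x => ?_)
    have : ∀ᶠ y in 𝓝 x, y - x ∈ U := by
      have hc : Continuous fun y : G => y - x := by fun_prop
      exact hc.continuousAt.eventually (hU.mem_nhds (by simp [U.zero_mem]))
    filter_upwards [this] with y hy
    change χ (π y) = χ (π x)
    have : π y = π x := by
      rw [← sub_eq_zero, ← map_sub]
      exact (QuotientAddGroup.eq_zero_iff _).2 hy
    rw [this]
  have hint : ∀ χ : AddChar (G ⧸ U) ℂ,
      Integrable (fun z => f z * (χ.compAddMonoidHom π) (-z)) μ := fun χ => by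
    have hc : Continuous fun z => f z * (χ.compAddMonoidHom π) (-z) :=
      hf.continuous.mul ((hcont χ).comp continuous_neg)
    exact hc.integrable_of_hasCompactSupport (HasCompactSupport.of_compactSpace _)
  have hsum : f 0 = ∑ χ : AddChar (G ⧸ U) ℂ, ∫ z, f z * (χ.compAddMonoidHom π) (-z) ∂μ := by
    rw [← integral_finsetSum _ fun χ _ => hint χ]
    have h1 : ∀ z, ∑ χ : AddChar (G ⧸ U) ℂ, f z * (χ.compAddMonoidHom π) (-z) =
        (U : Set G).indicator (fun _ => f 0 * (U.index : ℂ)) z := fun z => by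
      rw [← Finset.mul_sum]
      have : ∑ χ : AddChar (G ⧸ U) ℂ, (χ.compAddMonoidHom π) (-z) =
        ∑ χ : AddChar (G ⧸ U) ℂ, χ (π (-z)) := rfl
      rw [this, AddChar.sum_apply_eq_ite]
      have hz : π (-z) = 0 ↔ z ∈ (U : Set G) := by
        rw [map_neg, neg_eq_zero]; exact QuotientAddGroup.eq_zero_iff _
      by_cases hzU : z ∈ (U : Set G)
      · rw [Set.indicator_of_mem hzU, if_pos (hz.2 hzU)]
        have := hzU 0
        rw [zero_add] at this
        rw [this, AddSubgroup.index, Nat.card_eq_fintype_card]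
      · rw [Set.indicator_of_notMem hzU, if_neg (hz.not.2 hzU), mul_zero]
    simp_rw [h1]
    rw [integral_indicator_const _ hU.measurableSet]
    have h2 := U.index_mul_measure hU.measurableSet μ
    rw [measure_univ] at h2
    have h3 := congrArg ENNReal.toReal h2
    rw [ENNReal.toReal_mul, ENNReal.toReal_natCast, ENNReal.toReal_one] at h3
    rw [Complex.real_smul, Measure.real, mul_comm, mul_assoc, ← Complex.ofReal_natCast,
      ← Complex.ofReal_mul, h3, Complex.ofReal_one, mul_one]
  rw [hsum]
  refine I.sum_mem fun χ _ => h _ (hcont χ) fun u hu => ?_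
  change χ (π u) = 1
  rw [show π u = 0 from (QuotientAddGroup.eq_zero_iff _).2 hu, AddChar.map_zero_eq_one]

end CompactGroups

section ProductMeasure

set_option linter.unusedSectionVars false

open MeasureTheory Filter Topology

variable {k : Type*} [Field k] {Q : Type*} [AddCommGroup Q] [Module k Q] [TopologicalSpace Q]

theorem exists_pi_eq_addChar_sum_smul {ι : Type*} [Fintype ι] (ψ : AddChar Q ℂ)
    (hdual : ∀ χ : AddChar Q ℂ, Continuous χ → ∃ x : k, ∀ z, χ z = ψ (x • z))
    (χ : AddChar (ι → Q) ℂ) (hχ : Continuous χ) :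
    ∃ ξ : ι → k, ∀ Z, χ Z = ψ (∑ i, ξ i • Z i) := by
  classical
  have h : ∀ i, ∃ x : k, ∀ z, χ (Pi.single i z) = ψ (x • z) := fun i =>
    hdual (χ.compAddMonoidHom (AddMonoidHom.single (fun _ => Q) i))
      (hχ.comp (continuous_single (A := fun _ => Q) i))
  choose ξ hξ using h
  refine ⟨ξ, fun Z => ?_⟩
  have hsum : ∀ (χ : AddChar (ι → Q) ℂ) (s : Finset ι) (g : ι → ι → Q),
      χ (∑ i ∈ s, g i) = ∏ i ∈ s, χ (g i) := fun χ s g => by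
    induction s using Finset.induction_on with
    | empty => simp
    | insert a s ha ih => rw [Finset.sum_insert ha, Finset.prod_insert ha, AddChar.map_add_eq_mul, ih]
  have hsum' : ∀ (s : Finset ι) (g : ι → Q), ψ (∑ i ∈ s, g i) = ∏ i ∈ s, ψ (g i) := fun s g => by
    induction s using Finset.induction_on with
    | empty => simp
    | insert a s ha ih => rw [Finset.sum_insert ha, Finset.prod_insert ha, AddChar.map_add_eq_mul, ih]
  have hZ : Z = ∑ i, Pi.single i (Z i) := by
    ext j; simp [Finset.sum_apply, Pi.single_apply]
  rw [hZ, hsum, hsum']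
  refine Finset.prod_congr rfl fun i _ => ?_
  rw [hξ, ← hZ]

variable [IsTopologicalAddGroup Q] [CompactSpace Q] [SecondCountableTopology Q] [MeasurableSpace Q]
  [BorelSpace Q] (ν : Measure Q) [ν.IsAddHaarMeasure] [IsProbabilityMeasure ν]
  {ι : Type*} [Fintype ι]

open Classical in
theorem measurePreserving_piecewise (S : Set ι) :
    MeasurePreserving (fun z : (ι → Q) × (ι → Q) => S.piecewise z.1 z.2)
      ((Measure.pi fun _ : ι => ν).prod (Measure.pi fun _ : ι => ν)) (Measure.pi fun _ : ι => ν) := by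
  let f : (ι → Q) × (ι → Q) →+ (ι → Q) :=
    { toFun := fun z => S.piecewise z.1 z.2
      map_zero' := by ext i; by_cases hi : i ∈ S <;> simp [hi]
      map_add' := fun x y => by ext i; by_cases hi : i ∈ S <;> simp [hi] }
  have hf : Continuous f := by
    refine continuous_pi fun i => ?_
    change Continuous fun z : (ι → Q) × (ι → Q) => S.piecewise z.1 z.2 i
    by_cases hi : i ∈ S
    · simp only [hi, Set.piecewise_eq_of_mem]; fun_prop
    · simp only [hi, not_false_eq_true, Set.piecewise_eq_of_notMem]; fun_prop
  refine AddMonoidHom.measurePreserving (f := f) hf (fun z => ⟨(z, z), ?_⟩) (by simp)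
  exact Set.piecewise_same _ _

/-- Integration in stages: `F` depends on the coordinates in `S` through its first variable, and on
the other ones through its second variable. -/
theorem integral_diag_eq_integral_integral (S : Set ι) {F : (ι → Q) → (ι → Q) → ℂ}
    (hF₁ : ∀ Z Z' W, (∀ i ∈ S, Z i = Z' i) → F Z W = F Z' W)
    (hF₂ : ∀ Z W W', (∀ i ∉ S, W i = W' i) → F Z W = F Z W')
    (hF : Integrable (fun Z => F Z Z) (Measure.pi fun _ : ι => ν)) :
    Integrable (fun Z => ∫ W, F Z W ∂(Measure.pi fun _ : ι => ν)) (Measure.pi fun _ : ι => ν) ∧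
    ∫ Z, F Z Z ∂(Measure.pi fun _ : ι => ν) =
      ∫ Z, ∫ W, F Z W ∂(Measure.pi fun _ : ι => ν) ∂(Measure.pi fun _ : ι => ν) := by
  classical
  have hm := measurePreserving_piecewise ν S
  have hFm : ∀ z : (ι → Q) × (ι → Q),
      F z.1 z.2 = F (S.piecewise z.1 z.2) (S.piecewise z.1 z.2) := fun z => by
    rw [hF₁ z.1 (S.piecewise z.1 z.2) z.2 fun i hi => by simp [hi],
      hF₂ _ z.2 (S.piecewise z.1 z.2) fun i hi => by simp [hi]]
  have hint : Integrable (fun z : (ι → Q) × (ι → Q) => F z.1 z.2)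
      ((Measure.pi fun _ : ι => ν).prod (Measure.pi fun _ : ι => ν)) := by
    simp_rw [hFm]
    exact (hm.integrable_comp hF.aestronglyMeasurable).2 hF
  refine ⟨hint.integral_prod_left, ?_⟩
  rw [← integral_prod _ hint, ← hm.map_eq, integral_map hm.measurable.aemeasurable]
  · simp_rw [← hFm]; rw [hm.map_eq]
  · rw [hm.map_eq]; exact hF.aestronglyMeasurable

/-- Invariance of the product measure under an invertible matrix acting on the first index. -/
theorem integral_matrix_smul {m m' : Type*} [Fintype m] [DecidableEq m] [Fintype m']
    [ContinuousConstSMul k Q] (γ : GL m k) {E : Type*} [NormedAddCommGroup E] [NormedSpace ℝ E]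
    (F : (m × m' → Q) → E) :
    ∫ Z, F (fun p => ∑ l, γ.1 p.1 l • Z (l, p.2)) ∂(Measure.pi fun _ : m × m' => ν) =
      ∫ Z, F Z ∂(Measure.pi fun _ : m × m' => ν) := by
  have hmul : ∀ γ γ' : Matrix m m k, γ * γ' = 1 → ∀ Z : m × m' → Q,
      (fun p : m × m' => ∑ l, γ p.1 l • ∑ j, γ' l j • Z (j, p.2)) = Z := fun γ γ' h Z => by
    ext p
    simp_rw [Finset.smul_sum, smul_smul]
    rw [Finset.sum_comm]
    simp_rw [← Finset.sum_smul, ← Matrix.mul_apply, h, Matrix.one_apply]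
    simp
  have hcont : ∀ γ : Matrix m m k, Continuous fun (Z : m × m' → Q) (p : m × m') =>
      ∑ l, γ p.1 l • Z (l, p.2) := fun γ =>
    continuous_pi fun p => continuous_finsetSum _ fun l _ => (continuous_apply _).const_smul _
  let T : (m × m' → Q) ≃ₜ (m × m' → Q) :=
    { toFun := fun Z p => ∑ l, γ.1 p.1 l • Z (l, p.2)
      invFun := fun Z p => ∑ l, γ⁻¹.1 p.1 l • Z (l, p.2)
      left_inv := hmul _ _ (by rw [← Units.val_mul, inv_mul_cancel, Units.val_one])
      right_inv := hmul _ _ (by rw [← Units.val_mul, mul_inv_cancel, Units.val_one])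
      continuous_toFun := hcont _
      continuous_invFun := hcont _ }
  let f : (m × m' → Q) →+ (m × m' → Q) :=
    { toFun := T
      map_zero' := by ext p; simp [T]
      map_add' := fun x y => by
        ext p; simp [T, smul_add, Finset.sum_add_distrib] }
  have hmp : MeasurePreserving T (Measure.pi fun _ : m × m' => ν) (Measure.pi fun _ : m × m' => ν) :=
    AddMonoidHom.measurePreserving (f := f) T.continuous T.surjective rfl
  exact hmp.integral_comp T.measurableEmbedding F

end ProductMeasure

section ParameterIntegral

open MeasureTheory Filter Topology

theorem isLocallyConstant_integral {X Y : Type*} [TopologicalSpace X] [TopologicalSpace Y]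
    [CompactSpace Y] [MeasurableSpace Y] (μ : Measure Y) (w : Y → ℂ) {F : X → Y → ℂ}
    (hF : IsLocallyConstant fun z : X × Y => F z.1 z.2) :
    IsLocallyConstant fun x => ∫ y, w y * F x y ∂μ := by
  refine (IsLocallyConstant.iff_eventually_eq _).2 fun x => ?_
  have h : ∀ᶠ x' in 𝓝 x, ∀ y ∈ (Set.univ : Set Y), F x' y = F x y := by
    refine isCompact_univ.eventually_forall_of_forall_eventually fun y _ => ?_
    have h1 := (IsLocallyConstant.iff_eventually_eq _).1 hF (x, y)
    have hc : Continuous fun z : X × Y => (x, z.2) := by fun_prop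
    have h2 := (hc.continuousAt (x := (x, y))).eventually h1
    filter_upwards [h1, h2] with z h1 h2
    exact h1.trans h2.symm
  filter_upwards [h] with x' hx'
  simp_rw [hx' _ trivial]

end ParameterIntegral

section Unipotent

variable {n : ℕ} {R : Type*} [CommRing R]

theorem mirabolic_ext {g h : mirabolic n R} (H : g.1.1 = h.1.1) : g = h :=
  Subtype.ext (Units.ext H)

/-- The strictly upper triangular part of a square array. -/
def strictUpper (X : Fin n × Fin n → R) : Matrix (Fin n) (Fin n) R :=
  Matrix.of fun i j => if i < j then X (i, j) else 0

theorem strictUpper_apply (X : Fin n × Fin n → R) (i j : Fin n) :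
    strictUpper X i j = if i < j then X (i, j) else 0 := rfl

theorem det_one_add_strictUpper (X : Fin n × Fin n → R) : (1 + strictUpper X).det = 1 := by
  rw [Matrix.det_of_isUpperTriangular]
  · refine Finset.prod_eq_one fun i _ => ?_
    simp [strictUpper_apply]
  · intro i j h
    have h : j < i := h
    simp [strictUpper_apply, h.ne', h.le]

/-- The upper triangular unipotent matrix with given entries above the diagonal. -/
noncomputable def unip (X : Fin n × Fin n → R) : mirabolic n R :=
  ⟨Matrix.nonsingInvUnit (1 + strictUpper X) (by rw [det_one_add_strictUpper]; exact isUnit_one),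
    fun i j hi => by
      change (1 + strictUpper X) i j = _
      rw [Matrix.add_apply, strictUpper_apply, if_neg, add_zero]
      intro h
      have : (i : ℕ) < j := h
      omega⟩

theorem unip_val (X : Fin n × Fin n → R) : (unip X).1.1 = 1 + strictUpper X := rfl

theorem unip_entry_of_lt (X : Fin n × Fin n → R) {i j : Fin n} (h : i < j) :
    mirabolic.entry (unip X) i j = X (i, j) := by
  change (1 + strictUpper X) i j = _
  simp [strictUpper_apply, h, h.ne]

theorem unip_congr {X Y : Fin n × Fin n → R} (h : ∀ i j, i < j → X (i, j) = Y (i, j)) :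
    unip X = unip Y := by
  refine mirabolic_ext ?_
  rw [unip_val, unip_val]
  congr 1
  ext i j
  rw [strictUpper_apply, strictUpper_apply]
  split_ifs with hij
  · exact h i j hij
  · rfl

theorem unip_zero : unip (0 : Fin n × Fin n → R) = 1 := by
  refine mirabolic_ext ?_
  rw [unip_val]
  have : strictUpper (0 : Fin n × Fin n → R) = 0 := by ext i j; simp [strictUpper_apply]
  rw [this, add_zero]; rfl

/-- The array of entries of the product of the strictly upper triangular parts. -/
def upperMul (X Y : Fin n × Fin n → R) : Fin n × Fin n → R := fun p =>
  (strictUpper X * strictUpper Y) p.1 p.2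

theorem strictUpper_upperMul (X Y : Fin n × Fin n → R) :
    strictUpper (upperMul X Y) = strictUpper X * strictUpper Y := by
  ext i j
  rw [strictUpper_apply]
  split_ifs with h
  · rfl
  · rw [Matrix.mul_apply]
    refine (Finset.sum_eq_zero fun l _ => ?_).symm
    rw [strictUpper_apply, strictUpper_apply]
    split_ifs with h1 h2
    · exact absurd (h1.trans h2) h
    · rw [mul_zero]
    · rw [zero_mul]
    · rw [zero_mul]

theorem strictUpper_add (X Y : Fin n × Fin n → R) :
    strictUpper (X + Y) = strictUpper X + strictUpper Y := by
  ext i j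
  rw [Matrix.add_apply, strictUpper_apply, strictUpper_apply, strictUpper_apply]
  split_ifs <;> simp

theorem unip_mul_unip (X Y : Fin n × Fin n → R) :
    unip X * unip Y = unip (X + Y + upperMul X Y) := by
  refine mirabolic_ext ?_
  change (unip X).1.1 * (unip Y).1.1 = _
  rw [unip_val, unip_val, unip_val, strictUpper_add, strictUpper_add, strictUpper_upperMul]
  noncomm_ring

theorem upperMul_indicator_apply (S T : Set (Fin n × Fin n)) (X Y : Fin n × Fin n → R)
    (p : Fin n × Fin n) (h : ∀ l, (p.1, l) ∈ S → (l, p.2) ∈ T → False) :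
    upperMul (S.indicator X) (T.indicator Y) p = 0 := by
  rw [upperMul, Matrix.mul_apply]
  refine Finset.sum_eq_zero fun l _ => ?_
  rw [strictUpper_apply, strictUpper_apply]
  by_cases hS : (p.1, l) ∈ S
  · rw [Set.indicator_of_notMem (h l hS)]; simp
  · rw [Set.indicator_of_notMem hS]; simp

theorem unip_indicator_mul (S T : Set (Fin n × Fin n)) (X Y : Fin n × Fin n → R)
    (h : ∀ i l j, (i, l) ∈ S → (l, j) ∈ T → False) :
    unip (S.indicator X) * unip (T.indicator Y) = unip (S.indicator X + T.indicator Y) := by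
  rw [unip_mul_unip]
  congr 1
  have : upperMul (S.indicator X) (T.indicator Y) = 0 :=
    funext fun p => upperMul_indicator_apply S T X Y p fun l => h p.1 l p.2
  rw [this, add_zero]

theorem mirabolicMap_unip {R' : Type*} [CommRing R'] (f : R →+* R') (X : Fin n × Fin n → R) :
    mirabolicMap n f (unip X) = unip (fun p => f (X p)) := by
  refine mirabolic_ext ?_
  ext i j
  change f ((1 + strictUpper X) i j) = (1 + strictUpper fun p => f (X p)) i j
  simp only [Matrix.add_apply, strictUpper_apply, map_add, Matrix.one_apply]
  split_ifs <;> simp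

theorem unip_mem_upperUnipotent (X : Fin n × Fin n → R) : unip X ∈ upperUnipotent n R := by
  refine ⟨fun i => ?_, fun i j h => ?_⟩
  · change (1 + strictUpper X) i i = 1
    simp [strictUpper_apply]
  · change (1 + strictUpper X) i j = 0
    simp [strictUpper_apply, h.ne', h.le]

theorem eq_unip_of_mem_upperUnipotent {g : mirabolic n R} (hg : g ∈ upperUnipotent n R) :
    g = unip (fun p => mirabolic.entry g p.1 p.2) := by
  refine mirabolic_ext ?_
  ext i j
  rw [unip_val, Matrix.add_apply, strictUpper_apply]
  rcases lt_trichotomy i j with h | rfl | h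
  · simp [h, h.ne]
  · simpa using hg.1 i
  · simpa [h.ne', h.le, h.not_gt] using hg.2 i j h

/-- The positions `(i, j)` with `i < m ≤ j < r`. -/
def blockSet (n m r : ℕ) : Set (Fin n × Fin n) :=
  {p | (p.1 : ℕ) < m ∧ m ≤ (p.2 : ℕ) ∧ (p.2 : ℕ) < r}

/-- The positions `(i, j)` with `i < j < r`. -/
def upperSet (n r : ℕ) : Set (Fin n × Fin n) := {p | (p.1 : ℕ) < p.2 ∧ (p.2 : ℕ) < r}

/-- The positions `(i, r)` with `i < r`. -/
def colSet (n r : ℕ) : Set (Fin n × Fin n) := {p | (p.1 : ℕ) < r ∧ (p.2 : ℕ) = r}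

theorem unip_indicator_blockSet_mem (m : ℕ) (X : Fin n × Fin n → R) :
    unip ((blockSet n m n).indicator X) ∈ unipotentRadical n R m := by
  intro i j hij
  change (1 + strictUpper ((blockSet n m n).indicator X)) i j = _
  rw [Matrix.add_apply, strictUpper_apply, Set.indicator_of_notMem (fun h => hij ⟨h.1, h.2.1⟩)]
  simp

theorem eq_unip_of_mem_unipotentRadical {m : ℕ} {g : mirabolic n R}
    (hg : g ∈ unipotentRadical n R m) :
    g = unip ((blockSet n m n).indicator fun p => mirabolic.entry g p.1 p.2) := by
  refine mirabolic_ext ?_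
  ext i j
  rw [unip_val, Matrix.add_apply, strictUpper_apply]
  by_cases h : (i : ℕ) < m ∧ m ≤ (j : ℕ)
  · have hlt : i < j := show (i : ℕ) < j from h.1.trans_le h.2
    rw [if_pos hlt, Set.indicator_of_mem (show (i, j) ∈ blockSet n m n from ⟨h.1, h.2, j.2⟩),
      Matrix.one_apply_ne hlt.ne, zero_add]
  · rw [Set.indicator_of_notMem (fun h' => h ⟨h'.1, h'.2.1⟩)]
    simpa using hg i j h

theorem superdiagonalSum_unip (X : Fin n × Fin n → R) :
    superdiagonalSum (unip X) = ∑ p : Fin n × Fin n,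
      if (p.1 : ℕ) + 1 = p.2 then X p else 0 := by
  rw [Fintype.sum_prod_type]
  refine Finset.sum_congr rfl fun i _ => Finset.sum_congr rfl fun j _ => ?_
  split_ifs with h
  · exact unip_entry_of_lt X (show (i : ℕ) < j by omega)
  · rfl

theorem superdiagonalSum_mul {g h : mirabolic n R} (hg : g ∈ upperUnipotent n R)
    (hh : h ∈ upperUnipotent n R) :
    superdiagonalSum (g * h) = superdiagonalSum g + superdiagonalSum h := by
  rw [eq_unip_of_mem_upperUnipotent hg, eq_unip_of_mem_upperUnipotent hh, unip_mul_unip,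
    superdiagonalSum_unip, superdiagonalSum_unip, superdiagonalSum_unip, ← Finset.sum_add_distrib]
  refine Finset.sum_congr rfl fun p _ => ?_
  split_ifs with hp
  · rw [Pi.add_apply, Pi.add_apply, add_eq_left]
    rw [upperMul, Matrix.mul_apply]
    refine Finset.sum_eq_zero fun l _ => ?_
    rw [strictUpper_apply, strictUpper_apply]
    split_ifs with h1 h2
    · have h1 : (p.1 : ℕ) < l := h1
      have h2 : (l : ℕ) < p.2 := h2
      omega
    · rw [mul_zero]
    · rw [zero_mul]
    · rw [zero_mul]
  · rw [add_zero]

/-- A matrix acting on arrays by left multiplication. -/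
def matMul (γ : Matrix (Fin n) (Fin n) R) (X : Fin n × Fin n → R) : Fin n × Fin n → R :=
  fun p => ∑ l, γ p.1 l * X (l, p.2)

/-- A matrix whose rows and columns of index at least `r` are those of the identity normalizes the
unipotent matrices supported on the column `r`. -/
theorem unip_colSet_mul {r : ℕ} {γ : mirabolic n R}
    (hrow : ∀ i j : Fin n, r ≤ (i : ℕ) → γ.1.1 i j = (1 : Matrix (Fin n) (Fin n) R) i j)
    (hcol : ∀ i j : Fin n, r ≤ (j : ℕ) → γ.1.1 i j = (1 : Matrix (Fin n) (Fin n) R) i j)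
    (X : Fin n × Fin n → R) :
    unip ((colSet n r).indicator (matMul γ.1.1 X)) * γ = γ * unip ((colSet n r).indicator X) := by
  refine mirabolic_ext ?_
  change (unip _).1.1 * γ.1.1 = γ.1.1 * (unip _).1.1
  rw [unip_val, unip_val, add_mul, mul_add, one_mul, mul_one]
  congr 1
  have hsu : ∀ (X : Fin n × Fin n → R) i j, strictUpper ((colSet n r).indicator X) i j =
      (colSet n r).indicator X (i, j) := fun X i j => by
    rw [strictUpper_apply]
    split_ifs with h
    · rfl
    · rw [Set.indicator_of_notMem]
      rintro ⟨h1, h2⟩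
      refine h (show (i : ℕ) < j from ?_)
      simp only at h1 h2; omega
  have hl : strictUpper ((colSet n r).indicator (matMul γ.1.1 X)) * γ.1.1 =
      strictUpper ((colSet n r).indicator (matMul γ.1.1 X)) := by
    ext i j
    rw [Matrix.mul_apply]
    have : ∀ l, strictUpper ((colSet n r).indicator (matMul γ.1.1 X)) i l * γ.1.1 l j =
        strictUpper ((colSet n r).indicator (matMul γ.1.1 X)) i l *
          (1 : Matrix (Fin n) (Fin n) R) l j := fun l => by
      by_cases h : (i, l) ∈ colSet n r
      · rw [hrow l j h.2.ge]
      · rw [hsu, Set.indicator_of_notMem h, zero_mul, zero_mul]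
    simp_rw [this]
    rw [← Matrix.mul_apply, mul_one]
  rw [hl]
  ext i j
  rw [hsu, Matrix.mul_apply]
  simp_rw [hsu]
  by_cases hj : (j : ℕ) = r
  · by_cases hi : (i : ℕ) < r
    · rw [Set.indicator_of_mem (show (i, j) ∈ colSet n r from ⟨hi, hj⟩)]
      refine Finset.sum_congr rfl fun l _ => ?_
      by_cases hl : (l : ℕ) < r
      · rw [Set.indicator_of_mem (show (l, j) ∈ colSet n r from ⟨hl, hj⟩)]
      · rw [hcol i l (not_lt.1 hl), Matrix.one_apply_ne, zero_mul, zero_mul]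
        rintro rfl; exact hl hi
    · rw [Set.indicator_of_notMem fun h => hi h.1]
      refine (Finset.sum_eq_zero fun l _ => ?_).symm
      by_cases hl : (l : ℕ) < r
      · rw [hrow i l (not_lt.1 hi), Matrix.one_apply_ne, zero_mul]
        rintro rfl; exact hi hl
      · rw [Set.indicator_of_notMem fun h => hl h.1, mul_zero]
  · rw [Set.indicator_of_notMem fun h => hj h.2]
    refine (Finset.sum_eq_zero fun l _ => ?_).symm
    rw [Set.indicator_of_notMem fun h => hj h.2, mul_zero]

variable [TopologicalSpace R] [IsTopologicalRing R]

theorem continuous_unip : Continuous (unip : (Fin n × Fin n → R) → mirabolic n R) := by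
  have h : Continuous fun X : Fin n × Fin n → R => 1 + strictUpper X := by
    refine continuous_const.add (continuous_matrix fun i j => ?_)
    simp only [strictUpper_apply]
    split_ifs
    · exact continuous_apply _
    · exact continuous_const
  refine Continuous.subtype_mk (Units.continuous_iff.2 ⟨h, ?_⟩) _
  refine h.matrix_adjugate.congr fun X => ?_
  change _ = (1 + strictUpper X)⁻¹
  rw [Matrix.inv_def, det_one_add_strictUpper, Ring.inverse_one, one_smul]

end Unipotent

section Arrays

variable {k A Q : Type*} [Field k] [CommRing A] {n : ℕ} {d : k →+* A} {s : Q → A}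

theorem indicator_diag_add (S : Set (Fin n × Fin n)) (Γ : Fin n × Fin n → k)
    (X : Fin n × Fin n → A) : (S.indicator fun p => d (Γ p) + X p) =
      (S.indicator fun p => d (Γ p)) + S.indicator X :=
  Set.indicator_add' _ _ _

theorem mirabolicMap_unip_indicator (S : Set (Fin n × Fin n)) (Γ : Fin n × Fin n → k) :
    mirabolicMap n d (unip (S.indicator Γ)) = unip (S.indicator fun p => d (Γ p)) := by
  rw [mirabolicMap_unip]
  congr 1
  ext p
  by_cases hp : p ∈ S <;> simp [hp]

/-- Periodicity along an abelian unipotent subgroup. -/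
theorem apply_unip_indicator_diag_add {E : Type*} {S : Set (Fin n × Fin n)}
    (hS : ∀ i l j, (i, l) ∈ S → (l, j) ∈ S → False) {φ : mirabolic n A → E}
    (hφ : ∀ (Γ : Fin n × Fin n → k) g, φ (mirabolicMap n d (unip (S.indicator Γ)) * g) = φ g)
    (g : mirabolic n A) (Γ : Fin n × Fin n → k) (X : Fin n × Fin n → A) :
    φ (unip (S.indicator fun p => d (Γ p) + X p) * g) = φ (unip (S.indicator X) * g) := by
  rw [indicator_diag_add, ← unip_indicator_mul S S _ _ hS, ← mirabolicMap_unip_indicator, mul_assoc,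
    hφ]

theorem indicator_section_congr {S : Set (Fin n × Fin n)} {Z Z' : Fin n × Fin n → Q}
    (h : ∀ p ∈ S, Z p = Z' p) :
    (S.indicator fun p => s (Z p)) = S.indicator fun p => s (Z' p) := by
  ext p
  by_cases hp : p ∈ S
  · simp [hp, h p hp]
  · simp [hp]

theorem continuous_unip_indicator [TopologicalSpace A] [IsTopologicalRing A] [TopologicalSpace Q]
    (hs : Continuous s) (S : Set (Fin n × Fin n)) :
    Continuous fun Z : Fin n × Fin n → Q => unip (S.indicator fun p => s (Z p)) := by
  classical
  refine continuous_unip.comp (continuous_pi fun p => ?_)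
  by_cases hp : p ∈ S
  · simp only [hp, Set.indicator_of_mem]; exact hs.comp (continuous_apply p)
  · simp only [hp, not_false_eq_true, Set.indicator_of_notMem]; exact continuous_const

variable [AddCommGroup Q] [Module k Q]

theorem addChar_sum_add_smul (ψ : AddChar Q ℂ)
    (ξ η : Fin n × Fin n → k) (Z : Fin n × Fin n → Q) :
    ψ (-∑ p, (ξ + η) p • Z p) = ψ (-∑ p, η p • Z p) * ψ (-∑ p, ξ p • Z p) := by
  rw [← AddChar.map_add_eq_mul]
  congr 1
  simp only [Pi.add_apply, add_smul, Finset.sum_add_distrib]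
  abel

theorem sum_smul_congr {S : Set (Fin n × Fin n)} {ξ : Fin n × Fin n → k} (hξ : ∀ p ∉ S, ξ p = 0)
    {Z Z' : Fin n × Fin n → Q} (h : ∀ p ∈ S, Z p = Z' p) :
    ∑ p, ξ p • Z p = ∑ p, ξ p • Z' p := by
  refine Finset.sum_congr rfl fun p _ => ?_
  by_cases hp : p ∈ S
  · rw [h p hp]
  · rw [hξ p hp, zero_smul, zero_smul]

/-- The transpose of a matrix acting on frequencies. -/
def transposeMul (γ : Matrix (Fin n) (Fin n) k) (ξ : Fin n × Fin n → k) : Fin n × Fin n → k :=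
  fun p => ∑ i, ξ (i, p.2) * γ i p.1

theorem sum_smul_matrix (γ : Matrix (Fin n) (Fin n) k) (ξ : Fin n × Fin n → k)
    (Z : Fin n × Fin n → Q) :
    ∑ p, ξ p • ∑ l, γ p.1 l • Z (l, p.2) = ∑ p, transposeMul γ ξ p • Z p := by
  simp_rw [transposeMul, Finset.sum_smul, Finset.smul_sum, smul_smul]
  simp only [Fintype.sum_prod_type]
  rw [Finset.sum_comm]
  conv_rhs => rw [Finset.sum_comm]
  refine Finset.sum_congr rfl fun j _ => ?_
  rw [Finset.sum_comm]

theorem continuous_addChar_sum_smul [TopologicalSpace Q] [IsTopologicalAddGroup Q]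
    [ContinuousConstSMul k Q] {ψ : AddChar Q ℂ} (hψ : Continuous ψ) (ξ : Fin n × Fin n → k) :
    Continuous fun Z : Fin n × Fin n → Q => ψ (-∑ p, ξ p • Z p) :=
  hψ.comp (continuous_finsetSum _ fun p _ => (continuous_apply p).const_smul _).neg

end Arrays

section Coefficients

set_option linter.unusedSectionVars false

open MeasureTheory Filter Topology

variable {k A Q : Type*} [Field k] [CommRing A] [AddCommGroup Q] [Module k Q]
  [TopologicalSpace A] [TopologicalSpace Q]

/-- `q : A → Q` is the quotient map by the image of `k`, and `s` is a continuous section of it. -/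
structure IsLatticeQuotient (d : k →+* A) (q : A →+ Q) (s : Q → A) : Prop where
  map_diag (x : k) : q (d x) = 0
  map_mul (x : k) (a : A) : q (d x * a) = x • q a
  exists_add_eq (a b : A) : q a = q b → ∃ x : k, d x + a = b
  continuous_section : Continuous s
  map_section (z : Q) : q (s z) = z

variable {d : k →+* A} {q : A →+ Q} {s : Q → A}

theorem IsLatticeQuotient.eq_of_map_eq (hL : IsLatticeQuotient d q s) {ι E : Type*}
    {H : (ι → A) → E} (hH : ∀ (Γ : ι → k) X, H (fun p => d (Γ p) + X p) = H X) {X Y : ι → A}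
    (h : ∀ p, q (X p) = q (Y p)) : H X = H Y := by
  choose Γ hΓ using fun p => hL.exists_add_eq _ _ (h p)
  rw [← hH Γ X]
  exact congrArg H (funext hΓ)

variable [IsTopologicalAddGroup Q] [CompactSpace Q] [SecondCountableTopology Q] [MeasurableSpace Q]
  [BorelSpace Q] (ν : Measure Q) [ν.IsAddHaarMeasure] [IsProbabilityMeasure ν]

theorem integrable_of_continuous {ι : Type*} [Fintype ι] {f : (ι → Q) → ℂ} (hf : Continuous f) :
    Integrable f (Measure.pi fun _ : ι => ν) :=
  hf.integrable_of_hasCompactSupport (HasCompactSupport.of_compactSpace _)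

theorem integral_section_add (hL : IsLatticeQuotient d q s) {ι : Type*} [Fintype ι]
    {H : (ι → A) → ℂ} (hH : ∀ (Γ : ι → k) X, H (fun p => d (Γ p) + X p) = H X) (C : ι → A) :
    ∫ Z, H (fun p => s (Z p) + C p) ∂(Measure.pi fun _ : ι => ν) =
      ∫ Z, H (fun p => s (Z p)) ∂(Measure.pi fun _ : ι => ν) := by
  rw [← integral_add_right_eq_self (fun Z : ι → Q => H (fun p => s (Z p))) (fun p => q (C p))]
  refine integral_congr_ae (Eventually.of_forall fun Z => ?_)
  refine hL.eq_of_map_eq hH fun p => ?_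
  rw [map_add, hL.map_section, hL.map_section, Pi.add_apply]

variable [IsTopologicalRing A]

theorem integral_section_shear (hL : IsLatticeQuotient d q s) {ι : Type*} [Fintype ι]
    {H : (ι → A) → ℂ} (hH : ∀ (Γ : ι → k) X, H (fun p => d (Γ p) + X p) = H X)
    (hHc : Continuous H) (T : Set ι) {C : (ι → Q) → ι → A} (hC : Continuous C)
    (hCT : ∀ Z Z', (∀ i ∉ T, Z i = Z' i) → C Z = C Z') :
    ∫ Z, H (fun p => s (Z p) + T.indicator (C Z) p) ∂(Measure.pi fun _ : ι => ν) =
      ∫ Z, H (fun p => s (Z p)) ∂(Measure.pi fun _ : ι => ν) := by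
  classical
  have hs := hL.continuous_section
  let F (C : (ι → Q) → ι → A) (Z W : ι → Q) : ℂ :=
    H fun p => if p ∈ T then s (W p) + C Z p else s (Z p)
  have key : ∀ C : (ι → Q) → ι → A, Continuous C →
      (∀ Z Z', (∀ i ∉ T, Z i = Z' i) → C Z = C Z') →
      ∫ Z, F C Z Z ∂(Measure.pi fun _ : ι => ν) =
        ∫ Z, ∫ W, F C Z W ∂(Measure.pi fun _ : ι => ν) ∂(Measure.pi fun _ : ι => ν) := by
    intro C hC hCT
    refine (integral_diag_eq_integral_integral ν Tᶜ (F := F C) (fun Z Z' W h => ?_)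
      (fun Z W W' h => ?_) (integrable_of_continuous ν ?_)).2
    · change H _ = H _
      congr 1; ext p
      split_ifs with hp
      · rw [hCT Z Z' h]
      · rw [h p hp]
    · change H _ = H _
      congr 1; ext p
      split_ifs with hp
      · rw [h p (not_not.2 hp)]
      · rfl
    · refine hHc.comp (continuous_pi fun p => ?_)
      split_ifs
      · exact (hs.comp (continuous_apply p)).add ((continuous_apply p).comp hC)
      · exact hs.comp (continuous_apply p)
  have h1 : ∀ Z : ι → Q, H (fun p => s (Z p) + T.indicator (C Z) p) = F C Z Z := fun Z => by
    change H _ = H _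
    congr 1; ext p
    by_cases hp : p ∈ T <;> simp [hp]
  have h2 : ∀ Z : ι → Q, H (fun p => s (Z p)) = F (fun _ => 0) Z Z := fun Z => by
    change H _ = H _
    congr 1; ext p
    by_cases hp : p ∈ T <;> simp [hp]
  simp_rw [h1, h2]
  rw [key C hC hCT, key _ continuous_const fun _ _ _ => rfl]
  refine integral_congr_ae (Eventually.of_forall fun Z => ?_)
  let H' (X : ι → A) : ℂ := H fun p => if p ∈ T then X p else s (Z p)
  have hH' : ∀ (Γ : ι → k) X, H' (fun p => d (Γ p) + X p) = H' X := fun Γ X => by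
    refine hL.eq_of_map_eq hH fun p => ?_
    split_ifs
    · rw [map_add, hL.map_diag, zero_add]
    · rfl
  have h3 := integral_section_add ν hL hH' (C Z)
  have h4 := integral_section_add ν hL hH' 0
  exact h3.trans h4.symm

variable {n : ℕ}

/-- The Fourier coefficient of `φ` with frequency `ξ` along the unipotent matrices supported
on `S`. -/
noncomputable def coeff (ψ : AddChar Q ℂ) (s : Q → A) (S : Set (Fin n × Fin n))
    (ξ : Fin n × Fin n → k) (φ : mirabolic n A → ℂ) (g : mirabolic n A) : ℂ :=
  ∫ Z, ψ (-∑ p, ξ p • Z p) * φ (unip (S.indicator fun p => s (Z p)) * g)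
    ∂(Measure.pi fun _ : Fin n × Fin n => ν)

theorem isLocallyConstant_coeff (ψ : AddChar Q ℂ) (hs : Continuous s) (S : Set (Fin n × Fin n))
    (ξ : Fin n × Fin n → k) {φ : mirabolic n A → ℂ} (hφ : IsLocallyConstant φ) :
    IsLocallyConstant (coeff ν ψ s S ξ φ) := by
  have hc : Continuous fun z : mirabolic n A × (Fin n × Fin n → Q) =>
      unip (S.indicator fun p => s (z.2 p)) * z.1 :=
    ((continuous_unip_indicator hs S).comp continuous_snd).mul continuous_fst
  exact isLocallyConstant_integral (Measure.pi fun _ : Fin n × Fin n => ν)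
    (fun Z => ψ (-∑ p, ξ p • Z p))
    (F := fun g Z => φ (unip (S.indicator fun p => s (Z p)) * g)) (hφ.comp_continuous hc)

theorem integrable_coeff [ContinuousConstSMul k Q] {ψ : AddChar Q ℂ} (hψ : Continuous ψ)
    (hs : Continuous s) (S : Set (Fin n × Fin n)) (ξ : Fin n × Fin n → k) {φ : mirabolic n A → ℂ}
    (hφ : Continuous φ) (g : mirabolic n A) :
    Integrable (fun Z => ψ (-∑ p, ξ p • Z p) * φ (unip (S.indicator fun p => s (Z p)) * g))
      (Measure.pi fun _ : Fin n × Fin n => ν) :=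
  integrable_of_continuous ν ((continuous_addChar_sum_smul hψ ξ).mul
    (hφ.comp ((continuous_unip_indicator hs S).mul continuous_const)))

/-- Fourier coefficients in stages. -/
theorem coeff_coeff (ψ : AddChar Q ℂ) {S T : Set (Fin n × Fin n)} (hST : Disjoint S T)
    (hmul : ∀ i l j, (i, l) ∈ S → (l, j) ∈ T → False) {ξ η : Fin n × Fin n → k}
    (hξ : ∀ p ∉ S, ξ p = 0) (hη : ∀ p ∉ T, η p = 0) {φ : mirabolic n A → ℂ} {g : mirabolic n A}
    (hφ : Integrable (fun Z => ψ (-∑ p, (ξ + η) p • Z p) *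
      φ (unip ((S ∪ T).indicator fun p => s (Z p)) * g)) (Measure.pi fun _ : Fin n × Fin n => ν)) :
    Integrable (fun Z => ψ (-∑ p, η p • Z p) * coeff ν ψ s S ξ φ
      (unip (T.indicator fun p => s (Z p)) * g)) (Measure.pi fun _ : Fin n × Fin n => ν) ∧
    coeff ν ψ s T η (coeff ν ψ s S ξ φ) g = coeff ν ψ s (S ∪ T) (ξ + η) φ g := by
  let F (Z W : Fin n × Fin n → Q) : ℂ := ψ (-∑ p, η p • Z p) * (ψ (-∑ p, ξ p • W p) *
    φ (unip (S.indicator fun p => s (W p)) * (unip (T.indicator fun p => s (Z p)) * g)))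
  have hF : ∀ Z, ψ (-∑ p, (ξ + η) p • Z p) *
      φ (unip ((S ∪ T).indicator fun p => s (Z p)) * g) = F Z Z := fun Z => by
    rw [addChar_sum_add_smul, Set.indicator_union_of_disjoint hST]
    have := unip_indicator_mul S T (fun p => s (Z p)) (fun p => s (Z p)) hmul
    change _ * φ (unip (S.indicator (fun p => s (Z p)) + T.indicator fun p => s (Z p)) * g) = _
    rw [← this, mul_assoc, mul_assoc]
  simp_rw [hF] at hφ
  have := integral_diag_eq_integral_integral ν T (F := F) (fun Z Z' W h => ?_)
    (fun Z W W' h => ?_) hφ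
  · simp only [F, integral_const_mul] at this
    refine ⟨this.1, ?_⟩
    unfold coeff
    simp_rw [hF]
    exact this.2.symm
  · change _ * _ = _ * _
    rw [sum_smul_congr hη h, indicator_section_congr h]
  · have h' : ∀ p ∈ S, W p = W' p := fun p hp => h p (Set.disjoint_left.1 hST hp)
    change _ * _ = _ * _
    rw [sum_smul_congr hξ h', indicator_section_congr h']

/-- The coefficients along a column under left translation by a rational matrix normalizing it. -/
theorem coeff_mirabolicMap_mul [ContinuousConstSMul k Q] (hL : IsLatticeQuotient d q s)
    (ψ : AddChar Q ℂ) {r : ℕ} {γ : mirabolic n k}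
    (hrow : ∀ i j : Fin n, r ≤ (i : ℕ) → γ.1.1 i j = (1 : Matrix (Fin n) (Fin n) k) i j)
    (hcol : ∀ i j : Fin n, r ≤ (j : ℕ) → γ.1.1 i j = (1 : Matrix (Fin n) (Fin n) k) i j)
    {φ : mirabolic n A → ℂ} {g : mirabolic n A}
    (hφγ : ∀ X : Fin n × Fin n → A, φ (mirabolicMap n d γ * (unip X * g)) = φ (unip X * g))
    (hφ : ∀ (Γ : Fin n × Fin n → k) (X : Fin n × Fin n → A),
      φ (mirabolicMap n d (unip ((colSet n r).indicator Γ)) *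
        (unip X * (mirabolicMap n d γ * g))) = φ (unip X * (mirabolicMap n d γ * g)))
    (ξ : Fin n × Fin n → k) :
    coeff ν ψ s (colSet n r) ξ φ (mirabolicMap n d γ * g) =
      coeff ν ψ s (colSet n r) (transposeMul γ.1.1 ξ) φ g := by
  rw [coeff, ← integral_matrix_smul ν γ.1]
  refine integral_congr_ae (Eventually.of_forall fun Z => ?_)
  dsimp only
  rw [sum_smul_matrix]
  congr 1
  have hmap : ∀ (f : Fin n → Fin n → Prop), (∀ i j, f i j → γ.1.1 i j =
      (1 : Matrix (Fin n) (Fin n) k) i j) → ∀ i j, f i j → (mirabolicMap n d γ).1.1 i j =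
      (1 : Matrix (Fin n) (Fin n) A) i j := fun f hf i j hij => by
    change d (γ.1.1 i j) = _
    rw [hf i j hij, Matrix.one_apply, Matrix.one_apply]
    split_ifs <;> simp
  have hconj := unip_colSet_mul (γ := mirabolicMap n d γ)
    (hmap (fun i _ => r ≤ (i : ℕ)) hrow) (hmap (fun _ j => r ≤ (j : ℕ)) hcol) (fun p => s (Z p))
  have hper : φ (unip ((colSet n r).indicator fun p => s (∑ l, γ.1.1 p.1 l • Z (l, p.2))) *
      (mirabolicMap n d γ * g)) = φ (unip ((colSet n r).indicator
        (matMul (mirabolicMap n d γ).1.1 fun p => s (Z p))) * (mirabolicMap n d γ * g)) := by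
    refine hL.eq_of_map_eq (H := fun X => φ (unip ((colSet n r).indicator X) *
      (mirabolicMap n d γ * g))) (fun Γ X => ?_) fun p => ?_
    · rw [indicator_diag_add, ← unip_indicator_mul _ _ _ _ (fun i l j h h' => ?_),
        ← mirabolicMap_unip_indicator, mul_assoc, hφ]
      have h1 := h.2
      have h2 := h'.1
      simp only at h1 h2
      omega
    · rw [hL.map_section, matMul, map_sum]
      refine Finset.sum_congr rfl fun l _ => ?_
      change _ = q (d (γ.1.1 p.1 l) * _)
      rw [hL.map_mul, hL.map_section]
  rw [hper, ← mul_assoc, hconj, mul_assoc, hφγ]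

end Coefficients

section MatrixCompletion

variable {k : Type*} [Field k] {n : ℕ}

/-- A nonzero row vector supported on the indices `< r` is the row of index `r - 1` of an invertible
matrix whose rows and columns of index at least `r` are those of the identity. -/
theorem exists_mirabolic_row_eq {r : ℕ} (hr : r < n) {x : Fin n → k}
    (hx : ∀ j : Fin n, r ≤ (j : ℕ) → x j = 0) (hx0 : x ≠ 0) :
    ∃ γ : mirabolic n k,
      (∀ i j : Fin n, r ≤ (i : ℕ) → γ.1.1 i j = (1 : Matrix (Fin n) (Fin n) k) i j) ∧
      (∀ i j : Fin n, r ≤ (j : ℕ) → γ.1.1 i j = (1 : Matrix (Fin n) (Fin n) k) i j) ∧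
      ∀ i j : Fin n, (i : ℕ) + 1 = r → γ.1.1 i j = x j := by
  obtain ⟨i₀, hi₀⟩ := Function.ne_iff.1 hx0
  have hi₀r : (i₀ : ℕ) < r := not_le.1 fun h => hi₀ (hx i₀ h)
  let a : Fin n := ⟨r - 1, by omega⟩
  have har : (a : ℕ) < r := by change r - 1 < r; omega
  let σ : Equiv.Perm (Fin n) := Equiv.swap a i₀
  have hσ : ∀ j : Fin n, r ≤ (j : ℕ) → σ j = j := fun j hj =>
    Equiv.swap_apply_of_ne_of_ne (by rintro rfl; omega) (by rintro rfl; omega)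
  let M : Matrix (Fin n) (Fin n) k := ((1 : Matrix (Fin n) (Fin n) k).updateRow i₀ x).submatrix σ id
  have hM : IsUnit M.det := by
    rw [Matrix.det_permute, ← Matrix.cramer_transpose_apply, Matrix.transpose_one, Matrix.cramer_one]
    refine (Units.isUnit ((Units.map (Int.castRingHom k).toMonoidHom) (Equiv.Perm.sign σ))).mul ?_
    exact isUnit_iff_ne_zero.2 hi₀
  have hrow : ∀ i j : Fin n, r ≤ (i : ℕ) → M i j = (1 : Matrix (Fin n) (Fin n) k) i j := by
    intro i j hi
    change (1 : Matrix (Fin n) (Fin n) k).updateRow i₀ x (σ i) j = _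
    rw [hσ i hi, Matrix.updateRow_ne (by rintro rfl; omega)]
  refine ⟨⟨Matrix.nonsingInvUnit M hM, fun i j hi => hrow i j (by omega)⟩, hrow, fun i j hj => ?_,
    fun i j hi => ?_⟩
  · change (1 : Matrix (Fin n) (Fin n) k).updateRow i₀ x (σ i) j = _
    have h1 : (1 : Matrix (Fin n) (Fin n) k).updateRow i₀ x (σ i) j =
        (1 : Matrix (Fin n) (Fin n) k) (σ i) j := by
      by_cases h : σ i = i₀
      · rw [h, Matrix.updateRow_self, hx j hj, Matrix.one_apply_ne]
        rintro rfl; omega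
      · rw [Matrix.updateRow_ne h]
    rw [h1, Matrix.one_apply, Matrix.one_apply]
    have : σ i = j ↔ i = j := by
      rw [← hσ j hj, σ.injective.eq_iff, hσ j hj]
    simp only [this]
  · have hia : i = a := Fin.ext (by change (i : ℕ) = r - 1; omega)
    change (1 : Matrix (Fin n) (Fin n) k).updateRow i₀ x (σ i) j = _
    rw [hia, show σ a = i₀ from Equiv.swap_apply_left _ _, Matrix.updateRow_self]

end MatrixCompletion

section UnipotentRows

variable {n : ℕ}

theorem unip_indicator_rows_cols {S : Set (Fin n × Fin n)} {r : ℕ} (hS : S ⊆ upperSet n r)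
    {R : Type*} [CommRing R]
    (Γ : Fin n × Fin n → R) {i j : Fin n} (hij : r ≤ (i : ℕ) + 1 ∨ r ≤ (j : ℕ)) :
    (unip (S.indicator Γ)).1.1 i j = (1 : Matrix (Fin n) (Fin n) R) i j := by
  rw [unip_val, Matrix.add_apply, strictUpper_apply, Set.indicator_of_notMem, ite_self, add_zero]
  intro h
  have h := hS h
  have h1 := h.1
  have h2 := h.2
  simp only at h1 h2
  omega

end UnipotentRows

section Expansion

open MeasureTheory Filter Topology

set_option linter.unusedSectionVars false

variable {k A Q : Type*} [Field k] [CommRing A] [AddCommGroup Q] [Module k Q]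
  [TopologicalSpace A] [TopologicalSpace Q] {d : k →+* A} {q : A →+ Q} {s : Q → A}
  [IsTopologicalAddGroup Q] [CompactSpace Q] [SecondCountableTopology Q] [MeasurableSpace Q]
  [BorelSpace Q] (ν : Measure Q) [ν.IsAddHaarMeasure] [IsProbabilityMeasure ν]
  [IsTopologicalRing A] [ContinuousConstSMul k Q] {n : ℕ}

/-- The frequency of the Whittaker character on the column `r`. -/
def colFreq (k : Type*) [Field k] (n r : ℕ) : Fin n × Fin n → k := fun p =>
  if (p.1 : ℕ) + 1 = p.2 ∧ (p.2 : ℕ) = r then 1 else 0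

/-- The frequency of the Whittaker character on the columns of index less than `r`. -/
def upperFreq (k : Type*) [Field k] (n r : ℕ) : Fin n × Fin n → k := fun p =>
  if (p.1 : ℕ) + 1 = p.2 ∧ (p.2 : ℕ) < r then 1 else 0

theorem colFreq_eq_zero {r : ℕ} {p : Fin n × Fin n} (hp : p ∉ colSet n r) : colFreq k n r p = 0 :=
  if_neg fun h => hp ⟨by omega, h.2⟩

theorem upperFreq_eq_zero {r : ℕ} {p : Fin n × Fin n} (hp : p ∉ upperSet n r) :
    upperFreq k n r p = 0 :=
  if_neg fun h => hp ⟨by omega, h.2⟩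

theorem colFreq_add_upperFreq (r : ℕ) :
    colFreq k n r + upperFreq k n r = upperFreq k n (r + 1) := by
  ext p
  simp only [Pi.add_apply, colFreq, upperFreq]
  by_cases h : (p.1 : ℕ) + 1 = p.2
  · rcases lt_trichotomy (p.2 : ℕ) r with h1 | h1 | h1
    · simp [h, h1, h1.ne, h1.trans (Nat.lt_succ_self r)]
    · simp [h, h1]
    · simp [h, h1.ne', h1.not_gt, Nat.not_le.2 h1]
  · simp [h]

theorem colSet_union_upperSet (r : ℕ) : colSet n r ∪ upperSet n r = upperSet n (r + 1) := by
  ext p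
  simp only [colSet, upperSet, Set.mem_union, Set.mem_ofPred_eq]
  omega

theorem disjoint_colSet_upperSet (r : ℕ) : Disjoint (colSet n r) (upperSet n r) :=
  Set.disjoint_left.2 fun _ h h' => h'.2.ne h.2

theorem transposeMul_colFreq {r : ℕ} {γ : Matrix (Fin n) (Fin n) k} {ξ : Fin n × Fin n → k}
    (hr : 1 ≤ r) (hξ : ∀ p, (p.2 : ℕ) ≠ r → ξ p = 0)
    (hγ : ∀ i j l : Fin n, (i : ℕ) + 1 = r → (j : ℕ) = r → γ i l = ξ (l, j)) :
    transposeMul γ (colFreq k n r) = ξ := by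
  ext ⟨l, j⟩
  simp only [transposeMul, colFreq]
  by_cases hj : (j : ℕ) = r
  · have hlt : r - 1 < n := by have := j.2; omega
    rw [Finset.sum_eq_single ⟨r - 1, hlt⟩]
    · rw [if_pos ⟨by simp only; omega, hj⟩, one_mul]
      exact hγ _ j l (by simp only; omega) hj
    · intro i _ hi
      rw [if_neg, zero_mul]
      rintro ⟨h1, h2⟩
      exact hi (Fin.ext (by simp only; omega))
    · simp
  · rw [hξ _ hj]
    refine Finset.sum_eq_zero fun i _ => ?_
    rw [if_neg fun h => hj h.2, zero_mul]

/-- Cuspidality is inherited by the coefficients along the last column. -/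
theorem coeff_blockSet_coeff_colSet (hL : IsLatticeQuotient d q s) {ψ : AddChar Q ℂ}
    (hψ : Continuous ψ) {m r : ℕ} (hm : m < r) {φ : mirabolic n A → ℂ} (hφ : IsLocallyConstant φ)
    (hinv : ∀ (Γ : Fin n × Fin n → k) g,
      φ (mirabolicMap n d (unip ((blockSet n m (r + 1)).indicator Γ)) * g) = φ g)
    (hcusp : ∀ g, coeff ν ψ s (blockSet n m (r + 1)) (0 : Fin n × Fin n → k) φ g = 0)
    (g : mirabolic n A) :
    coeff ν ψ s (blockSet n m r) (0 : Fin n × Fin n → k)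
      (coeff ν ψ s (colSet n r) (colFreq k n r) φ) g = 0 := by
  have hs := hL.continuous_section
  let B := blockSet n m (r + 1)
  let Y₁ : Set (Fin n × Fin n) := {p | (p.1 : ℕ) < m ∧ (p.2 : ℕ) = r}
  let Y₂ : Set (Fin n × Fin n) := {p | m ≤ (p.1 : ℕ) ∧ (p.1 : ℕ) < r ∧ (p.2 : ℕ) = r}
  have hdisj : Disjoint (colSet n r) (blockSet n m r) :=
    Set.disjoint_left.2 fun _ h h' => h'.2.2.ne h.2
  have hξ : ∀ p ∉ Y₂, colFreq k n r p = 0 := fun p hp => if_neg fun h => hp ⟨by omega, by omega, h.2⟩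
  have hunion : colSet n r ∪ blockSet n m r = Y₂ ∪ B := by
    ext p
    simp only [colSet, blockSet, B, Y₂, Set.mem_union, Set.mem_ofPred_eq]
    omega
  have hY₂B : Disjoint Y₂ B := Set.disjoint_left.2 fun p h h' => absurd h'.1 (not_lt.2 h.1)
  rw [(coeff_coeff ν ψ hdisj (fun i l j h h' => ?_) (ξ := colFreq k n r)
    (η := 0) (fun p => colFreq_eq_zero) (fun _ _ => rfl)
    (integrable_coeff ν hψ hs _ _ hφ.continuous g)).2, add_zero, hunion, coeff]
  swap
  · have h1 := h.2
    have h2 := h'.1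
    simp only at h1 h2
    omega
  let F (W Z : Fin n × Fin n → Q) : ℂ := ψ (-∑ p, colFreq k n r p • W p) *
    φ (unip ((Y₂.indicator fun p => s (W p)) + B.indicator fun p => s (Z p)) * g)
  have hF : ∀ Z : Fin n × Fin n → Q, ψ (-∑ p, colFreq k n r p • Z p) *
      φ (unip ((Y₂ ∪ B).indicator fun p => s (Z p)) * g) = F Z Z := fun Z => by
    rw [Set.indicator_union_of_disjoint hY₂B]; rfl
  have hint := integrable_coeff ν hψ hs (Y₂ ∪ B) (colFreq k n r) hφ.continuous g
  simp_rw [hF] at hint ⊢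
  rw [(integral_diag_eq_integral_integral ν Y₂ (F := F) (fun Z Z' W h => ?_)
    (fun Z W W' h => ?_) hint).2]
  rotate_left
  · change _ * _ = _ * _
    rw [sum_smul_congr hξ h, indicator_section_congr h]
  · change _ * _ = _ * _
    rw [indicator_section_congr fun p hp => h p (Set.disjoint_right.1 hY₂B hp)]
  refine integral_eq_zero_of_ae (Eventually.of_forall fun W => ?_)
  change ∫ Z, _ * _ ∂_ = 0
  rw [integral_const_mul]
  refine mul_eq_zero_of_right _ ?_
  let C (Z : Fin n × Fin n → Q) : Fin n × Fin n → A :=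
    -upperMul (B.indicator fun p => s (Z p)) (Y₂.indicator fun p => s (W p))
  have hCs : ∀ Z, Y₁.indicator (C Z) = C Z := fun Z => by
    refine Set.indicator_eq_self.2 fun p hp => ?_
    by_contra hp'
    refine hp ?_
    change -_ = _
    rw [neg_eq_zero]
    refine upperMul_indicator_apply _ _ _ _ p fun l h h' => hp' ⟨h.1, h'.2.2⟩
  have hCsu : ∀ Z, upperMul (C Z) (Y₂.indicator fun p => s (W p)) = 0 := fun Z => by
    rw [← hCs]
    refine funext fun p => upperMul_indicator_apply _ _ _ _ p fun l h h' => ?_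
    have h1 := h.2
    have h2 := h'.2.1
    simp only at h1 h2
    omega
  have hY₁B : Y₁ ⊆ B := fun p hp => ⟨hp.1, by have := hp.2; omega, by have := hp.2; omega⟩
  have hsplit : ∀ Z : Fin n × Fin n → Q,
      unip ((Y₂.indicator fun p => s (W p)) + B.indicator fun p => s (Z p)) =
      unip (B.indicator fun p => s (Z p) + Y₁.indicator (C Z) p) *
        unip (Y₂.indicator fun p => s (W p)) := fun Z => by
    have h1 : (B.indicator fun p => s (Z p) + Y₁.indicator (C Z) p) =
        (B.indicator fun p => s (Z p)) + C Z := by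
      refine (Set.indicator_add' B (fun p => s (Z p)) (Y₁.indicator (C Z))).trans ?_
      rw [Set.indicator_indicator, Set.inter_eq_self_of_subset_right hY₁B, hCs]
    have h2 : upperMul ((B.indicator fun p => s (Z p)) + C Z) (Y₂.indicator fun p => s (W p)) =
        upperMul (B.indicator fun p => s (Z p)) (Y₂.indicator fun p => s (W p)) := by
      have h3 : upperMul ((B.indicator fun p => s (Z p)) + C Z) (Y₂.indicator fun p => s (W p)) =
          upperMul (B.indicator fun p => s (Z p)) (Y₂.indicator fun p => s (W p)) +
          upperMul (C Z) (Y₂.indicator fun p => s (W p)) := by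
        ext p
        simp only [upperMul, strictUpper_add, add_mul, Matrix.add_apply, Pi.add_apply]
      rw [h3, hCsu, add_zero]
    rw [h1, unip_mul_unip, h2]
    congr 1
    change _ = _ + -upperMul _ _ + _ + _
    abel
  simp_rw [hsplit, mul_assoc]
  have hB : ∀ i l j, (i, l) ∈ B → (l, j) ∈ B → False := fun i l j h h' => by
    have h1 := h.2.1
    have h2 := h'.1
    simp only at h1 h2
    omega
  have hind : Continuous fun X : Fin n × Fin n → A => B.indicator X := by
    refine continuous_pi fun p => ?_
    by_cases hp : p ∈ B
    · simp only [hp, Set.indicator_of_mem]; exact continuous_apply p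
    · simp only [hp, not_false_eq_true, Set.indicator_of_notMem]; exact continuous_const
  have hshear := integral_section_shear ν hL (H := fun X => φ (unip (B.indicator X) *
    (unip (Y₂.indicator fun p => s (W p)) * g)))
    (fun Γ X => apply_unip_indicator_diag_add hB hinv _ Γ X)
    (hφ.continuous.comp ((continuous_unip.comp hind).mul continuous_const)) Y₁ (C := C) ?_ ?_
  · refine hshear.trans ?_
    have := hcusp (unip (Y₂.indicator fun p => s (W p)) * g)
    simpa [coeff] using this
  · refine continuous_pi fun p => ?_
    change Continuous fun Z : Fin n × Fin n → Q => -upperMul (B.indicator fun p => s (Z p))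
      (Y₂.indicator fun p => s (W p)) p
    refine Continuous.neg ?_
    simp only [upperMul, Matrix.mul_apply]
    refine continuous_finsetSum _ fun l _ => Continuous.mul ?_ continuous_const
    simp only [strictUpper_apply]
    split_ifs
    · by_cases hp : (p.1, l) ∈ B
      · simp only [hp, Set.indicator_of_mem]; exact hs.comp (continuous_apply _)
      · simp only [hp, not_false_eq_true, Set.indicator_of_notMem]; exact continuous_const
    · exact continuous_const
  · intro Z Z' h
    change -_ = -_
    congr 1
    ext p
    simp only [upperMul, Matrix.mul_apply]
    refine Finset.sum_congr rfl fun l _ => ?_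
    by_cases hl : (l, p.2) ∈ Y₂
    · congr 1
      simp only [strictUpper_apply]
      split_ifs
      · by_cases hp : (p.1, l) ∈ B
        · rw [Set.indicator_of_mem hp, Set.indicator_of_mem hp, h]
          intro h'
          have h1 := h'.2
          have h2 := hl.2.1
          simp only at h1 h2
          omega
        · rw [Set.indicator_of_notMem hp, Set.indicator_of_notMem hp]
      · rfl
    · simp [strictUpper_apply, Set.indicator_of_notMem hl]

/-- The Fourier expansion along the column `r`. -/
theorem mem_of_forall_coeff_colSet_mem (hL : IsLatticeQuotient d q s) {ψ : AddChar Q ℂ}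
    (hψ_ne : ∃ z, ψ z ≠ 1)
    (hdual : ∀ χ : AddChar Q ℂ, Continuous χ → ∃ x : k, ∀ z, χ z = ψ (x • z))
    (I : AddSubgroup ℂ) {r : ℕ} {φ : mirabolic n A → ℂ} (hφ : IsLocallyConstant φ)
    (hinv : ∀ (Γ : Fin n × Fin n → k) g,
      φ (mirabolicMap n d (unip ((colSet n r).indicator Γ)) * g) = φ g)
    (g : mirabolic n A)
    (h : ∀ ξ : Fin n × Fin n → k, (∀ p ∉ colSet n r, ξ p = 0) →
      coeff ν ψ s (colSet n r) ξ φ g ∈ I) : φ g ∈ I := by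
  classical
  have hcol : ∀ i l j : Fin n, (i, l) ∈ colSet n r → (l, j) ∈ colSet n r → False :=
    fun i l j h h' => by
      have h1 := h.2
      have h2 := h'.1
      simp only at h1 h2
      omega
  let f (Z : Fin n × Fin n → Q) : ℂ := φ (unip ((colSet n r).indicator fun p => s (Z p)) * g)
  have hf : IsLocallyConstant f := hφ.comp_continuous
    ((continuous_unip_indicator hL.continuous_section (colSet n r)).mul
      (continuous_const (y := g)))
  have hf0 : f 0 = φ g := by
    have := hL.eq_of_map_eq (H := fun X => φ (unip ((colSet n r).indicator X) * g))
      (X := fun _ => s 0) (Y := 0) (apply_unip_indicator_diag_add hcol hinv g) fun p => by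
        rw [hL.map_section, Pi.zero_apply, map_zero]
    change φ (unip ((colSet n r).indicator fun p => s 0) * g) = _
    rw [this, Set.indicator_zero', unip_zero, one_mul]
  rw [← hf0]
  refine mem_of_forall_integral_addChar_mem (Measure.pi fun _ : Fin n × Fin n => ν) I hf
    fun χ hχ hχf => ?_
  obtain ⟨ξ, hξ⟩ := exists_pi_eq_addChar_sum_smul ψ hdual χ hχ
  have hξ0 : ∀ p ∉ colSet n r, ξ p = 0 := fun p hp => by
    by_contra hne
    obtain ⟨z, hz⟩ := hψ_ne
    refine hz ?_
    have hper : (Pi.single p ((ξ p)⁻¹ • z) : Fin n × Fin n → Q) ∈ periods f := fun Z => by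
      change φ (unip _ * g) = φ (unip _ * g)
      rw [indicator_section_congr (Z' := Z)]
      intro p' hp'
      rw [Pi.add_apply, Pi.single_eq_of_ne (by rintro rfl; exact hp hp'), add_zero]
    have := hχf _ hper
    rw [hξ, Finset.sum_eq_single p (fun p' _ hp' => by rw [Pi.single_eq_of_ne hp', smul_zero])
      (by simp), Pi.single_eq_same, smul_inv_smul₀ hne] at this
    exact this
  have := h ξ hξ0
  unfold coeff at this
  convert this using 3 with Z
  rw [hξ, mul_comm]
  congr 2
  simp [Finset.sum_neg_distrib]

/-- A smooth function that is left invariant under rational points, cuspidal, and whose Whittaker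
coefficients lie in `I` takes its values in `I`; here only the first `r` columns and the first
`r - 1` rows are involved. -/
theorem mem_of_forall_coeff_upperSet_mem (hL : IsLatticeQuotient d q s) {ψ : AddChar Q ℂ}
    (hψ : Continuous ψ) (hψ_ne : ∃ z, ψ z ≠ 1)
    (hdual : ∀ χ : AddChar Q ℂ, Continuous χ → ∃ x : k, ∀ z, χ z = ψ (x • z))
    (I : AddSubgroup ℂ) {r : ℕ} (hr : 1 ≤ r) (hrn : r ≤ n) {φ : mirabolic n A → ℂ}
    (hφ : IsLocallyConstant φ)
    (hinv : ∀ γ : mirabolic n k, (∀ i j : Fin n, r ≤ (i : ℕ) + 1 ∨ r ≤ (j : ℕ) →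
      γ.1.1 i j = (1 : Matrix (Fin n) (Fin n) k) i j) → ∀ g, φ (mirabolicMap n d γ * g) = φ g)
    (hcusp : ∀ m, 1 ≤ m → m < r → ∀ g,
      coeff ν ψ s (blockSet n m r) (0 : Fin n × Fin n → k) φ g = 0)
    (hW : ∀ g, coeff ν ψ s (upperSet n r) (upperFreq k n r) φ g ∈ I) (g : mirabolic n A) :
    φ g ∈ I := by
  induction r, hr using Nat.le_induction generalizing φ g with
  | base =>
    have h1 : upperSet n 1 = ∅ := by
      ext p
      simp only [upperSet, Set.mem_ofPred_eq, Set.mem_empty_iff_false, iff_false]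
      omega
    have h2 : upperFreq k n 1 = 0 := by
      ext p
      exact upperFreq_eq_zero (h1 ▸ Set.notMem_empty p)
    have := hW g
    rw [h1, h2, coeff] at this
    simp only [Pi.zero_apply, zero_smul, Finset.sum_const_zero, neg_zero, AddChar.map_zero_eq_one,
      one_mul, Set.indicator_empty', unip_zero, integral_const, probReal_univ, one_smul] at this
    exact this
  | succ r hr ih =>
    have hs := hL.continuous_section
    have hcolU : colSet n r ⊆ upperSet n (r + 1) := by
      rw [← colSet_union_upperSet]; exact Set.subset_union_left
    have hinv_unip : ∀ S ⊆ upperSet n (r + 1), ∀ (Γ : Fin n × Fin n → k) g,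
        φ (mirabolicMap n d (unip (S.indicator Γ)) * g) = φ g := fun S hS Γ g =>
      hinv _ (fun i j hij => unip_indicator_rows_cols hS Γ hij) g
    have htrans : ∀ γ : mirabolic n k,
        (∀ i j : Fin n, r ≤ (i : ℕ) → γ.1.1 i j = (1 : Matrix (Fin n) (Fin n) k) i j) →
        (∀ i j : Fin n, r ≤ (j : ℕ) → γ.1.1 i j = (1 : Matrix (Fin n) (Fin n) k) i j) →
        ∀ g, coeff ν ψ s (colSet n r) (colFreq k n r) φ (mirabolicMap n d γ * g) =
          coeff ν ψ s (colSet n r) (transposeMul γ.1.1 (colFreq k n r)) φ g :=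
      fun γ hrow hcol g => coeff_mirabolicMap_mul ν hL ψ hrow hcol
        (fun X => hinv γ (fun i j hij => hij.elim (fun h => hrow i j (by omega))
          fun h => hcol i j (by omega)) _) (fun Γ X => hinv_unip _ hcolU Γ _) _
    have hφ' : ∀ g, coeff ν ψ s (colSet n r) (colFreq k n r) φ g ∈ I := by
      refine ih (by omega) (isLocallyConstant_coeff ν ψ hs _ _ hφ) (fun γ hγ g => ?_)
        (fun m hm1 hmr g => ?_) fun g => ?_
      · rw [htrans γ (fun i j hi => hγ i j (Or.inl (by omega))) (fun i j hj => hγ i j (Or.inr hj)),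
          transposeMul_colFreq (ξ := colFreq k n r) hr fun p hp => if_neg fun h => hp h.2]
        intro i j l hi hj
        rw [hγ i l (Or.inl hi.ge), Matrix.one_apply, colFreq]
        simp only [hj, and_true]
        congr 1
        rw [Fin.ext_iff, eq_iff_iff]
        omega
      · refine coeff_blockSet_coeff_colSet ν hL hψ hmr hφ (hinv_unip _ fun p hp => ?_)
          (hcusp m hm1 (by omega)) g
        exact ⟨hp.1.trans_le hp.2.1, hp.2.2⟩
      · rw [(coeff_coeff ν ψ (disjoint_colSet_upperSet r) (fun i l j h h' => ?_)
          (fun p => colFreq_eq_zero) (fun p => upperFreq_eq_zero)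
          (integrable_coeff ν hψ hs _ _ hφ.continuous g)).2, colSet_union_upperSet,
          colFreq_add_upperFreq]
        · exact hW g
        · have h1 := h.2
          have h2 := h'.1
          have h3 := h'.2
          simp only at h1 h2 h3
          omega
    refine mem_of_forall_coeff_colSet_mem ν hL hψ_ne hdual I hφ (hinv_unip _ hcolU) g
      fun ξ hξ => ?_
    by_cases hξ0 : ξ = 0
    · have hblock : colSet n r = blockSet n r (r + 1) := by
        ext p
        simp only [colSet, blockSet, Set.mem_ofPred_eq]
        omega
      rw [hξ0, hblock, hcusp r hr (by omega)]
      exact I.zero_mem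
    · let a : Fin n := ⟨r, by omega⟩
      obtain ⟨γ, hrow, hcol, hγ⟩ := exists_mirabolic_row_eq (r := r) (by omega)
        (x := fun l => ξ (l, a)) (fun j hj => hξ _ fun h => absurd h.1 (not_lt.2 hj)) fun h => by
          refine hξ0 (funext fun p => ?_)
          by_cases hp : p ∈ colSet n r
          · have : p.2 = a := Fin.ext hp.2
            have h1 := congrFun h p.1
            rwa [← this] at h1
          · exact hξ p hp
      have := hφ' (mirabolicMap n d γ * g)
      rwa [htrans γ hrow hcol, transposeMul_colFreq (ξ := ξ) hr
        (fun p hp => hξ p fun h => hp h.2)] at this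
      intro i j l hi hj
      rw [hγ i l hi, show j = a from Fin.ext hj]

end Expansion

section HaarProbability

open MeasureTheory Filter Topology

set_option linter.unusedSectionVars false

variable {k A Q : Type*} [Field k] [CommRing A] [AddCommGroup Q] [Module k Q]
  [TopologicalSpace A] [TopologicalSpace Q] {d : k →+* A} {q : A →+ Q} {s : Q → A}
  [IsTopologicalAddGroup Q] [CompactSpace Q] [SecondCountableTopology Q] [MeasurableSpace Q]
  [BorelSpace Q] (ν : Measure Q) [ν.IsAddHaarMeasure] [IsProbabilityMeasure ν]
  [IsTopologicalRing A] {n : ℕ}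

theorem coeff_zero (ψ : AddChar Q ℂ) (s : Q → A) (S : Set (Fin n × Fin n))
    (φ : mirabolic n A → ℂ) (g : mirabolic n A) :
    coeff ν ψ s S (0 : Fin n × Fin n → k) φ g =
      ∫ Z, φ (unip (S.indicator fun p => s (Z p)) * g)
        ∂(Measure.pi fun _ : Fin n × Fin n => ν) := by
  simp only [coeff, Pi.zero_apply, zero_smul, Finset.sum_const_zero, neg_zero,
    AddChar.map_zero_eq_one, one_mul]

theorem indicator_add_indicator_eq {R : Type*} [CommRing R] (S : Set (Fin n × Fin n))
    (X Y : Fin n × Fin n → R) : S.indicator X + S.indicator Y = S.indicator fun p => X p + Y p :=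
  (Set.indicator_add' _ _ _).symm

/-- Right invariance of the integral over the upper triangular unipotent matrices supported on the
first `r` columns. -/
theorem coeff_upperSet_mul [ContinuousConstSMul k Q] (hL : IsLatticeQuotient d q s) (r : ℕ)
    {F : mirabolic n A → ℂ}
    (hF : ∀ (Γ : Fin n × Fin n → k), ∀ g ∈ upperUnipotent n A,
      F (mirabolicMap n d (unip ((upperSet n r).indicator Γ)) * g) = F g)
    (hint : ∀ g ∈ upperUnipotent n A, Integrable
      (fun Z => F (unip ((upperSet n r).indicator fun p => s (Z p)) * g))
      (Measure.pi fun _ : Fin n × Fin n => ν))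
    (H : Fin n × Fin n → A) {g : mirabolic n A} (hg : g ∈ upperUnipotent n A) :
    coeff ν 1 s (upperSet n r) (0 : Fin n × Fin n → k) F
        (unip ((upperSet n r).indicator H) * g) =
      coeff ν 1 s (upperSet n r) (0 : Fin n × Fin n → k) F g := by
  induction r generalizing F g with
  | zero =>
    have : upperSet n 0 = ∅ := by ext p; simp [upperSet]
    rw [this, Set.indicator_empty', unip_zero, one_mul]
  | succ r ih =>
    have hmul : ∀ i l j : Fin n, (i, l) ∈ colSet n r → (l, j) ∈ upperSet n r → False :=
      fun i l j h h' => by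
        have h1 := h.2
        have h2 := h'.1
        have h3 := h'.2
        simp only at h1 h2 h3
        omega
    have hcol : ∀ i l j : Fin n, (i, l) ∈ colSet n r → (l, j) ∈ colSet n r → False :=
      fun i l j h h' => by
        have h1 := h.2
        have h2 := h'.1
        simp only at h1 h2
        omega
    have hFS : ∀ S ⊆ upperSet n (r + 1), ∀ (Γ : Fin n × Fin n → k), ∀ g ∈ upperUnipotent n A,
        F (mirabolicMap n d (unip (S.indicator Γ)) * g) = F g := fun S hS Γ g hg => by
      have := hF (S.indicator Γ) g hg
      rwa [Set.indicator_indicator, Set.inter_eq_self_of_subset_right hS] at this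
    have hcolU : colSet n r ⊆ upperSet n (r + 1) := by
      rw [← colSet_union_upperSet]; exact Set.subset_union_left
    have hupU : upperSet n r ⊆ upperSet n (r + 1) := by
      rw [← colSet_union_upperSet]; exact Set.subset_union_right
    let F' := coeff ν 1 s (colSet n r) (0 : Fin n × Fin n → k) F
    have hstage : ∀ g ∈ upperUnipotent n A, Integrable
        (fun Z => F' (unip ((upperSet n r).indicator fun p => s (Z p)) * g))
        (Measure.pi fun _ : Fin n × Fin n => ν) ∧
        coeff ν 1 s (upperSet n r) (0 : Fin n × Fin n → k) F' g =
          coeff ν 1 s (upperSet n (r + 1)) (0 : Fin n × Fin n → k) F g := fun g hg => by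
      have := coeff_coeff ν (1 : AddChar Q ℂ) (s := s) (disjoint_colSet_upperSet r) hmul
        (ξ := (0 : Fin n × Fin n → k)) (η := (0 : Fin n × Fin n → k)) (fun _ _ => rfl)
        (fun _ _ => rfl) (φ := F) (g := g) (by
          rw [colSet_union_upperSet]
          simpa only [AddChar.one_apply, one_mul] using hint g hg)
      rw [colSet_union_upperSet, add_zero] at this
      simpa only [AddChar.one_apply, one_mul] using this
    have hF' : ∀ (Γ : Fin n × Fin n → k), ∀ g ∈ upperUnipotent n A,
        F' (mirabolicMap n d (unip ((upperSet n r).indicator Γ)) * g) = F' g := fun Γ g hg => by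
      have hγ : mirabolicMap n d (unip ((upperSet n r).indicator Γ)) ∈ upperUnipotent n A := by
        rw [mirabolicMap_unip_indicator]; exact unip_mem_upperUnipotent _
      refine (coeff_mirabolicMap_mul ν hL 1 (r := r)
        (fun i j hi => unip_indicator_rows_cols subset_rfl Γ (Or.inl (by omega)))
        (fun i j hj => unip_indicator_rows_cols subset_rfl Γ (Or.inr hj))
        (fun X => hFS _ hupU Γ _ (mul_mem (unip_mem_upperUnipotent _) hg))
        (fun Γ' X => hFS _ hcolU Γ' _
          (mul_mem (unip_mem_upperUnipotent _) (mul_mem hγ hg))) 0).trans ?_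
      congr 1
      ext p
      simp [transposeMul]
    have htrans : ∀ (X : Fin n × Fin n → A), ∀ g ∈ upperUnipotent n A,
        F' (unip ((upperSet n r).indicator X) * (unip ((colSet n r).indicator H) * g)) =
          F' (unip ((upperSet n r).indicator X) * g) := fun X g hg => by
      have h1 := unip_colSet_mul (r := r) (γ := unip ((upperSet n r).indicator X))
        (fun i j hi => unip_indicator_rows_cols subset_rfl X (Or.inl (by omega)))
        (fun i j hj => unip_indicator_rows_cols subset_rfl X (Or.inr hj)) H
      rw [← mul_assoc, ← h1, mul_assoc]
      simp only [F', coeff_zero]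
      simp_rw [← mul_assoc, unip_indicator_mul _ _ _ _ hcol, indicator_add_indicator_eq, mul_assoc]
      refine integral_section_add ν hL (H := fun Y => F (unip ((colSet n r).indicator Y) *
        (unip ((upperSet n r).indicator X) * g))) (fun Γ Y => ?_) _
      rw [indicator_diag_add, ← unip_indicator_mul _ _ _ _ hcol, ← mirabolicMap_unip_indicator,
        mul_assoc]
      exact hFS _ hcolU Γ _ (mul_mem (unip_mem_upperUnipotent _)
        (mul_mem (unip_mem_upperUnipotent _) hg))
    have hsplit : unip ((upperSet n (r + 1)).indicator H) =
        unip ((colSet n r).indicator H) * unip ((upperSet n r).indicator H) := by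
      rw [unip_indicator_mul _ _ _ _ hmul, ← colSet_union_upperSet,
        Set.indicator_union_of_disjoint (disjoint_colSet_upperSet r)]
      rfl
    have hug := mul_mem (unip_mem_upperUnipotent ((upperSet n r).indicator H)) hg
    rw [hsplit, mul_assoc, ← (hstage _ (mul_mem (unip_mem_upperUnipotent _) hug)).2,
      ← (hstage g hg).2, ← ih hF' (fun g hg => (hstage g hg).1) hg]
    rw [coeff_zero, coeff_zero]
    refine integral_congr_ae (Eventually.of_forall fun Z => ?_)
    exact htrans _ _ hug

/-- Right invariance of the integral over an abelian unipotent subgroup. -/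
theorem coeff_blockSet_mul (hL : IsLatticeQuotient d q s) (m r : ℕ) {F : mirabolic n A → ℂ}
    {g : mirabolic n A}
    (hF : ∀ (Γ : Fin n × Fin n → k) (X : Fin n × Fin n → A),
      F (mirabolicMap n d (unip ((blockSet n m r).indicator Γ)) *
        (unip ((blockSet n m r).indicator X) * g)) = F (unip ((blockSet n m r).indicator X) * g))
    (H : Fin n × Fin n → A) :
    ∫ Z, F (unip ((blockSet n m r).indicator fun p => s (Z p)) *
        (unip ((blockSet n m r).indicator H) * g)) ∂(Measure.pi fun _ : Fin n × Fin n => ν) =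
      ∫ Z, F (unip ((blockSet n m r).indicator fun p => s (Z p)) * g)
        ∂(Measure.pi fun _ : Fin n × Fin n => ν) := by
  have hB : ∀ i l j : Fin n, (i, l) ∈ blockSet n m r → (l, j) ∈ blockSet n m r → False :=
    fun i l j h h' => by
      have h1 := h.2.1
      have h2 := h'.1
      simp only at h1 h2
      omega
  simp_rw [← mul_assoc, unip_indicator_mul _ _ _ _ hB, indicator_add_indicator_eq]
  refine integral_section_add ν hL
    (H := fun Y => F (unip ((blockSet n m r).indicator Y) * g)) (fun Γ Y => ?_) _
  rw [indicator_diag_add, ← unip_indicator_mul _ _ _ _ hB, ← mirabolicMap_unip_indicator,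
    mul_assoc]
  exact hF _ _

variable {G : Subgroup (mirabolic n A)} (Γ : Subgroup G) (S : Set (Fin n × Fin n))
  (hS : ∀ X : Fin n × Fin n → A, unip (S.indicator X) ∈ G)

/-- The coset of `g` in `Γ\G`. -/
def LeftQuotient.mk {G : Type*} [Group G] (Γ : Subgroup G) (g : G) : LeftQuotient Γ :=
  Quotient.mk (QuotientGroup.rightRel Γ) g

theorem LeftQuotient.isQuotientMap_mk {G : Type*} [Group G] [TopologicalSpace G]
    (Γ : Subgroup G) : IsQuotientMap (LeftQuotient.mk Γ) :=
  isQuotientMap_quotient_mk'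

theorem LeftQuotient.continuous_rightMul {G : Type*} [Group G] [TopologicalSpace G]
    [ContinuousMul G] (Γ : Subgroup G) (h : G) : Continuous (LeftQuotient.rightMul Γ h) :=
  (LeftQuotient.isQuotientMap_mk Γ).continuous_iff.2
    ((LeftQuotient.isQuotientMap_mk Γ).continuous.comp (continuous_mul_const h))

theorem LeftQuotient.mk_mul_of_mem {G : Type*} [Group G] (Γ : Subgroup G) {γ : G} (hγ : γ ∈ Γ)
    (g : G) : LeftQuotient.mk Γ (γ * g) = LeftQuotient.mk Γ g := by
  refine Quotient.sound ?_
  change QuotientGroup.rightRel Γ _ _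
  rw [QuotientGroup.rightRel_apply]
  simpa using hγ

theorem LeftQuotient.borelSpace {G : Type*} [Group G] [TopologicalSpace G] (Γ : Subgroup G) :
    BorelSpace (LeftQuotient Γ) := ⟨rfl⟩

/-- The class in `Γ\G` of the unipotent matrix supported on `S` with given coordinates. -/
noncomputable def unipClass (s : Q → A) (Z : Fin n × Fin n → Q) : LeftQuotient Γ :=
  LeftQuotient.mk Γ ⟨unip (S.indicator fun p => s (Z p)), hS _⟩

theorem measurable_unipClass (hs : Continuous s) : Measurable (unipClass Γ S hS s) := by
  have := LeftQuotient.borelSpace Γ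
  have hc : Continuous (unipClass Γ S hS s) := (LeftQuotient.isQuotientMap_mk Γ).continuous.comp
    ((continuous_unip_indicator hs S).subtype_mk _)
  exact hc.measurable

theorem integral_descend_map_unipClass (hs : Continuous s) {F : G → ℂ} (hFc : Continuous F)
    (hF : ∀ γ ∈ Γ, ∀ g, F (γ * g) = F g) :
    ∫ x, LeftQuotient.descend Γ F x
        ∂((Measure.pi fun _ : Fin n × Fin n => ν).map (unipClass Γ S hS s)) =
      ∫ Z, F ⟨unip (S.indicator fun p => s (Z p)), hS _⟩
        ∂(Measure.pi fun _ : Fin n × Fin n => ν) := by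
  have := LeftQuotient.borelSpace Γ
  have hc : Continuous (LeftQuotient.descend Γ F) := by
    exact (LeftQuotient.isQuotientMap_mk Γ).continuous_iff.2
      (hFc.congr fun g => (LeftQuotient.descend_mk Γ F hF g).symm)
  rw [integral_map (measurable_unipClass Γ S hS hs).aemeasurable hc.aestronglyMeasurable]
  refine integral_congr_ae (Eventually.of_forall fun Z => ?_)
  exact LeftQuotient.descend_mk Γ F hF _

theorem isHaarProbability_map_unipClass (hs : Continuous s)
    (hinv : ∀ F : mirabolic n A → ℂ, (∀ γ ∈ Γ, ∀ g ∈ G, F (γ * g) = F g) →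
      (∀ g ∈ G, Integrable (fun Z => F (unip (S.indicator fun p => s (Z p)) * g))
        (Measure.pi fun _ : Fin n × Fin n => ν)) → ∀ h ∈ G,
      ∫ Z, F (unip (S.indicator fun p => s (Z p)) * h)
          ∂(Measure.pi fun _ : Fin n × Fin n => ν) =
        ∫ Z, F (unip (S.indicator fun p => s (Z p)) * 1)
          ∂(Measure.pi fun _ : Fin n × Fin n => ν)) :
    IsHaarProbability Γ ((Measure.pi fun _ : Fin n × Fin n => ν).map (unipClass Γ S hS s)) := by
  classical
  have := LeftQuotient.borelSpace Γ
  have hm := measurable_unipClass Γ S hS hs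
  refine ⟨?_, fun h => ?_⟩
  · rw [Measure.map_apply hm MeasurableSet.univ, Set.preimage_univ, measure_univ]
  have hright : ∀ h : G, Continuous (LeftQuotient.rightMul Γ h) :=
    LeftQuotient.continuous_rightMul Γ
  rw [Measure.map_map (hright h).measurable hm]
  refine Measure.ext fun B hB => ?_
  rw [Measure.map_apply ((hright h).measurable.comp hm) hB, Measure.map_apply hm hB]
  let F (g : mirabolic n A) : ℂ :=
    if hg : g ∈ G then B.indicator (fun _ => 1) (LeftQuotient.mk Γ ⟨g, hg⟩)
    else 0
  have hFG : ∀ g : G, F g = B.indicator (fun _ => 1)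
      (LeftQuotient.mk Γ g) := by
    intro g
    simp only [F]
    rw [dif_pos g.2]
  have hFZ : ∀ (h : G) Z, F (unip (S.indicator fun p => s (Z p)) * h) =
      (LeftQuotient.rightMul Γ h ∘ unipClass Γ S hS s ⁻¹' B).indicator (fun _ => 1) Z := by
    intro h Z
    refine (hFG (⟨unip (S.indicator fun p => s (Z p)), hS _⟩ * h)).trans ?_
    have hZ : (LeftQuotient.rightMul Γ h ∘ unipClass Γ S hS s) Z =
        LeftQuotient.mk Γ (⟨unip (S.indicator fun p => s (Z p)), hS _⟩ * h) := rfl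
    by_cases hB : (LeftQuotient.rightMul Γ h ∘ unipClass Γ S hS s) Z ∈ B
    · rw [Set.indicator_of_mem (Set.mem_preimage.2 hB), ← hZ, Set.indicator_of_mem hB]
    · rw [Set.indicator_of_notMem (mt Set.mem_preimage.1 hB), ← hZ, Set.indicator_of_notMem hB]
  have hmeas : ∀ h : G, MeasurableSet (LeftQuotient.rightMul Γ h ∘ unipClass Γ S hS s ⁻¹' B) :=
    fun h => ((hright h).measurable.comp hm) hB
  have key := hinv F (fun γ hγ g hg => ?_) (fun g hg => ?_) h h.2
  · have h1 := hFZ 1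
    rw [show ((1 : G) : mirabolic n A) = 1 from rfl] at h1
    simp_rw [hFZ h, h1] at key
    rw [integral_indicator_const _ (hmeas _), integral_indicator_const _ (hmeas _), Complex.real_smul,
      Complex.real_smul, mul_one, mul_one, Complex.ofReal_inj] at key
    have hone : LeftQuotient.rightMul Γ 1 ∘ unipClass Γ S hS s = unipClass Γ S hS s := by
      ext Z
      exact congrArg (LeftQuotient.mk Γ) (mul_one _)
    rw [hone] at key
    exact (measureReal_eq_measureReal_iff).1 key
  · have h1 := hFG (γ * ⟨g, hg⟩)
    have h2 := hFG ⟨g, hg⟩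
    rw [LeftQuotient.mk_mul_of_mem Γ hγ] at h1
    exact h1.trans h2.symm
  · have h1 := hFZ ⟨g, hg⟩
    simp_rw [h1]
    exact (integrable_const (1 : ℂ)).indicator (hmeas _)

end HaarProbability

section Integrality

open MeasureTheory Filter Topology

set_option linter.unusedSectionVars false

variable {k A Q : Type*} [Field k] [CommRing A] [AddCommGroup Q] [Module k Q]
  [TopologicalSpace A] [TopologicalSpace Q] {d : k →+* A} {q : A →+ Q} {s : Q → A}
  [IsTopologicalAddGroup Q] [CompactSpace Q] [SecondCountableTopology Q] [MeasurableSpace Q]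
  [BorelSpace Q] (ν : Measure Q) [ν.IsAddHaarMeasure] [IsProbabilityMeasure ν]
  [IsTopologicalRing A] [ContinuousConstSMul k Q] (n : ℕ)

variable (d) in
/-- The rational points of the group of upper triangular unipotent matrices. -/
def rationalUpper : Subgroup (upperUnipotent n A) :=
  ((upperUnipotent n k).map (mirabolicMap n d)).subgroupOf _

variable (d) in
/-- The rational points of the unipotent radical of type `(m, n - m)`. -/
def rationalRadical (m : ℕ) : Subgroup (unipotentRadical n A m) :=
  ((unipotentRadical n k m).map (mirabolicMap n d)).subgroupOf _

variable {n}

theorem unip_indicator_upperSet {R : Type*} [CommRing R] (X : Fin n × Fin n → R) :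
    unip ((upperSet n n).indicator X) = unip X :=
  unip_congr fun i j hij =>
    Set.indicator_of_mem (show (i, j) ∈ upperSet n n from ⟨hij, j.2⟩) _

theorem isHaarProbability_rationalUpper (hL : IsLatticeQuotient d q s) :
    IsHaarProbability (rationalUpper d n) ((Measure.pi fun _ : Fin n × Fin n => ν).map
      (unipClass (rationalUpper d n) (upperSet n n) (fun _ => unip_mem_upperUnipotent _) s)) := by
  refine isHaarProbability_map_unipClass ν _ _ _ hL.continuous_section fun F hF hint h hh => ?_
  have := coeff_upperSet_mul ν hL n (F := F) (fun Γ g hg => ?_) hint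
    (fun p => mirabolic.entry h p.1 p.2) (one_mem _)
  · rw [coeff_zero, coeff_zero, unip_indicator_upperSet, ← eq_unip_of_mem_upperUnipotent hh,
      mul_one] at this
    exact this
  · have hmem : mirabolicMap n d (unip ((upperSet n n).indicator Γ)) ∈ upperUnipotent n A := by
      rw [mirabolicMap_unip]; exact unip_mem_upperUnipotent _
    exact hF ⟨_, hmem⟩ ⟨_, unip_mem_upperUnipotent _, rfl⟩ g hg

theorem isHaarProbability_rationalRadical (hL : IsLatticeQuotient d q s) (m : ℕ) :
    IsHaarProbability (rationalRadical d n m) ((Measure.pi fun _ : Fin n × Fin n => ν).map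
      (unipClass (rationalRadical d n m) (blockSet n m n)
        (unip_indicator_blockSet_mem m) s)) := by
  refine isHaarProbability_map_unipClass ν _ _ _ hL.continuous_section fun F hF hint h hh => ?_
  have := coeff_blockSet_mul ν hL m n (F := F) (g := 1) (fun Γ X => ?_)
    (fun p => mirabolic.entry h p.1 p.2)
  · rw [← eq_unip_of_mem_unipotentRadical hh, mul_one] at this
    exact this
  · have hmem : mirabolicMap n d (unip ((blockSet n m n).indicator Γ)) ∈ unipotentRadical n A m := by
      rw [mirabolicMap_unip_indicator]; exact unip_indicator_blockSet_mem _ _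
    exact hF ⟨_, hmem⟩ ⟨_, unip_indicator_blockSet_mem _ _, rfl⟩ _
      (mul_mem (unip_indicator_blockSet_mem _ _) (one_mem _))

theorem continuous_superdiagonalSum :
    Continuous (superdiagonalSum : mirabolic n A → A) := by
  refine continuous_finsetSum _ fun i _ => continuous_finsetSum _ fun j _ => ?_
  split_ifs
  · exact (Units.continuous_val.comp continuous_subtype_val).matrix_elem i j
  · exact continuous_const

theorem mem_of_isLatticeQuotient (ν : Measure Q) [ν.IsAddHaarMeasure] [IsProbabilityMeasure ν]
    (hL : IsLatticeQuotient d q s) {ψ : AddChar A ℂ}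
    (hψ : Continuous ψ) (hψ_k : ∀ x : k, ψ (d x) = 1) {ψ' : AddChar Q ℂ} (hψ' : Continuous ψ')
    (hψq : ∀ a, ψ' (q a) = ψ a) (hψ_ne : ∃ z, ψ' z ≠ 1)
    (hdual : ∀ χ : AddChar Q ℂ, Continuous χ → ∃ x : k, ∀ z, χ z = ψ' (x • z))
    (I : AddSubgroup ℂ) (hn : 1 ≤ n) {φ : mirabolic n A → ℂ} (hφ : IsLocallyConstant φ)
    (hinv : ∀ (γ : mirabolic n k) g, φ (mirabolicMap n d γ * g) = φ g)
    (hcusp : ∀ m, 1 ≤ m → m < n → ∀ μ : Measure (LeftQuotient (rationalRadical d n m)),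
      IsHaarProbability _ μ → ∀ g : mirabolic n A,
        ∫ x, LeftQuotient.descend (rationalRadical d n m) (fun u => φ (u * g)) x ∂μ = 0)
    (hW : ∀ μ : Measure (LeftQuotient (rationalUpper d n)), IsHaarProbability _ μ →
      ∀ g : mirabolic n A, ∫ x, LeftQuotient.descend (rationalUpper d n)
        (fun u => (ψ (superdiagonalSum (u : mirabolic n A)))⁻¹ * φ (u * g)) x ∂μ ∈ I)
    (g : mirabolic n A) : φ g ∈ I := by
  have hs := hL.continuous_section
  refine mem_of_forall_coeff_upperSet_mem ν hL hψ' hψ_ne hdual I hn le_rfl hφ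
    (fun γ _ => hinv γ) (fun m hm hmn g => ?_) (fun g => ?_) g
  · have := hcusp m hm hmn _ (isHaarProbability_rationalRadical ν hL m) g
    have hc : Continuous fun u : unipotentRadical n A m => φ (u * g) :=
      hφ.continuous.comp (continuous_subtype_val.mul continuous_const)
    rw [integral_descend_map_unipClass ν _ _ _ hs hc] at this
    · rw [coeff_zero]; exact this
    · rintro γ ⟨γ₀, -, hγ₀⟩ u
      change φ (γ.1 * u.1 * g) = _
      rw [mul_assoc, ← hinv γ₀ (u * g)]
      exact congrArg (fun x => φ (x * (u * g))) hγ₀.symm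
  · have := hW _ (isHaarProbability_rationalUpper ν hL) g
    rw [integral_descend_map_unipClass ν _ _ _ hs] at this
    · rw [coeff]
      convert this using 3 with Z
      dsimp only
      rw [unip_indicator_upperSet, superdiagonalSum_unip, AddChar.map_neg_eq_inv, ← hψq, map_sum q]
      congr 2
      refine congrArg ψ' (Finset.sum_congr rfl fun p _ => ?_)
      by_cases hp : (p.1 : ℕ) + 1 = p.2
      · rw [upperFreq, if_pos ⟨hp, p.2.2⟩, if_pos hp, one_smul, hL.map_section]
      · rw [upperFreq, if_neg fun h => hp h.1, if_neg hp, zero_smul, map_zero]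
    · refine Continuous.mul (Continuous.inv₀ ?_ fun u => ?_) ?_
      · exact hψ.comp (continuous_superdiagonalSum.comp continuous_subtype_val)
      · refine left_ne_zero_of_mul_eq_one (b := ψ (-superdiagonalSum u.1)) ?_
        rw [← AddChar.map_add_eq_mul, add_neg_cancel, AddChar.map_zero_eq_one]
      · exact hφ.continuous.comp (continuous_subtype_val.mul continuous_const)
    · rintro γ ⟨γ₀, hγ₀, hγ⟩ u
      have hγ : mirabolicMap n d γ₀ = γ := hγ
      change (ψ (superdiagonalSum (γ.1 * u.1)))⁻¹ * φ (γ.1 * u.1 * g) = _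
      rw [superdiagonalSum_mul γ.2 u.2, AddChar.map_add_eq_mul, mul_assoc, ← hγ, hinv,
        eq_unip_of_mem_upperUnipotent hγ₀, mirabolicMap_unip, superdiagonalSum_unip]
      have : ∑ p : Fin n × Fin n, (if (p.1 : ℕ) + 1 = p.2 then d (mirabolic.entry γ₀ p.1 p.2) else 0)
          = d (∑ p : Fin n × Fin n, if (p.1 : ℕ) + 1 = p.2 then mirabolic.entry γ₀ p.1 p.2 else 0) := by
        rw [map_sum]
        refine Finset.sum_congr rfl fun p _ => ?_
        split_ifs <;> simp
      rw [this, hψ_k, one_mul]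

end Integrality

section FundamentalDomain

open MeasureTheory Filter Topology

variable {k A : Type*} [Field k] [CommRing A] [TopologicalSpace A] [IsTopologicalRing A]
  [SecondCountableTopology A] {d : k →+* A}

theorem mem_of_exists_fundamental_domain
    (hD : ∃ D : Set A, IsOpen D ∧ IsCompact D ∧ ∀ a, ∃! x : k, d x + a ∈ D) {ψ : AddChar A ℂ}
    (hψ : Continuous ψ) (hψ_ne : ∃ a, ψ a ≠ 1) (hψ_k : ∀ x : k, ψ (d x) = 1)
    (hdual : ∀ χ : AddChar A ℂ, Continuous χ → (∀ x : k, χ (d x) = 1) →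
      ∃ x : k, ∀ a, χ a = ψ (d x * a))
    (I : AddSubgroup ℂ) {n : ℕ} (hn : 1 ≤ n) {φ : mirabolic n A → ℂ} (hφ : IsLocallyConstant φ)
    (hinv : ∀ (γ : mirabolic n k) g, φ (mirabolicMap n d γ * g) = φ g)
    (hcusp : ∀ m, 1 ≤ m → m < n → ∀ μ : Measure (LeftQuotient (rationalRadical d n m)),
      IsHaarProbability _ μ → ∀ g : mirabolic n A,
        ∫ x, LeftQuotient.descend (rationalRadical d n m) (fun u => φ (u * g)) x ∂μ = 0)
    (hW : ∀ μ : Measure (LeftQuotient (rationalUpper d n)), IsHaarProbability _ μ →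
      ∀ g : mirabolic n A, ∫ x, LeftQuotient.descend (rationalUpper d n)
        (fun u => (ψ (superdiagonalSum (u : mirabolic n A)))⁻¹ * φ (u * g)) x ∂μ ∈ I)
    (g : mirabolic n A) : φ g ∈ I := by
  obtain ⟨D, hDo, hDc, hD⟩ := hD
  let _ : Algebra k A := d.toAlgebra
  let W : Submodule k A := LinearMap.range (Algebra.linearMap k A)
  let q : A →+ A ⧸ W := W.mkQ.toAddMonoidHom
  have hquot : IsQuotientMap q := W.isQuotientMap_mkQ
  have hq0 : ∀ a, q a = 0 ↔ ∃ x : k, d x = a := fun a => Submodule.Quotient.mk_eq_zero W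
  choose x hx hx' using hD
  have hρ : ∀ (y : k) (a : A), d (x (d y + a)) + (d y + a) = d (x a) + a := fun y a => by
    have := hx' a (x (d y + a) + y) (by
      simp only; rw [map_add, add_assoc]; exact hx (d y + a))
    rw [← this, map_add, add_assoc]
  have hadd : ∀ a b, q a = q b → ∃ y : k, d y + a = b := fun a b hab => by
    obtain ⟨y, hy⟩ := (hq0 (b - a)).1 (by rw [map_sub, hab, sub_self])
    exact ⟨y, by rw [hy, sub_add_cancel]⟩
  let s (z : A ⧸ W) : A := d (x (Function.surjInv hquot.surjective z)) +
    Function.surjInv hquot.surjective z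
  have hsq : ∀ a, s (q a) = d (x a) + a := fun a => by
    obtain ⟨y, hy⟩ := hadd a _ (Function.surjInv_eq hquot.surjective (q a)).symm
    simp only [s]
    rw [← hy, hρ]
  have hdq : ∀ y : k, q (d y) = 0 := fun y => (hq0 _).2 ⟨y, rfl⟩
  have hqs : ∀ z, q (s z) = z := fun z => by
    simp only [s]
    rw [map_add, hdq, zero_add, Function.surjInv_eq hquot.surjective]
  have hs : Continuous s := by
    refine hquot.continuous_iff.2 (continuous_iff_continuousAt.2 fun a => ?_)
    have hc : Continuous fun b => d (x a) + b := continuous_const_add _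
    refine (hc.continuousAt (x := a)).congr ?_
    filter_upwards [(hDo.preimage hc).mem_nhds (hx a)] with b hb
    change _ = s (q b)
    rw [hsq, hx' b (x a) hb]
  have hL : IsLatticeQuotient d q s :=
    { map_diag := hdq
      map_mul := fun y a => W.mkQ.map_smul y a
      exists_add_eq := hadd
      continuous_section := hs
      map_section := hqs }
  have : CompactSpace (A ⧸ W) := by
    refine ⟨?_⟩
    have : q '' D = Set.univ := Set.eq_univ_of_forall fun z => by
      refine ⟨s z, hx _, hqs z⟩
    rw [← this]
    exact hDc.image hquot.continuous
  have : SecondCountableTopology (A ⧸ W) :=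
    (Function.LeftInverse.isEmbedding hqs hquot.continuous hs).secondCountableTopology
  have : ContinuousConstSMul k (A ⧸ W) := ⟨fun y => hquot.continuous_iff.2
    (hquot.continuous.comp (continuous_const_mul (d y)))⟩
  let _ : MeasurableSpace (A ⧸ W) := borel _
  have : BorelSpace (A ⧸ W) := ⟨rfl⟩
  let ν : Measure (A ⧸ W) := Measure.addHaarMeasure ⊤
  have : IsProbabilityMeasure ν := ⟨Measure.addHaarMeasure_self⟩
  have hψs : ∀ a, ψ (s (q a)) = ψ a := fun a => by
    rw [hsq, AddChar.map_add_eq_mul, hψ_k, one_mul]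
  let ψ' : AddChar (A ⧸ W) ℂ :=
    { toFun := fun z => ψ (s z)
      map_zero_eq_one' := by rw [← map_zero q, hψs, AddChar.map_zero_eq_one]
      map_add_eq_mul' := fun z w => by
        rw [← AddChar.map_add_eq_mul, ← hψs (s z + s w), map_add q, hqs, hqs] }
  have hψq : ∀ a, ψ' (q a) = ψ a := hψs
  refine mem_of_isLatticeQuotient ν hL hψ hψ_k (ψ' := ψ') (hψ.comp hs) hψq ?_ (fun χ hχ => ?_) I hn
    hφ hinv hcusp hW g
  · obtain ⟨a, ha⟩ := hψ_ne
    exact ⟨q a, by rwa [hψq]⟩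
  · obtain ⟨y, hy⟩ := hdual (χ.compAddMonoidHom q) (hχ.comp hquot.continuous) fun y => by
      rw [AddChar.compAddMonoidHom_apply, hdq, AddChar.map_zero_eq_one]
    refine ⟨y, fun z => ?_⟩
    have := hy (s z)
    rw [AddChar.compAddMonoidHom_apply, hqs, ← hψq, hL.map_mul, hqs] at this
    exact this

end FundamentalDomain

end GlobalFunctionField

open GlobalFunctionField MeasureTheory in
theorem theorem3p1 {k : Type*} [Field k] [IsGlobalFunctionField k] (p : ℕ) [Fact p.Prime]
    [CharP k p] (ψ : AddChar (AdeleRing k) ℂ) (hψ : Continuous ψ) (hψ_ne : ∃ a, ψ a ≠ 1)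
    (hψ_k : ∀ x : k, ψ (diagonal k x) = 1)
    (I : Submodule (Algebra.adjoin ℤ {ζ : ℂ | ζ ^ p = 1}) ℂ) (n : ℕ) (hn : 2 ≤ n)
    (φ : mirabolic n (AdeleRing k) → ℂ) (hφ_smooth : IsLocallyConstant φ)
    (hφ_inv : IsLeftInvariant φ) (hφ_cusp : IsCuspidal φ)
    (hφ_W : ∀ μ : Measure (LeftQuotient (rationalUpperUnipotent k n)), IsHaarProbability _ μ →
      ∀ g : mirabolic n (AdeleRing k), whittaker ψ μ φ g ∈ I)
    (g : mirabolic n (AdeleRing k)) : φ g ∈ I := by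
  have hdual : ∀ χ : AddChar (AdeleRing k) ℂ, Continuous χ → (∀ x : k, χ (diagonal k x) = 1) →
      ∃ x : k, ∀ a : AdeleRing k, χ a = ψ (diagonal k x * a) := fun χ hχ hχ_k =>
    exists_eq_mul_of_trivial_on_diagonal p ψ χ hψ hχ hψ_ne hψ_k hχ_k
  exact mem_of_exists_fundamental_domain exists_fundamental_domain hψ hψ_ne hψ_k hdual
    I.toAddSubgroup (by omega) hφ_smooth hφ_inv hφ_cusp hφ_W g
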